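/- Let $(S,\Omega)$ be a finite-dimensional connected (Hausdorff, second countable, smooth, boundaryless) symplectic manifold, let $h\in C^\infty(S)$ be real-valued and let $\beta>0$. For real smooth $f$ let $X_f$ be the Hamiltonian vector field defined by $\Omega(X_f,\cdot)=df$, put $\{f,g\}=\Omega(X_f,X_g)$ (so $\{f,g\}=X_g(f)$), extend $\{\cdot,\cdot\}$ complex bilinearly to complex-valued functions, and write $Y^h=X_h$. Let $\mu_0$ be the Liouville measure, i.e. the measure given by the volume form $\Omega^n/n!$, $\dim S=2n$. Let $C_0(S)$ be the algebra of continuous complex functions vanishing at infinity with the uniform norm. A Poisson $*$-subalgebra of $C_0(S)$ is a $*$-subalgebra $\tilde{\mathfrak A}_0$ of $C_0(S)$ that consists of smooth functions and is closed under $\{\cdot,\cdot\}$; the compactly supported smooth functions form such an algebra $C_c^\infty(S)$. For $\tilde{\mathfrak A}_0\supseteq C_c^\infty(S)$, a linear functional $\varphi:\tilde{\mathfrak A}_0\to\mathbb C$ is called a classical $(Y^h,\beta)$-KMS functional if $\varphi(\bar f f)\ge 0$ for all $f\in\tilde{\mathfrak A}_0$ and $$\varphi(\{f,g\})=\beta\,\varphi(Y^h(f)\,g)$$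 for all $f,g\in\tilde{\mathfrak A}_0$ with $Y^h(f)g\in\tilde{\mathfrak A}_0$ (for $\tilde{\mathfrak A}_0=C_c^\infty(S)$ these are all $f,g$). Assume $e^{-\beta h}\in L^1(S,\mu_0)$. Then $$\varphi^\beta(f):=\int_S e^{-\beta h}f\,d\mu_0\qquad (f\in C_0(S))$$ defines a continuous positive linear functional on $C_0(S)$, and: 1. The classical $(Y^h,\beta)$-KMS functionals on $C_c^\infty(S)$ are exactly the functionals $c\,\varphi^\beta|_{C_c^\infty(S)}$ with $c\ge 0$. 2. For every Poisson $*$-subalgebra $\tilde{\mathfrak A}_0$ of $C_0(S)$ containing $C_c^\infty(S)$: the restriction of $\varphi^\beta$ to $\tilde{\mathfrak A}_0$ is a classical $(Y^h,\beta)$-KMS functional; every linear functional $\varphi$ on $\tilde{\mathfrak A}_0$ that is continuous in the uniform norm and whose restriction to $C_c^\infty(S)$ is a classical $(Y^h,\beta)$-KMS functional (in particular, every classical $(Y^h,\beta)$-KMS functional on $\tilde{\mathfrak A}_0$ that is continuous in the uniform norm) equals $c\,\varphi^\beta|_{\tilde{\mathfrak A}_0}$ for some $c\ge 0$; and $\varphi^\beta$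 is the only linear functional on $C_0(S)$ that extends $\varphi^\beta|_{\tilde{\mathfrak A}_0}$ and is continuous or positive. -/

import Mathlib

open scoped Manifold ContDiff ComplexOrder ZeroAtInfty

noncomputable section

namespace ClassicalKMS

open MeasureTheory

section Symplectic

variable {d : ℕ} {M : Type*} [TopologicalSpace M] [ChartedSpace (EuclideanSpace ℝ (Fin d)) M]

/-- The coordinate expression in the chart `e` of a `2`-form on `M`, that is, its pullback under
`e⁻¹`. Only its values on the open set `e.target` are meaningful. -/
def chartForm (η : ∀ x : M, TangentSpace (𝓡 d) x [⋀^Fin 2]→L[ℝ] ℝ)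
    (e : OpenPartialHomeomorph M (EuclideanSpace ℝ (Fin d))) (y : EuclideanSpace ℝ (Fin d)) :
    EuclideanSpace ℝ (Fin d) [⋀^Fin 2]→L[ℝ] ℝ :=
  (η (e.symm y)).compContinuousLinearMap (mfderiv (𝓡 d) (𝓡 d) e.symm y)

variable (d M) in
/-- A symplectic form on the `d`-dimensional manifold `M`: a smooth, closed, pointwise
nondegenerate `2`-form. -/
structure SymplecticForm where
  /-- The alternating form on each tangent space. -/
  form : ∀ x : M, TangentSpace (𝓡 d) x [⋀^Fin 2]→L[ℝ] ℝ
  smooth : ∀ e ∈ atlas (EuclideanSpace ℝ (Fin d)) M, ContDiffOn ℝ ∞ (chartForm form e) e.target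
  closed : ∀ e ∈ atlas (EuclideanSpace ℝ (Fin d)) M, ∀ y ∈ e.target,
    extDeriv (chartForm form e) y = 0
  nondegenerate : ∀ (x : M) (v : TangentSpace (𝓡 d) x),
    (∀ w : TangentSpace (𝓡 d) x, form x ![v, w] = 0) → v = 0

theorem update_pair_zero {V : Type*} (a b c : V) : Function.update ![a, b] 0 c = ![c, b] := by
  ext i; fin_cases i <;> rfl

theorem update_pair_one {V : Type*} (a b c : V) : Function.update ![a, b] 1 c = ![a, c] := by
  ext i; fin_cases i <;> rfl

/-- The map `v ↦ Ω(v, ·)` from a tangent space to its dual. -/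
def SymplecticForm.flat (Ω : SymplecticForm d M) (x : M) :
    TangentSpace (𝓡 d) x →ₗ[ℝ] Module.Dual ℝ (TangentSpace (𝓡 d) x) :=
  LinearMap.mk₂ ℝ (fun v w => Ω.form x ![v, w])
    (fun v v' w => by
      simpa only [update_pair_zero] using (Ω.form x).map_update_add ![v, w] 0 v v')
    (fun c v w => by
      simpa only [update_pair_zero] using (Ω.form x).map_update_smul ![v, w] 0 c v)
    (fun v w w' => by
      simpa only [update_pair_one] using (Ω.form x).map_update_add ![v, w] 1 w w')
    (fun c v w => by
      simpa only [update_pair_one] using (Ω.form x).map_update_smul ![v, w] 1 c w)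

theorem SymplecticForm.flat_injective (Ω : SymplecticForm d M) (x : M) :
    Function.Injective (Ω.flat x) := by
  rw [← LinearMap.ker_eq_bot, LinearMap.ker_eq_bot']
  intro v hv
  exact Ω.nondegenerate x v fun w => LinearMap.congr_fun hv w

instance (x : M) : FiniteDimensional ℝ (TangentSpace (𝓡 d) x) :=
  inferInstanceAs (FiniteDimensional ℝ (EuclideanSpace ℝ (Fin d)))

/-- The isomorphism `v ↦ Ω(v, ·)` from a tangent space onto its dual. -/
def SymplecticForm.flatEquiv (Ω : SymplecticForm d M) (x : M) :
    TangentSpace (𝓡 d) x ≃ₗ[ℝ] Module.Dual ℝ (TangentSpace (𝓡 d) x) :=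
  (Ω.flat x).linearEquivOfInjective (Ω.flat_injective x) Subspace.dual_finrank_eq.symm

/-- The Hamiltonian vector field `X_f` of `f`, determined by `Ω(X_f, ·) = df`. -/
def SymplecticForm.hamiltonianField (Ω : SymplecticForm d M) (f : M → ℝ) (x : M) :
    TangentSpace (𝓡 d) x :=
  (Ω.flatEquiv x).symm (mfderiv (𝓡 d) 𝓘(ℝ, ℝ) f x).toLinearMap

theorem SymplecticForm.form_hamiltonianField (Ω : SymplecticForm d M) (f : M → ℝ) (x : M)
    (w : TangentSpace (𝓡 d) x) :
    Ω.form x ![Ω.hamiltonianField f x, w] = mfderiv (𝓡 d) 𝓘(ℝ, ℝ) f x w :=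
  LinearMap.congr_fun ((Ω.flatEquiv x).apply_symm_apply (mfderiv (𝓡 d) 𝓘(ℝ, ℝ) f x).toLinearMap) w

/-- The Poisson bracket `{f, g} = Ω(X_f, X_g)` of real functions. Since `Ω(X_f, ·) = df`, it is
also `X_g f`. -/
def SymplecticForm.bracketReal (Ω : SymplecticForm d M) (f g : M → ℝ) (x : M) : ℝ :=
  Ω.form x ![Ω.hamiltonianField f x, Ω.hamiltonianField g x]

/-- The complex bilinear extension of the Poisson bracket to complex-valued functions. -/
def SymplecticForm.bracket (Ω : SymplecticForm d M) (f g : M → ℂ) (x : M) : ℂ :=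
  ((Ω.bracketReal (fun z => (f z).re) (fun z => (g z).re) x
      - Ω.bracketReal (fun z => (f z).im) (fun z => (g z).im) x : ℝ) : ℂ)
    + Complex.I * ((Ω.bracketReal (fun z => (f z).re) (fun z => (g z).im) x
      + Ω.bracketReal (fun z => (f z).im) (fun z => (g z).re) x : ℝ) : ℂ)

/-- The derivative `Y(f)` of a complex-valued function along a vector field. -/
def vectorFieldApply (Y : ∀ x : M, TangentSpace (𝓡 d) x) (f : M → ℂ) (x : M) : ℂ :=
  mfderiv (𝓡 d) 𝓘(ℝ, ℂ) f x (Y x)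

/-- The density of `|Ωⁿ / n!|`, `d = 2n`, with respect to Lebesgue measure in the chart `e`.
The coefficient of `Ωⁿ / n!` in coordinates is the Pfaffian of the matrix `(Ω_ij)`, the square of
which is the determinant, so the density is `√(det (Ω_ij))`. -/
def SymplecticForm.chartDensity (Ω : SymplecticForm d M)
    (e : OpenPartialHomeomorph M (EuclideanSpace ℝ (Fin d))) (y : EuclideanSpace ℝ (Fin d)) : ℝ :=
  √(Matrix.of fun i j : Fin d => chartForm Ω.form e y
    ![EuclideanSpace.single i (1 : ℝ), EuclideanSpace.single j (1 : ℝ)]).det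

/-- The part of the Liouville measure that lives on the domain of the chart `e`. -/
def SymplecticForm.chartMeasure [MeasurableSpace M] (Ω : SymplecticForm d M)
    (e : OpenPartialHomeomorph M (EuclideanSpace ℝ (Fin d))) : Measure M :=
  ((volume.restrict e.target).withDensity
    fun y => ENNReal.ofReal (Ω.chartDensity e y)).map e.symm

/-- The Liouville measure, that is, the measure of the volume form `Ωⁿ / n!`. By the change of
variables formula, the measures `Ω.chartMeasure e` and `Ω.chartMeasure e'` agree on subsets of
`e.source ∩ e'.source`; the supremum, in the lattice of measures, glues them together to the
measure whose restriction to each `e.source` is `Ω.chartMeasure e`. -/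
def SymplecticForm.liouville [MeasurableSpace M] (Ω : SymplecticForm d M) : Measure M :=
  ⨆ e ∈ atlas (EuclideanSpace ℝ (Fin d)) M, Ω.chartMeasure e

end Symplectic

section Functionals

variable {d : ℕ} {M : Type*} [TopologicalSpace M] [ChartedSpace (EuclideanSpace ℝ (Fin d)) M]

variable (d M) in
/-- The `*`-algebra of compactly supported smooth functions on `M`, inside `C₀(M, ℂ)`. -/
def smoothCompact : NonUnitalStarSubalgebra ℂ C₀(M, ℂ) where
  carrier := {f | ContMDiff (𝓡 d) 𝓘(ℝ, ℂ) ∞ f ∧ HasCompactSupport f}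
  add_mem' := fun {f g} hf hg => by
    refine ⟨?_, ?_⟩
    · rw [ZeroAtInftyContinuousMap.coe_add]; exact hf.1.add hg.1
    · rw [ZeroAtInftyContinuousMap.coe_add]; exact hf.2.add hg.2
  zero_mem' := ⟨contMDiff_const, HasCompactSupport.zero⟩
  mul_mem' := fun {f g} hf hg => by
    refine ⟨?_, ?_⟩
    · rw [ZeroAtInftyContinuousMap.coe_mul]
      exact (contDiff_mul (𝕜 := ℝ) (𝔸 := ℂ)).contMDiff.comp (hf.1.prodMk_space hg.1)
    · rw [ZeroAtInftyContinuousMap.coe_mul]; exact hf.2.mul_right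
  smul_mem' := fun c f hf => by
    refine ⟨?_, ?_⟩
    · rw [ZeroAtInftyContinuousMap.coe_smul]
      exact (contDiff_const_smul (𝕜 := ℝ) (F := ℂ) c).contMDiff.comp hf.1
    · rw [ZeroAtInftyContinuousMap.coe_smul]; exact hf.2.smul_left (f := fun _ => c)
  star_mem' := fun {f} hf => by
    refine ⟨?_, ?_⟩
    · exact Complex.conjCLE.contDiff.contMDiff.comp hf.1
    · exact hf.2.comp_left (g := star) (star_zero ℂ)

/-- `A` is a Poisson `*`-subalgebra of `C₀(M, ℂ)`: a `*`-subalgebra that consists of smooth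
functions and is closed under the Poisson bracket. -/
structure IsPoissonStarSubalgebra (Ω : SymplecticForm d M)
    (A : NonUnitalStarSubalgebra ℂ C₀(M, ℂ)) : Prop where
  smooth : ∀ f ∈ A, ContMDiff (𝓡 d) 𝓘(ℝ, ℂ) ∞ f
  bracket_mem : ∀ f ∈ A, ∀ g ∈ A, ∃ k ∈ A, ∀ x, k x = Ω.bracket f g x

/-- The linear functional `φ` on the `*`-algebra `A` is a classical `(Y, β)`-KMS functional: it is
positive, and `φ({f, g}) = β φ(Y(f) g)` for all `f` and `g` in `A`. As `φ` is only defined on `A`,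
the condition is about the `f`, `g` for which `k = {f, g}` and `l = Y(f) g` belong to `A`; for
the algebra of compactly supported smooth functions (and smooth `Y`) these are all `f` and `g`. -/
structure IsKMSFunctional (Ω : SymplecticForm d M) (Y : ∀ x : M, TangentSpace (𝓡 d) x) (β : ℝ)
    (A : NonUnitalStarSubalgebra ℂ C₀(M, ℂ)) (φ : A →ₗ[ℂ] ℂ) : Prop where
  positive : ∀ f : A, 0 ≤ φ (star f * f)
  kms : ∀ f g k l : A, (∀ x, k.1 x = Ω.bracket f.1 g.1 x) →
    (∀ x, l.1 x = vectorFieldApply Y f.1 x * g.1 x) → φ k = β * φ l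

/-- The restriction of a linear functional on `A` to a smaller subalgebra `B`. -/
def restrictFunctional {A B : NonUnitalStarSubalgebra ℂ C₀(M, ℂ)} (hBA : B ≤ A)
    (φ : A →ₗ[ℂ] ℂ) : B →ₗ[ℂ] ℂ where
  toFun f := φ ⟨f.1, hBA f.2⟩
  map_add' f g := φ.map_add ⟨f.1, hBA f.2⟩ ⟨g.1, hBA g.2⟩
  map_smul' c f := φ.map_smul c ⟨f.1, hBA f.2⟩

/-- The restriction of a linear functional on `C₀(M, ℂ)` to a `*`-subalgebra. -/
def restrictTo (A : NonUnitalStarSubalgebra ℂ C₀(M, ℂ)) (Φ : C₀(M, ℂ) →ₗ[ℂ] ℂ) : A →ₗ[ℂ] ℂ where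
  toFun f := Φ f.1
  map_add' f g := Φ.map_add f.1 g.1
  map_smul' c f := Φ.map_smul c f.1

end Functionals

end ClassicalKMS

end

/-! Both halves rest on two facts about the Liouville integral: it annihilates Poisson brackets, and
on a connected manifold it is, up to a factor, the only linear functional on test functions that
does.

Existence. In a chart with matrix `W` of `Ω`, the density is `√(det W)`, and closedness of `Ω` makes
the tensor `√(det W) W⁻¹` divergence free (`sum_pderiv_sqrt_det_mul_inv`). Hence the density times
`{F, G}` is a divergence, and a partition of unity gives `∫ {F, G} = 0` when one factor has compact
support (`integral_bracketReal_eq_zero`). Since `{f, e^{-βh} g} = e^{-βh} ({f, g} - β {f, h} g)` and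
`{f, h} = Y^h(f)`, the KMS identity for the Gibbs functional says that `∫ {f, e^{-βh} g} = 0`. On a
general Poisson algebra neither `f` nor `g` has compact support, and derivatives of an arbitrary
cutoff would not be controlled. The cutoff is therefore taken to be a function `χₙ(f)` of `f`
itself: it has compact support because `f` vanishes at infinity, and it commutes with `f` under the
bracket, so no error term arises (`integral_bracketReal_eq_zero_of_tendsto`).

Uniqueness. If `φ` is KMS on the compactly supported smooth functions, the same identity with the
opposite sign shows that `f ↦ φ(e^{βh} f)` kills all brackets (`twistedFunctional_bracketReal`). In
a chart every coordinate derivative of a test function is, after division by the density, a sum of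
brackets (`exists_sum_bracketReal_eq_pderiv`). By the compactly supported Poincaré lemma in top
degree a test function in a cube is its integral times a fixed bump plus such derivatives, so the
functional is locally a multiple of the Liouville integral. Overlaps and connectedness make the
factor global (`exists_eq_mul_integral`), and positivity makes it nonnegative. No continuity of `φ`
is involved.

On larger algebras, uniform density of the smooth compactly supported functions
(`exists_smoothCompact_dist_le`) and automatic continuity of positive functionals on a C*-algebra
(`continuous_of_star_mul_self_nonneg`) finish the proof. -/

noncomputable section

namespace ClassicalKMS

open MeasureTheory

/-! ### Matrix calculus: the weighted inverse of a closed skew matrix field is divergence free. -/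

section MatrixCalculus

/-- The partial derivative of a function on Euclidean space in the direction of a coordinate. -/
def pderiv {d : ℕ} (k : Fin d) (u : EuclideanSpace ℝ (Fin d) → ℝ) (y : EuclideanSpace ℝ (Fin d)) :
    ℝ :=
  fderiv ℝ u y (EuclideanSpace.single k 1)

variable {d : ℕ}

/-- The segment from `A` to the identity stays invertible: if `(1 - s) A v + s v = 0`, pairing with
`v` and using `v · A v = 0` leaves `s |v|² = 0`. So the determinant cannot change sign on the way to
`det 1 = 1`. -/
theorem det_pos_of_transpose_eq_neg {A : Matrix (Fin d) (Fin d) ℝ} (hA : A.transpose = -A)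
    (h0 : A.det ≠ 0) : 0 < A.det := by
  by_contra hneg
  push Not at hneg
  have hcont : Continuous fun s : ℝ => ((1 - s) • A + s • (1 : Matrix (Fin d) (Fin d) ℝ)).det := by
    fun_prop
  obtain ⟨s, hs, hs0⟩ : (0 : ℝ) ∈ (fun s : ℝ =>
      ((1 - s) • A + s • (1 : Matrix (Fin d) (Fin d) ℝ)).det) '' Set.Icc 0 1 :=
    intermediate_value_Icc zero_le_one hcont.continuousOn (by simpa using hneg)
  have hs1 : s ≠ 0 := by
    rintro rfl
    simp at hs0
    exact h0 hs0
  obtain ⟨v, hv, hv0⟩ := Matrix.exists_mulVec_eq_zero_iff.2 hs0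
  have hskew : v ⬝ᵥ A.mulVec v = 0 := by
    have h1 : v ⬝ᵥ A.mulVec v = A.transpose.mulVec v ⬝ᵥ v := by
      rw [Matrix.dotProduct_mulVec, Matrix.mulVec_transpose]
    rw [hA, Matrix.neg_mulVec, neg_dotProduct, dotProduct_comm (A.mulVec v)] at h1
    linarith
  have h2 : v ⬝ᵥ (((1 - s) • A + s • (1 : Matrix (Fin d) (Fin d) ℝ)).mulVec v) = 0 := by
    rw [hv0, dotProduct_zero]
  rw [Matrix.add_mulVec, Matrix.smul_mulVec, Matrix.smul_mulVec, Matrix.one_mulVec,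
    dotProduct_add, dotProduct_smul, dotProduct_smul, hskew] at h2
  have h3 : s * (v ⬝ᵥ v) = 0 := by simpa using! h2
  exact hv (dotProduct_self_eq_zero.1 ((mul_eq_zero.1 h3).resolve_left hs1))

variable {E : Type*} [NormedAddCommGroup E] [NormedSpace ℝ E] {n : WithTop ℕ∞}
  {W : E → Matrix (Fin d) (Fin d) ℝ} {y : E}

theorem contDiffAt_matrix_det (hW : ∀ i j, ContDiffAt ℝ n (fun z => W z i j) y) :
    ContDiffAt ℝ n (fun z => (W z).det) y := by
  simp only [Matrix.det_apply]
  refine ContDiffAt.sum fun σ _ => ?_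
  exact (contDiffAt_prod fun i _ => hW _ _).const_smul _

theorem contDiffAt_matrix_inv (hW : ∀ i j, ContDiffAt ℝ n (fun z => W z i j) y)
    (h0 : (W y).det ≠ 0) (i j : Fin d) : ContDiffAt ℝ n (fun z => (W z)⁻¹ i j) y := by
  have h : (fun z => (W z)⁻¹ i j)
      = fun z => ((W z).det)⁻¹ * ((W z).updateRow j (Pi.single i 1)).det := by
    funext z
    rw [Matrix.inv_def, Matrix.smul_apply, Matrix.adjugate_apply, Ring.inverse_eq_inv', smul_eq_mul]
  rw [h]
  refine ((contDiffAt_matrix_det hW).inv h0).mul (contDiffAt_matrix_det fun k l => ?_)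
  by_cases hk : k = j
  · subst hk
    simp only [Matrix.updateRow_self]
    exact contDiffAt_const
  · simp only [Matrix.updateRow_ne hk]
    exact hW k l

/-- Jacobi's formula. Differentiating the Leibniz expansion replaces one column at a time by its
derivative, and by Cramer's rule the resulting determinants are the diagonal entries of `adj(W) W'`.
-/
theorem fderiv_matrix_det (hW : ∀ i j, DifferentiableAt ℝ (fun z => W z i j) y) (v : E) :
    fderiv ℝ (fun z => (W z).det) y v
      = ((W y).adjugate * Matrix.of fun i j => fderiv ℝ (fun z => W z i j) y v).trace := by
  have h1 : HasFDerivAt (fun z => (W z).det) (∑ σ : Equiv.Perm (Fin d),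
      Equiv.Perm.sign σ • ∑ i, (∏ j ∈ Finset.univ.erase i, W y (σ j) j) •
        fderiv ℝ (fun z => W z (σ i) i) y) y := by
    simp only [Matrix.det_apply]
    refine HasFDerivAt.fun_sum fun σ _ => ?_
    refine HasFDerivAt.const_smul ?_ _
    exact HasFDerivAt.finsetProd fun i _ => (hW (σ i) i).hasFDerivAt
  rw [h1.fderiv]
  have h2 : ∀ i, ((W y).adjugate * Matrix.of fun i j => fderiv ℝ (fun z => W z i j) y v) i i
      = ((W y).updateCol i fun k => fderiv ℝ (fun z => W z k i) y v).det := by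
    intro i
    rw [← Matrix.cramer_apply, Matrix.cramer_eq_adjugate_mulVec]
    rfl
  simp only [Matrix.trace, Matrix.diag_apply, h2, Matrix.det_apply]
  rw [Finset.sum_comm, sum_apply]
  refine Finset.sum_congr rfl fun σ _ => ?_
  rw [smul_apply, sum_apply, Finset.smul_sum]
  refine Finset.sum_congr rfl fun i _ => ?_
  congr 1
  rw [← Finset.mul_prod_erase _ _ (Finset.mem_univ i), Matrix.updateCol_self,
    smul_apply, smul_eq_mul, mul_comm]
  congr 1
  refine Finset.prod_congr rfl fun j hj => ?_
  rw [Matrix.updateCol_ne (Finset.ne_of_mem_erase hj)]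

/-- Obtained by differentiating `W W⁻¹ = 1`, which holds near `y` because invertibility is an open
condition. -/
theorem fderiv_matrix_inv (hW : ∀ i j, ContDiffAt ℝ 1 (fun z => W z i j) y)
    (h0 : (W y).det ≠ 0) (v : E) :
    (Matrix.of fun i j => fderiv ℝ (fun z => (W z)⁻¹ i j) y v)
      = -((W y)⁻¹ * (Matrix.of fun i j => fderiv ℝ (fun z => W z i j) y v) * (W y)⁻¹) := by
  have hP := contDiffAt_matrix_inv hW h0
  have hev : ∀ᶠ z in nhds y, (W z).det ≠ 0 :=
    (contDiffAt_matrix_det hW).continuousAt.eventually_ne h0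
  have key : (Matrix.of fun i j => fderiv ℝ (fun z => W z i j) y v) * (W y)⁻¹
      + W y * (Matrix.of fun i j => fderiv ℝ (fun z => (W z)⁻¹ i j) y v) = 0 := by
    ext i j
    have h1 : (fun z : E => ∑ k, W z i k * (W z)⁻¹ k j) =ᶠ[nhds y]
        fun _ => (1 : Matrix (Fin d) (Fin d) ℝ) i j := by
      filter_upwards [hev] with z hz
      rw [← Matrix.mul_apply, Matrix.mul_nonsing_inv _ (isUnit_iff_ne_zero.2 hz)]
    have h2 := h1.fderiv_eq (𝕜 := ℝ)
    rw [fderiv_fun_sum (fun k _ => ((hW i k).differentiableAt one_ne_zero).fun_mul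
      ((hP k j).differentiableAt one_ne_zero)), fderiv_const_apply] at h2
    have h3 := congrArg (fun L => L v) h2
    simp only [sum_apply, zero_apply] at h3
    rw [Matrix.add_apply, Matrix.mul_apply, Matrix.mul_apply, ← Finset.sum_add_distrib,
      Matrix.zero_apply, ← h3]
    refine Finset.sum_congr rfl fun k _ => ?_
    rw [fderiv_fun_mul ((hW i k).differentiableAt one_ne_zero)
      ((hP k j).differentiableAt one_ne_zero)]
    simp only [Matrix.of_apply, add_apply, smul_apply,
      smul_eq_mul]
    ring
  have hu : IsUnit (W y).det := isUnit_iff_ne_zero.2 h0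
  have h4 := congrArg (fun N => (W y)⁻¹ * N) key
  simp only [Matrix.mul_add, Matrix.mul_zero, ← Matrix.mul_assoc, Matrix.nonsing_inv_mul _ hu,
    Matrix.one_mul] at h4
  exact eq_neg_of_add_eq_zero_right h4

/-- Meant for `P = W⁻¹` and `w i j k = ∂ᵢ W j k`, where the two sides come from differentiating
`W⁻¹` and `√(det W)`. Relabelling indices and using skew-symmetry puts every sum over the common
factor `P a c * P e b`; the coefficients then add up to the cyclic sum. -/
theorem sum_contract_of_cyclic {P : Fin d → Fin d → ℝ} {w : Fin d → Fin d → Fin d → ℝ}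
    (hP : ∀ i j, P i j = -P j i) (hw : ∀ i j k, w i j k = -w i k j)
    (hc : ∀ i j k, w i j k + w j k i + w k i j = 0) (a : Fin d) :
    2 * ∑ b, ∑ c, ∑ e, P a c * w b c e * P e b = ∑ b, ∑ c, ∑ e, P e c * w b c e * P a b := by
  have h1 : ∑ b, ∑ c, ∑ e, P a c * w b c e * P e b = ∑ b, ∑ c, ∑ e, P a c * w e b c * P e b := by
    calc _ = ∑ c, ∑ b, ∑ e, P a c * w b c e * P e b := Finset.sum_comm
      _ = ∑ c, ∑ e, ∑ b, P a c * w b c e * P e b :=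
        Finset.sum_congr rfl fun c _ => Finset.sum_comm
      _ = ∑ c, ∑ b, ∑ e, P a c * w e b c * P e b := by
        refine Finset.sum_congr rfl fun c _ => Finset.sum_congr rfl fun b _ =>
          Finset.sum_congr rfl fun e _ => ?_
        rw [hP b e, hw e c b]; ring
      _ = _ := Finset.sum_comm
  have h2 : ∑ b, ∑ c, ∑ e, P e c * w b c e * P a b
      = ∑ b, ∑ c, ∑ e, -(P a c * w c e b * P e b) := by
    calc _ = ∑ c, ∑ b, ∑ e, P e c * w b c e * P a b := Finset.sum_comm
      _ = _ := by
        refine Finset.sum_congr rfl fun b _ => Finset.sum_congr rfl fun c _ =>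
          Finset.sum_congr rfl fun e _ => ?_
        rw [hw c b e]; ring
  rw [h2, two_mul]
  nth_rewrite 2 [h1]
  rw [← Finset.sum_add_distrib]
  refine Finset.sum_congr rfl fun b _ => ?_
  rw [← Finset.sum_add_distrib]
  refine Finset.sum_congr rfl fun c _ => ?_
  rw [← Finset.sum_add_distrib]
  refine Finset.sum_congr rfl fun e _ => ?_
  linear_combination (P a c * P e b) * hc b c e

/-- In coordinates, the Poisson tensor of a closed nondegenerate two-form, multiplied by the
Liouville density, is divergence free. -/
theorem sum_pderiv_sqrt_det_mul_inv {W : EuclideanSpace ℝ (Fin d) → Matrix (Fin d) (Fin d) ℝ}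
    {y : EuclideanSpace ℝ (Fin d)} (hW : ∀ i j, ContDiffAt ℝ 1 (fun z => W z i j) y)
    (hskew : ∀ z i j, W z i j = -W z j i) (h0 : (W y).det ≠ 0)
    (hclosed : ∀ i j k, pderiv i (fun z => W z j k) y + pderiv j (fun z => W z k i) y
      + pderiv k (fun z => W z i j) y = 0) (a : Fin d) :
    ∑ b, pderiv b (fun z => √(W z).det * (W z)⁻¹ a b) y = 0 := by
  have hT : ∀ z, (W z).transpose = -W z := fun z => by
    ext i j; exact hskew z j i
  have hpos : 0 < (W y).det := det_pos_of_transpose_eq_neg (hT y) h0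
  have hPs : ∀ i j, (W y)⁻¹ i j = -(W y)⁻¹ j i := by
    intro i j
    have : ((W y)⁻¹).transpose = -(W y)⁻¹ := by
      rw [Matrix.transpose_nonsing_inv, hT]
      refine Matrix.inv_eq_left_inv ?_
      rw [neg_mul_neg, Matrix.nonsing_inv_mul _ (isUnit_iff_ne_zero.2 h0)]
    exact congrFun (congrFun this j) i
  have hdet := contDiffAt_matrix_det hW
  have hinv := contDiffAt_matrix_inv hW h0
  -- Product rule: the square root contributes `½ tr(W⁻¹ ∂W) W⁻¹` by Jacobi's formula, the inverse
  -- contributes `-W⁻¹ ∂W W⁻¹`.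
  have hterm : ∀ b, pderiv b (fun z => √(W z).det * (W z)⁻¹ a b) y
      = √(W y).det * (1 / 2 * ∑ c, ∑ e, (W y)⁻¹ e c * pderiv b (fun z => W z c e) y * (W y)⁻¹ a b
        - ∑ c, ∑ e, (W y)⁻¹ a c * pderiv b (fun z => W z c e) y * (W y)⁻¹ e b) := by
    intro b
    have hs : HasFDerivAt (fun z => √(W z).det)
        ((1 / (2 * √(W y).det)) • fderiv ℝ (fun z => (W z).det) y) y :=
      (hdet.differentiableAt one_ne_zero).hasFDerivAt.sqrt h0
    have hm := hs.fun_mul ((hinv a b).differentiableAt one_ne_zero).hasFDerivAt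
    have hi : fderiv ℝ (fun z => (W z)⁻¹ a b) y (EuclideanSpace.single b 1)
        = -∑ c, ∑ e, (W y)⁻¹ a c * pderiv b (fun z => W z c e) y * (W y)⁻¹ e b := by
      have := congrFun (congrFun (fderiv_matrix_inv hW h0 (EuclideanSpace.single b 1)) a) b
      rw [Matrix.of_apply] at this
      rw [this, Matrix.neg_apply, Matrix.mul_apply]
      simp only [Matrix.mul_apply, Finset.sum_mul, Matrix.of_apply]
      rw [Finset.sum_comm]
      rfl
    have hd : fderiv ℝ (fun z => (W z).det) y (EuclideanSpace.single b 1)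
        = (W y).det * ∑ c, ∑ e, (W y)⁻¹ e c * pderiv b (fun z => W z c e) y := by
      rw [fderiv_matrix_det (fun i j => (hW i j).differentiableAt one_ne_zero)]
      have hadj : (W y).adjugate = (W y).det • (W y)⁻¹ := by
        rw [Matrix.inv_def, Ring.inverse_eq_inv', smul_smul, mul_inv_cancel₀ h0, one_smul]
      rw [hadj, Matrix.smul_mul, Matrix.trace_smul, smul_eq_mul]
      congr 1
      simp only [Matrix.trace, Matrix.diag_apply, Matrix.mul_apply, Matrix.of_apply]
      rw [Finset.sum_comm]
      rfl
    have h5 := hm.fderiv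
    unfold pderiv at *
    rw [h5]
    simp only [add_apply, smul_apply, smul_eq_mul, hi, hd]
    have hsq : (W y).det = √(W y).det * √(W y).det := (Real.mul_self_sqrt hpos.le).symm
    have hne : √(W y).det ≠ 0 := (Real.sqrt_pos.2 hpos).ne'
    simp only [← Finset.sum_mul]
    nth_rewrite 3 [hsq]
    field_simp
    ring
  simp only [hterm]
  rw [← Finset.mul_sum, Finset.sum_sub_distrib, ← Finset.mul_sum]
  -- Closedness enters here: after summation over `b` the two contributions cancel by the cyclic
  -- identity.
  have := sum_contract_of_cyclic (P := fun i j => (W y)⁻¹ i j)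
    (w := fun i j k => pderiv i (fun z => W z j k) y) hPs (fun i j k => by
      have : (fun z => W z j k) = fun z => -W z k j := by funext z; exact hskew z j k
      simp only [pderiv, this, fderiv_fun_neg, neg_apply]) hclosed a
  rw [← this]
  ring

end MatrixCalculus

/-! ### The Poincaré lemma with compact supports in top degree, on cubes. -/

section CompactPoincare

variable {d : ℕ}

theorem integral_pderiv_eq_zero {u : EuclideanSpace ℝ (Fin d) → ℝ} (hu : ContDiff ℝ 1 u)
    (hc : HasCompactSupport u) (k : Fin d) : ∫ x, pderiv k u x = 0 := by
  have hd : Continuous fun x => fderiv ℝ u x (EuclideanSpace.single k 1) :=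
    (hu.continuous_fderiv one_ne_zero).clm_apply continuous_const
  have hdc : HasCompactSupport fun x => fderiv ℝ u x (EuclideanSpace.single k 1) :=
    hc.fderiv_apply (𝕜 := ℝ) _
  have := integral_mul_fderiv_eq_neg_fderiv_mul_of_integrable (𝕜 := ℝ) (μ := volume)
    (f := fun _ : EuclideanSpace ℝ (Fin d) => (1 : ℝ)) (g := u)
    (v := EuclideanSpace.single k 1) (by simp)
    (by simpa using hd.integrable_of_hasCompactSupport hdc)
    (by simpa using hu.continuous.integrable_of_hasCompactSupport hc)
    (by simp) (fun x _ => (hu.differentiable one_ne_zero) x)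
  simpa [pderiv] using this

/-- An integral along a coordinate line is a convolution with Lebesgue measure pushed onto the axis
by `t ↦ -t eₖ`. Finiteness on compacts makes the smoothness theorem for convolutions applicable. -/
theorem isFiniteMeasureOnCompacts_map_single (k : Fin d) (S : Set ℝ) :
    IsFiniteMeasureOnCompacts ((volume.restrict S).map
      fun t : ℝ => -(t • (EuclideanSpace.single k 1 : EuclideanSpace ℝ (Fin d)))) where
  lt_top_of_isCompact C hC := by
    obtain ⟨R, hR⟩ := hC.isBounded.exists_norm_le
    rw [Measure.map_apply (by fun_prop) hC.measurableSet]
    refine (Measure.restrict_apply_le _ _).trans_lt ?_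
    refine (measure_mono (t := Metric.closedBall 0 R) fun t ht => ?_).trans_lt
      measure_closedBall_lt_top
    have := hR _ ht
    simpa [norm_smul] using this

/-- Integrals of smooth compactly supported functions along (part of) a coordinate line depend
smoothly on the line. -/
theorem contDiff_integral_line {u : EuclideanSpace ℝ (Fin d) → ℝ} (hu : ContDiff ℝ ∞ u)
    (hc : HasCompactSupport u) (k : Fin d) (S : Set ℝ) :
    ContDiff ℝ ∞ fun x => ∫ t in S, u (x + t • EuclideanSpace.single k 1) := by
  have := isFiniteMeasureOnCompacts_map_single k S
  have h := hc.contDiff_convolution_right (n := ⊤) (ContinuousLinearMap.mul ℝ ℝ)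
    (f := fun _ => (1 : ℝ)) (μ := (volume.restrict S).map
      fun t : ℝ => -(t • (EuclideanSpace.single k 1 : EuclideanSpace ℝ (Fin d))))
    (locallyIntegrable_const _) hu
  convert h using 2 with x
  rw [convolution_def, integral_map (by fun_prop)]
  · simp
  · simp only [ContinuousLinearMap.mul_apply', one_mul]
    exact (hu.continuous.comp (by fun_prop)).aestronglyMeasurable

theorem integrable_line {u : EuclideanSpace ℝ (Fin d) → ℝ} (hu : Continuous u)
    (hc : HasCompactSupport u) (k : Fin d) (x : EuclideanSpace ℝ (Fin d)) :
    Integrable fun t : ℝ => u (x + t • EuclideanSpace.single k 1) := by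
  refine Continuous.integrable_of_hasCompactSupport (by fun_prop) ?_
  obtain ⟨R, hR⟩ := hc.isCompact.isBounded.exists_norm_le
  refine HasCompactSupport.intro (isCompact_closedBall (0 : ℝ) (R + ‖x‖)) fun t ht => ?_
  by_contra hne
  have h1 := hR _ (subset_tsupport u hne)
  refine ht ?_
  have h2 : ‖t • (EuclideanSpace.single k 1 : EuclideanSpace ℝ (Fin d))‖ ≤ R + ‖x‖ := by
    calc _ = ‖(x + t • EuclideanSpace.single k 1) - x‖ := by simp
      _ ≤ _ := (norm_sub_le _ _).trans (by gcongr)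
  simpa [norm_smul] using h2

/-- Moving the base point by `s` along the line turns the integral over `(-∞, 0]` into the one over
`(-∞, s]`, so the fundamental theorem of calculus applies. -/
theorem pderiv_integral_Iic {u : EuclideanSpace ℝ (Fin d) → ℝ} (hu : ContDiff ℝ ∞ u)
    (hc : HasCompactSupport u) (k : Fin d) (x : EuclideanSpace ℝ (Fin d)) :
    pderiv k (fun z => ∫ t in Set.Iic (0 : ℝ), u (z + t • EuclideanSpace.single k 1)) x = u x := by
  set w := fun z => ∫ t in Set.Iic (0 : ℝ), u (z + t • EuclideanSpace.single k 1) with hw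
  have hsm : ContDiff ℝ ∞ w := contDiff_integral_line hu hc k _
  have hi := integrable_line hu.continuous hc k x
  have h1 : HasDerivAt (fun s : ℝ => w (x + s • EuclideanSpace.single k 1)) (pderiv k w x) 0 := by
    have hl : HasDerivAt (fun s : ℝ => x + s • (EuclideanSpace.single k 1 :
        EuclideanSpace ℝ (Fin d))) (EuclideanSpace.single k 1) 0 := by
      simpa using ((hasDerivAt_id (0 : ℝ)).smul_const
        (EuclideanSpace.single k 1 : EuclideanSpace ℝ (Fin d))).const_add x
    have hf : HasFDerivAt w (fderiv ℝ w x) (x + (0 : ℝ) • EuclideanSpace.single k 1) := by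
      simpa using ((hsm.differentiable (by simp)) x).hasFDerivAt
    exact hf.comp_hasDerivAt (0 : ℝ) hl
  have h2 : (fun s : ℝ => w (x + s • EuclideanSpace.single k 1))
      = fun s => w x + ∫ t in (0 : ℝ)..s, u (x + t • EuclideanSpace.single k 1) := by
    funext s
    have h3 : w (x + s • EuclideanSpace.single k 1)
        = ∫ t in Set.Iic s, u (x + t • EuclideanSpace.single k 1) := by
      have := (measurePreserving_add_left volume s).setIntegral_preimage_emb
        (MeasurableEquiv.addLeft s).measurableEmbedding
        (fun t => u (x + t • EuclideanSpace.single k 1)) (Set.Iic s)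
      rw [← this]
      have hpre : (fun t => s + t) ⁻¹' Set.Iic s = Set.Iic 0 := by ext t; simp
      rw [hpre]
      refine setIntegral_congr_fun measurableSet_Iic fun t _ => ?_
      simp only [add_smul, add_assoc]
    rw [h3, ← intervalIntegral.integral_Iic_sub_Iic hi.integrableOn hi.integrableOn]
    simp [hw]
  rw [h2] at h1
  have h4 : HasDerivAt (fun s => w x + ∫ t in (0 : ℝ)..s, u (x + t • EuclideanSpace.single k 1))
      (u (x + (0 : ℝ) • EuclideanSpace.single k 1)) 0 := by
    refine HasDerivAt.const_add _ ?_
    have hcont : Continuous fun t : ℝ => u (x + t • EuclideanSpace.single k 1) :=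
      hu.continuous.comp (by fun_prop)
    exact hcont.integral_hasStrictDerivAt 0 0 |>.hasDerivAt
  simpa using h1.unique h4

/-- The smooth functions on Euclidean space that vanish outside a closed cube. -/
def cubeFunctions (p : EuclideanSpace ℝ (Fin d)) (r : ℝ) :
    Submodule ℝ (EuclideanSpace ℝ (Fin d) → ℝ) where
  carrier := {u | ContDiff ℝ ∞ u ∧ ∀ x i, r < |x i - p i| → u x = 0}
  add_mem' hu hv := ⟨hu.1.add hv.1, fun x i h => by simp [hu.2 x i h, hv.2 x i h]⟩
  zero_mem' := ⟨contDiff_const, fun _ _ _ => rfl⟩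
  smul_mem' c u hu := ⟨hu.1.const_smul c, fun x i h => by simp [hu.2 x i h]⟩

variable {p : EuclideanSpace ℝ (Fin d)} {r : ℝ} {u : EuclideanSpace ℝ (Fin d) → ℝ}

theorem isCompact_cube (p : EuclideanSpace ℝ (Fin d)) (r : ℝ) :
    IsCompact {x : EuclideanSpace ℝ (Fin d) | ∀ i, |x i - p i| ≤ r} := by
  have h : {x : EuclideanSpace ℝ (Fin d) | ∀ i, |x i - p i| ≤ r}
      = (EuclideanSpace.equiv (Fin d) ℝ).toHomeomorph ⁻¹'
        (Set.univ.pi fun i => Metric.closedBall (p i) r) := by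
    ext x
    simp [Real.dist_eq]
  rw [h, Homeomorph.isCompact_preimage]
  exact isCompact_univ_pi fun i => isCompact_closedBall _ _

theorem hasCompactSupport_of_mem_cubeFunctions (hu : u ∈ cubeFunctions p r) :
    HasCompactSupport u :=
  HasCompactSupport.intro (isCompact_cube p r) fun x hx => by
    simp only [Set.mem_ofPred_eq, not_forall, not_le] at hx
    obtain ⟨i, hi⟩ := hx
    exact hu.2 x i hi

theorem line_apply_of_ne {k i : Fin d} (h : i ≠ k) (x : EuclideanSpace ℝ (Fin d)) (t : ℝ) :
    (x + t • EuclideanSpace.single k (1 : ℝ)) i = x i := by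
  simp [h]

theorem line_apply_self (k : Fin d) (x : EuclideanSpace ℝ (Fin d)) (t : ℝ) :
    (x + t • EuclideanSpace.single k (1 : ℝ)) k = x k + t := by
  simp

/-- Averaging a function over lines parallel to the `k`-th axis changes it by a derivative. -/
theorem exists_pderiv_eq_sub_average {η : ℝ → ℝ} (hη : ContDiff ℝ ∞ η)
    (hη0 : ∀ s, r < |s| → η s = 0) (hη1 : ∫ s, η s = 1) (hu : u ∈ cubeFunctions p r) (k : Fin d) :
    (fun x => η (x k - p k) * ∫ t : ℝ, u (x + t • EuclideanSpace.single k 1)) ∈ cubeFunctions p r ∧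
    ∃ w ∈ cubeFunctions p r, ∀ x, u x = η (x k - p k) *
      (∫ t : ℝ, u (x + t • EuclideanSpace.single k 1)) + pderiv k w x := by
  set v := fun x => η (x k - p k) * ∫ t : ℝ, u (x + t • EuclideanSpace.single k 1) with hv
  have hcu := hasCompactSupport_of_mem_cubeFunctions hu
  have hvmem : v ∈ cubeFunctions p r := by
    refine ⟨?_, fun x i hi => ?_⟩
    · have := contDiff_integral_line hu.1 hcu k Set.univ
      simp only [Measure.restrict_univ] at this
      refine (hη.comp (by fun_prop)).mul this
    · by_cases hik : i = k
      · subst hik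
        simp [hv, hη0 _ hi]
      · have : ∀ t : ℝ, u (x + t • EuclideanSpace.single k 1) = 0 := fun t =>
          hu.2 _ i (by rwa [line_apply_of_ne hik])
        simp [hv, this]
  refine ⟨hvmem, ?_⟩
  have huv : u - v ∈ cubeFunctions p r := Submodule.sub_mem _ hu hvmem
  have hcuv := hasCompactSupport_of_mem_cubeFunctions huv
  -- `v` has the same line integrals as `u` because `η` has integral one.
  have hline : ∀ x, ∫ t : ℝ, (u - v) (x + t • EuclideanSpace.single k 1) = 0 := by
    intro x
    simp only [Pi.sub_apply]
    rw [integral_sub (integrable_line hu.1.continuous hcu k x)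
      (integrable_line hvmem.1.continuous (hasCompactSupport_of_mem_cubeFunctions hvmem) k x)]
    have h1 : ∀ t : ℝ, v (x + t • EuclideanSpace.single k 1)
        = η (t + (x k - p k)) * ∫ s : ℝ, u (x + s • EuclideanSpace.single k 1) := by
      intro t
      simp only [hv, line_apply_self]
      congr 1
      · congr 1; ring
      · rw [← integral_add_left_eq_self (fun s : ℝ => u (x + s • EuclideanSpace.single k 1)) t]
        simp only [add_smul, add_assoc]
    simp only [h1]
    rw [integral_mul_const, integral_add_right_eq_self (fun t => η t), hη1, one_mul, sub_self]
  -- The primitive of `u - v` from minus infinity along the axis. Below the cube it is trivially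
  -- zero; above the cube it equals the whole line integral, which is zero by `hline`.
  refine ⟨fun x => ∫ t in Set.Iic (0 : ℝ), (u - v) (x + t • EuclideanSpace.single k 1),
    ⟨contDiff_integral_line huv.1 hcuv k _, fun x i hi => ?_⟩, fun x => ?_⟩
  · beta_reduce
    by_cases hik : i = k
    · subst hik
      rcases lt_abs.1 hi with h | h
      · rw [setIntegral_eq_integral_of_forall_compl_eq_zero, hline]
        intro t ht
        refine huv.2 _ i (lt_abs.2 (Or.inl ?_))
        rw [line_apply_self]
        simp only [Set.mem_Iic, not_le] at ht
        linarith
      · refine setIntegral_eq_zero_of_forall_eq_zero fun t ht => ?_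
        refine huv.2 _ i (lt_abs.2 (Or.inr ?_))
        rw [line_apply_self]
        simp only [Set.mem_Iic] at ht
        linarith
    · refine setIntegral_eq_zero_of_forall_eq_zero fun t _ => ?_
      exact huv.2 _ i (by rwa [line_apply_of_ne hik])
  · rw [pderiv_integral_Iic huv.1 hcuv]
    simp [hv]

/-- Averages over one axis after another. The remaining factor `g` is invariant along the axes in
`S`; once `S` contains all of them it is constant. -/
theorem exists_eq_mul_prod_add_sum_pderiv {η : ℝ → ℝ} (hη : ContDiff ℝ ∞ η)
    (hη0 : ∀ s, r < |s| → η s = 0) (hη1 : ∫ s, η s = 1) (hu : u ∈ cubeFunctions p r)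
    (S : Finset (Fin d)) :
    ∃ (g : EuclideanSpace ℝ (Fin d) → ℝ) (w : Fin d → EuclideanSpace ℝ (Fin d) → ℝ),
      (∀ i ∈ S, ∀ x, ∀ t : ℝ, g (x + t • EuclideanSpace.single i 1) = g x) ∧
      (fun x => g x * ∏ i ∈ S, η (x i - p i)) ∈ cubeFunctions p r ∧
      (∀ k, w k ∈ cubeFunctions p r) ∧
      ∀ x, u x = g x * ∏ i ∈ S, η (x i - p i) + ∑ k ∈ S, pderiv k (w k) x := by
  classical
  induction S using Finset.induction_on with
  | empty => exact ⟨u, 0, by simp, by simpa using hu, fun _ => Submodule.zero_mem _, by simp⟩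
  | insert k S hk ih =>
    obtain ⟨g, w, hg, hgm, hw, heq⟩ := ih
    obtain ⟨hm, w', hw', heq'⟩ := exists_pderiv_eq_sub_average hη hη0 hη1 hgm k
    have hform : ∀ x, η (x k - p k) * (∫ t : ℝ, g (x + t • EuclideanSpace.single k 1) *
          ∏ i ∈ S, η ((x + t • EuclideanSpace.single k (1 : ℝ)) i - p i))
        = (∫ t : ℝ, g (x + t • EuclideanSpace.single k 1)) *
          ∏ i ∈ insert k S, η (x i - p i) := by
      intro x
      have : ∀ t : ℝ, ∏ i ∈ S, η ((x + t • EuclideanSpace.single k (1 : ℝ)) i - p i)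
          = ∏ i ∈ S, η (x i - p i) := fun t => Finset.prod_congr rfl fun i hi => by
        rw [line_apply_of_ne (ne_of_mem_of_not_mem hi hk)]
      simp only [this]
      rw [integral_mul_const, Finset.prod_insert hk]
      ring
    refine ⟨fun x => ∫ t : ℝ, g (x + t • EuclideanSpace.single k 1), Function.update w k w',
      fun i hi x t => ?_, ?_, fun j => ?_, fun x => ?_⟩
    · beta_reduce
      rcases Finset.mem_insert.1 hi with rfl | hi
      · rw [← integral_add_left_eq_self (fun s : ℝ => g (x + s • EuclideanSpace.single i 1)) t]
        simp only [add_smul, add_assoc]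
      · refine integral_congr_ae (Filter.Eventually.of_forall fun s => ?_)
        simp only
        rw [add_right_comm, hg i hi]
    · simpa only [hform] using hm
    · by_cases hj : j = k
      · subst hj; simpa using hw'
      · simpa [hj] using hw j
    · rw [heq x, heq' x, hform, Finset.sum_insert hk, Function.update_self, add_assoc]
      congr 2
      refine Finset.sum_congr rfl fun i hi => ?_
      rw [Function.update_of_ne (ne_of_mem_of_not_mem hi hk)]

/-- The Poincaré lemma with compact supports in top degree: modulo divergences, a smooth function
supported in a cube is determined by its integral. -/
theorem exists_eq_integral_smul_add_sum_pderiv (p : EuclideanSpace ℝ (Fin d)) (hr : 0 < r) :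
    ∃ b ∈ cubeFunctions p r, ∀ u ∈ cubeFunctions p r,
      ∃ w : Fin d → EuclideanSpace ℝ (Fin d) → ℝ, (∀ k, w k ∈ cubeFunctions p r) ∧
        ∀ x, u x = (∫ z, u z) * b x + ∑ k, pderiv k (w k) x := by
  let φ : ContDiffBump (0 : ℝ) := ⟨r / 2, r, by positivity, by linarith⟩
  set η : ℝ → ℝ := φ.normed volume with hηdef
  have hη : ContDiff ℝ ∞ η := φ.contDiff_normed
  have hη0 : ∀ s, r < |s| → η s = 0 := fun s hs => by
    have : s ∉ Function.support η := by
      rw [hηdef, φ.support_normed_eq]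
      simpa [φ] using hs.le
    simpa using this
  have hη1 : ∫ s, η s = 1 := φ.integral_normed
  set B : EuclideanSpace ℝ (Fin d) → ℝ := fun x => ∏ i, η (x i - p i) with hB
  have hBmem : B ∈ cubeFunctions p r := by
    refine ⟨?_, fun x i hi => Finset.prod_eq_zero (Finset.mem_univ i) (hη0 _ hi)⟩
    exact contDiff_prod fun i _ => hη.comp (by fun_prop)
  have hBc := hasCompactSupport_of_mem_cubeFunctions hBmem
  have hm : 0 < ∫ x, B x := by
    refine hBmem.1.continuous.integral_pos_of_hasCompactSupport_nonneg_nonzero (x := p) hBc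
      (fun x => Finset.prod_nonneg fun i _ => φ.nonneg_normed _) ?_
    refine Finset.prod_ne_zero_iff.2 fun i _ => ?_
    have : (p i - p i) ∈ Function.support η := by
      rw [hηdef, φ.support_normed_eq]
      simpa [φ] using hr
    simpa using this
  -- Dividing by the integral normalises the bump; positivity suffices, so the integral need not be
  -- computed.
  refine ⟨(∫ x, B x)⁻¹ • B, Submodule.smul_mem _ _ hBmem, fun u hu => ?_⟩
  obtain ⟨g, w, hg, hgm, hw, heq⟩ :=
    exists_eq_mul_prod_add_sum_pderiv hη hη0 hη1 hu Finset.univ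
  refine ⟨w, hw, fun x => ?_⟩
  have hconst : ∀ x, g x = g 0 := by
    intro x
    have h1 : ∀ S : Finset (Fin d), g (∑ i ∈ S, x i • EuclideanSpace.single i (1 : ℝ)) = g 0 := by
      classical
      intro S
      induction S using Finset.induction_on with
      | empty => simp
      | insert k S hk ih => rw [Finset.sum_insert hk, add_comm, hg k (Finset.mem_univ k), ih]
    rw [← h1 Finset.univ]
    congr 1
    ext j
    simp [Finset.sum_apply, Pi.single_apply]
  -- Integrating the decomposition identifies the constant, since derivatives of compactly supported
  -- functions integrate to zero.
  have hint : ∫ z, u z = g 0 * ∫ z, B z := by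
    have : ∀ z, u z = g 0 * B z + ∑ k, pderiv k (w k) z := fun z => by
      rw [heq z, hconst z]
    simp only [this]
    have hi : ∀ k ∈ Finset.univ, Integrable (pderiv k (w k)) := fun k _ => by
      have hc := hasCompactSupport_of_mem_cubeFunctions (hw k)
      exact (((hw k).1.continuous_fderiv (by simp)).clm_apply
        continuous_const).integrable_of_hasCompactSupport (hc.fderiv_apply (𝕜 := ℝ) _)
    rw [integral_add ((hBmem.1.continuous.integrable_of_hasCompactSupport hBc).const_mul _)
      (integrable_finsetSum _ hi), integral_const_mul, integral_finsetSum _ hi]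
    rw [Finset.sum_eq_zero, add_zero]
    intro k _
    exact integral_pderiv_eq_zero ((hw k).1.of_le (by simp))
      (hasCompactSupport_of_mem_cubeFunctions (hw k)) k
  rw [heq x, hconst x, hint, Pi.smul_apply, smul_eq_mul]
  congr 1
  field_simp
  rfl

end CompactPoincare

/-! ### Coordinate expressions of the form, its density and the bracket. -/

section Charts

variable {d : ℕ} {M : Type*} [TopologicalSpace M] [ChartedSpace (EuclideanSpace ℝ (Fin d)) M]
  (Ω : SymplecticForm d M)
  {e : OpenPartialHomeomorph M (EuclideanSpace ℝ (Fin d))} {y : EuclideanSpace ℝ (Fin d)}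

/-- The derivative of a real function at `x` in the direction of the tangent vector `v`. -/
def dirDeriv (F : M → ℝ) (x : M) (v : TangentSpace (𝓡 d) x) : ℝ :=
  mfderiv (𝓡 d) 𝓘(ℝ, ℝ) F x v

/-- The tangent map of the inverse of a chart. -/
def pushVec (e : OpenPartialHomeomorph M (EuclideanSpace ℝ (Fin d)))
    (y : EuclideanSpace ℝ (Fin d)) :
    EuclideanSpace ℝ (Fin d) →L[ℝ] TangentSpace (𝓡 d) (e.symm y) :=
  mfderiv (𝓡 d) (𝓡 d) e.symm y

theorem form_swap (x : M) (v w : TangentSpace (𝓡 d) x) : Ω.form x ![v, w] = -Ω.form x ![w, v] := by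
  have h := (Ω.form x).toAlternatingMap.map_swap ![w, v] (i := 0) (j := 1) (by simp)
  have h2 : (![w, v] : Fin 2 → TangentSpace (𝓡 d) x) ∘ Equiv.swap (0 : Fin 2) 1 = ![v, w] := by
    ext i; fin_cases i <;> rfl
  rw [h2] at h
  exact h

theorem form_add_left (x : M) (v v' w : TangentSpace (𝓡 d) x) :
    Ω.form x ![v + v', w] = Ω.form x ![v, w] + Ω.form x ![v', w] :=
  LinearMap.congr_fun ((Ω.flat x).map_add v v') w

theorem form_smul_left (x : M) (c : ℝ) (v w : TangentSpace (𝓡 d) x) :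
    Ω.form x ![c • v, w] = c * Ω.form x ![v, w] :=
  LinearMap.congr_fun ((Ω.flat x).map_smul c v) w

/-- The matrix of a symplectic form in a chart. -/
def chartMatrix (Ω : SymplecticForm d M)
    (e : OpenPartialHomeomorph M (EuclideanSpace ℝ (Fin d))) (y : EuclideanSpace ℝ (Fin d)) :
    Matrix (Fin d) (Fin d) ℝ :=
  Matrix.of fun i j => chartForm Ω.form e y
    ![EuclideanSpace.single i (1 : ℝ), EuclideanSpace.single j (1 : ℝ)]

theorem chartDensity_eq : Ω.chartDensity e y = √(chartMatrix Ω e y).det := rfl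

theorem chartForm_apply (v w : EuclideanSpace ℝ (Fin d)) :
    chartForm Ω.form e y ![v, w] = Ω.form (e.symm y) ![pushVec e y v, pushVec e y w] := by
  change Ω.form (e.symm y) (pushVec e y ∘ ![v, w]) = _
  congr 1
  ext i; fin_cases i <;> rfl

theorem chartForm_sum_left (b w : EuclideanSpace ℝ (Fin d)) :
    chartForm Ω.form e y ![b, w]
      = ∑ i, b i * chartForm Ω.form e y ![EuclideanSpace.single i 1, w] := by
  let l : EuclideanSpace ℝ (Fin d) →ₗ[ℝ] ℝ :=
    { toFun := fun v => chartForm Ω.form e y ![v, w]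
      map_add' := fun v v' => by
        simp only [chartForm_apply, map_add]
        exact form_add_left Ω _ _ _ _
      map_smul' := fun c v => by
        simp only [chartForm_apply, map_smul]
        exact form_smul_left Ω _ _ _ _ }
  have hb : b = ∑ i, b i • EuclideanSpace.single i (1 : ℝ) := by
    ext j; simp [Finset.sum_apply, Pi.single_apply]
  change l b = ∑ i, b i * l _
  conv_lhs => rw [hb]
  simp [map_sum]

theorem chartMatrix_skew (z : EuclideanSpace ℝ (Fin d)) (i j : Fin d) :
    chartMatrix Ω e z i j = -chartMatrix Ω e z j i := by
  change chartForm Ω.form e z _ = -chartForm Ω.form e z _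
  rw [chartForm_apply, chartForm_apply]
  exact form_swap Ω _ _ _

theorem contDiffAt_chartMatrix (he : e ∈ atlas (EuclideanSpace ℝ (Fin d)) M) (hy : y ∈ e.target)
    (i j : Fin d) : ContDiffAt ℝ ∞ (fun z => chartMatrix Ω e z i j) y := by
  have h1 := (Ω.smooth e he).contDiffAt (e.open_target.mem_nhds hy)
  exact (ContinuousAlternatingMap.apply ℝ (EuclideanSpace ℝ (Fin d)) ℝ
    ![EuclideanSpace.single i (1 : ℝ), EuclideanSpace.single j (1 : ℝ)]).contDiff.contDiffAt.comp
      y h1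

/-- The exterior derivative evaluated on three basis vectors; the minus sign of its middle term is
absorbed by skew-symmetry, which produces the cyclic form. -/
theorem chartMatrix_closed (he : e ∈ atlas (EuclideanSpace ℝ (Fin d)) M) (hy : y ∈ e.target)
    (i j k : Fin d) : pderiv i (fun z => chartMatrix Ω e z j k) y
      + pderiv j (fun z => chartMatrix Ω e z k i) y
      + pderiv k (fun z => chartMatrix Ω e z i j) y = 0 := by
  have h1 : DifferentiableAt ℝ (chartForm Ω.form e) y :=
    ((Ω.smooth e he).contDiffAt (e.open_target.mem_nhds hy)).differentiableAt (by simp)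
  have h2 : extDeriv (chartForm Ω.form e) y ![EuclideanSpace.single i (1 : ℝ),
      EuclideanSpace.single j (1 : ℝ), EuclideanSpace.single k (1 : ℝ)] = 0 := by
    rw [Ω.closed e he y hy]
    rfl
  rw [extDeriv_apply h1, Fin.sum_univ_three] at h2
  have r0 : (0 : Fin 3).removeNth ![EuclideanSpace.single i (1 : ℝ),
    EuclideanSpace.single j (1 : ℝ), EuclideanSpace.single k (1 : ℝ)]
    = ![EuclideanSpace.single j (1 : ℝ), EuclideanSpace.single k (1 : ℝ)] := by
    ext a; fin_cases a <;> rfl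
  have r1 : (1 : Fin 3).removeNth ![EuclideanSpace.single i (1 : ℝ),
    EuclideanSpace.single j (1 : ℝ), EuclideanSpace.single k (1 : ℝ)]
    = ![EuclideanSpace.single i (1 : ℝ), EuclideanSpace.single k (1 : ℝ)] := by
    ext a; fin_cases a <;> rfl
  have r2 : (2 : Fin 3).removeNth ![EuclideanSpace.single i (1 : ℝ),
    EuclideanSpace.single j (1 : ℝ), EuclideanSpace.single k (1 : ℝ)]
    = ![EuclideanSpace.single i (1 : ℝ), EuclideanSpace.single j (1 : ℝ)] := by
    ext a; fin_cases a <;> rfl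
  rw [r0, r1, r2] at h2
  have h3 : (fun z => chartMatrix Ω e z k i) = fun z => -chartMatrix Ω e z i k := by
    funext z; exact chartMatrix_skew Ω z k i
  rw [h3]
  simp only [pderiv, fderiv_fun_neg, neg_apply]
  simp only [Fin.val_zero, Fin.val_one, Fin.val_two, pow_zero, one_smul, pow_one, neg_smul,
    even_two, Even.neg_pow, one_pow, Matrix.cons_val_zero, Matrix.cons_val_one,
    Matrix.cons_val] at h2
  exact h2

theorem bracketReal_eq (F G : M → ℝ) (x : M) : Ω.bracketReal F G x
    = dirDeriv F x (Ω.hamiltonianField G x) :=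
  Ω.form_hamiltonianField F x _

theorem bracketReal_swap (F G : M → ℝ) (x : M) :
    Ω.bracketReal F G x = -Ω.bracketReal G F x :=
  form_swap Ω x _ _

theorem bracketReal_eq_neg (F G : M → ℝ) (x : M) : Ω.bracketReal F G x
    = -dirDeriv G x (Ω.hamiltonianField F x) := by
  rw [bracketReal_swap, bracketReal_eq]

theorem bracketReal_self (F : M → ℝ) (x : M) : Ω.bracketReal F F x = 0 := by
  have := bracketReal_swap Ω F F x
  linarith

variable [IsManifold (𝓡 d) ∞ M]

theorem pushVec_bijective (he : e ∈ atlas (EuclideanSpace ℝ (Fin d)) M) (hy : y ∈ e.target) :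
    Function.Bijective (pushVec e y) :=
  (mdifferentiable_of_mem_atlas (I := 𝓡 d) he).symm.mfderiv_bijective hy

/-- A null vector of the matrix would be pushed forward by the bijective tangent map to a vector in
the radical of `Ω`. -/
theorem det_chartMatrix_ne_zero (he : e ∈ atlas (EuclideanSpace ℝ (Fin d)) M)
    (hy : y ∈ e.target) : (chartMatrix Ω e y).det ≠ 0 := by
  intro h0
  obtain ⟨c, hc, hc0⟩ := Matrix.exists_vecMul_eq_zero_iff.2 h0
  let b : EuclideanSpace ℝ (Fin d) := WithLp.toLp 2 c
  have hb : ∀ j, chartForm Ω.form e y ![b, EuclideanSpace.single j 1] = 0 := fun j => by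
    rw [chartForm_sum_left]
    exact congrFun hc0 j
  have hb2 : ∀ w, chartForm Ω.form e y ![b, w] = 0 := by
    intro w
    have hsw : ∀ v v', chartForm Ω.form e y ![v, v'] = -chartForm Ω.form e y ![v', v] := by
      intro v v'
      rw [chartForm_apply, chartForm_apply]; exact form_swap Ω _ _ _
    rw [hsw, chartForm_sum_left]
    simp only [hsw _ b, hb]
    simp
  have hinj := pushVec_bijective he hy
  have hz : pushVec e y b = 0 := by
    refine Ω.nondegenerate _ _ fun w => ?_
    obtain ⟨w', rfl⟩ := hinj.2 w
    rw [← chartForm_apply]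
    exact hb2 w'
  have : b = 0 := hinj.1 (hz.trans (map_zero _).symm)
  refine hc ?_
  funext i
  exact congrArg (fun v : EuclideanSpace ℝ (Fin d) => v i) this

theorem det_chartMatrix_pos (he : e ∈ atlas (EuclideanSpace ℝ (Fin d)) M)
    (hy : y ∈ e.target) : 0 < (chartMatrix Ω e y).det :=
  det_pos_of_transpose_eq_neg (by ext i j; exact chartMatrix_skew Ω y j i)
    (det_chartMatrix_ne_zero Ω he hy)

theorem chartDensity_pos (he : e ∈ atlas (EuclideanSpace ℝ (Fin d)) M)
    (hy : y ∈ e.target) : 0 < Ω.chartDensity e y :=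
  Real.sqrt_pos.2 (det_chartMatrix_pos Ω he hy)

theorem contDiffAt_chartDensity (he : e ∈ atlas (EuclideanSpace ℝ (Fin d)) M)
    (hy : y ∈ e.target) : ContDiffAt ℝ ∞ (Ω.chartDensity e) y :=
  (contDiffAt_matrix_det (contDiffAt_chartMatrix Ω he hy)).sqrt (det_chartMatrix_ne_zero Ω he hy)

theorem fderiv_comp_symm_apply (he : e ∈ atlas (EuclideanSpace ℝ (Fin d)) M) (hy : y ∈ e.target)
    {F : M → ℝ} (hF : MDifferentiableAt (𝓡 d) 𝓘(ℝ, ℝ) F (e.symm y))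
    (b : EuclideanSpace ℝ (Fin d)) :
    fderiv ℝ (F ∘ e.symm) y b
      = dirDeriv F (e.symm y) (pushVec e y b) := by
  rw [← mfderiv_eq_fderiv, mfderiv_comp y hF (mdifferentiableAt_atlas_symm he hy)]
  rfl

/-- `{F, G}` is `dF` applied to `X_G`. The coordinate vector `b` of `X_G` solves `bᵀ W = dG`, hence
`bᵀ = dG W⁻¹`. -/
theorem bracketReal_symm_apply (he : e ∈ atlas (EuclideanSpace ℝ (Fin d)) M) (hy : y ∈ e.target)
    {F G : M → ℝ} (hF : MDifferentiableAt (𝓡 d) 𝓘(ℝ, ℝ) F (e.symm y))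
    (hG : MDifferentiableAt (𝓡 d) 𝓘(ℝ, ℝ) G (e.symm y)) :
    Ω.bracketReal F G (e.symm y) = ∑ j, ∑ k, (chartMatrix Ω e y)⁻¹ j k *
      pderiv j (G ∘ e.symm) y * pderiv k (F ∘ e.symm) y := by
  obtain ⟨b, hb⟩ := (pushVec_bijective he hy).2 (Ω.hamiltonianField G (e.symm y))
  have h1 : ∀ j, Matrix.vecMul (fun i => b i) (chartMatrix Ω e y) j
      = pderiv j (G ∘ e.symm) y := by
    intro j
    rw [pderiv, fderiv_comp_symm_apply he hy hG, dirDeriv, ← Ω.form_hamiltonianField, ← hb]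
    exact ((chartForm_sum_left Ω b _).symm.trans (chartForm_apply Ω _ _))
  have hbk : ∀ k, b k = ∑ j, pderiv j (G ∘ e.symm) y * (chartMatrix Ω e y)⁻¹ j k := by
    intro k
    have h2 : Matrix.vecMul (Matrix.vecMul (fun i => b i) (chartMatrix Ω e y))
        (chartMatrix Ω e y)⁻¹ k = b k := by
      rw [Matrix.vecMul_vecMul, Matrix.mul_nonsing_inv _
        (isUnit_iff_ne_zero.2 (det_chartMatrix_ne_zero Ω he hy)), Matrix.vecMul_one]
    rw [← h2, funext h1]
    rfl
  have hbs : b = ∑ i, b i • EuclideanSpace.single i (1 : ℝ) := by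
    ext j; simp [Finset.sum_apply, Pi.single_apply]
  have h3 : Ω.bracketReal F G (e.symm y) = fderiv ℝ (F ∘ e.symm) y b := by
    rw [bracketReal_eq, ← hb, fderiv_comp_symm_apply he hy hF]
  rw [h3, hbs, map_sum, Finset.sum_comm]
  refine Finset.sum_congr rfl fun k _ => ?_
  rw [map_smul, smul_eq_mul, hbk, Finset.sum_mul]
  refine Finset.sum_congr rfl fun j _ => ?_
  rw [pderiv, pderiv]
  ring

theorem contDiffAt_comp_symm {F' : Type*} [NormedAddCommGroup F'] [NormedSpace ℝ F']
    (he : e ∈ atlas (EuclideanSpace ℝ (Fin d)) M) (hy : y ∈ e.target)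
    {F : M → F'} (hF : ContMDiffAt (𝓡 d) 𝓘(ℝ, F') ∞ F (e.symm y)) :
    ContDiffAt ℝ ∞ (F ∘ e.symm) y := by
  rw [← contMDiffAt_iff_contDiffAt]
  exact hF.comp y (contMDiffAt_symm_of_mem_maximalAtlas (IsManifold.subset_maximalAtlas he) hy)

theorem contMDiffAt_comp_chart {F' : Type*} [NormedAddCommGroup F'] [NormedSpace ℝ F']
    (he : e ∈ atlas (EuclideanSpace ℝ (Fin d)) M) {x : M} (hx : x ∈ e.source)
    {u : EuclideanSpace ℝ (Fin d) → F'} (hu : ContDiffAt ℝ ∞ u (e x)) :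
    ContMDiffAt (𝓡 d) 𝓘(ℝ, F') ∞ (u ∘ e) x :=
  (contMDiffAt_iff_contDiffAt.2 hu).comp x
    (contMDiffAt_of_mem_maximalAtlas (IsManifold.subset_maximalAtlas he) hx)

theorem contDiffAt_pderiv {u : EuclideanSpace ℝ (Fin d) → ℝ} (hu : ContDiffAt ℝ ∞ u y)
    (k : Fin d) : ContDiffAt ℝ ∞ (pderiv k u) y :=
  (hu.fderiv_right (m := ∞) (by simp)).clm_apply contDiffAt_const

theorem contMDiff_bracketReal {F G : M → ℝ} (hF : ContMDiff (𝓡 d) 𝓘(ℝ, ℝ) ∞ F)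
    (hG : ContMDiff (𝓡 d) 𝓘(ℝ, ℝ) ∞ G) :
    ContMDiff (𝓡 d) 𝓘(ℝ, ℝ) ∞ (Ω.bracketReal F G) := by
  intro x
  set e := chartAt (EuclideanSpace ℝ (Fin d)) x
  have he : e ∈ atlas (EuclideanSpace ℝ (Fin d)) M := chart_mem_atlas _ x
  have hx : x ∈ e.source := mem_chart_source _ x
  have h1 : ContDiffAt ℝ ∞ (fun y => ∑ j, ∑ k, (chartMatrix Ω e y)⁻¹ j k *
      pderiv j (G ∘ e.symm) y * pderiv k (F ∘ e.symm) y) (e x) := by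
    have hy := e.map_source hx
    refine ContDiffAt.sum fun j _ => ContDiffAt.sum fun k _ => ?_
    exact ((contDiffAt_matrix_inv (contDiffAt_chartMatrix Ω he hy)
      (det_chartMatrix_ne_zero Ω he hy) j k).mul
      (contDiffAt_pderiv (contDiffAt_comp_symm he hy hG.contMDiffAt) j)).mul
      (contDiffAt_pderiv (contDiffAt_comp_symm he hy hF.contMDiffAt) k)
  refine (contMDiffAt_comp_chart he hx h1).congr_of_eventuallyEq ?_
  filter_upwards [e.open_source.mem_nhds hx] with z hz
  have := bracketReal_symm_apply Ω he (e.map_source hz)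
    (hF.mdifferentiable (by simp) _) (hG.mdifferentiable (by simp) _)
  rw [e.left_inv hz] at this
  exact this

end Charts

/-! ### The bracket as a first-order derivation in its second argument. -/

section Derivation

variable {d : ℕ} {M : Type*} [TopologicalSpace M] [ChartedSpace (EuclideanSpace ℝ (Fin d)) M]
  (Ω : SymplecticForm d M) {F G H : M → ℝ} {x : M}

theorem bracketReal_mul_right (hG : MDifferentiableAt (𝓡 d) 𝓘(ℝ, ℝ) G x)
    (hH : MDifferentiableAt (𝓡 d) 𝓘(ℝ, ℝ) H x) :
    Ω.bracketReal F (fun z => G z * H z) x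
      = G x * Ω.bracketReal F H x + H x * Ω.bracketReal F G x := by
  simp only [bracketReal_eq_neg]
  have h1 := (hG.hasMFDerivAt.mul hH.hasMFDerivAt).mfderiv
  have h2 : dirDeriv (fun z => G z * H z) x (Ω.hamiltonianField F x)
      = G x * dirDeriv H x (Ω.hamiltonianField F x)
        + H x * dirDeriv G x (Ω.hamiltonianField F x) :=
    congrArg (fun L => L (Ω.hamiltonianField F x)) h1
  rw [h2]
  ring

theorem bracketReal_add_right (hG : MDifferentiableAt (𝓡 d) 𝓘(ℝ, ℝ) G x)
    (hH : MDifferentiableAt (𝓡 d) 𝓘(ℝ, ℝ) H x) :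
    Ω.bracketReal F (fun z => G z + H z) x = Ω.bracketReal F G x + Ω.bracketReal F H x := by
  simp only [bracketReal_eq_neg]
  have h1 := (hG.hasMFDerivAt.add hH.hasMFDerivAt).mfderiv
  have h2 : dirDeriv (fun z => G z + H z) x (Ω.hamiltonianField F x)
      = dirDeriv G x (Ω.hamiltonianField F x)
        + dirDeriv H x (Ω.hamiltonianField F x) :=
    congrArg (fun L => L (Ω.hamiltonianField F x)) h1
  rw [h2]
  ring

theorem bracketReal_comp_right {χ : ℝ → ℝ} (hχ : DifferentiableAt ℝ χ (G x))
    (hG : MDifferentiableAt (𝓡 d) 𝓘(ℝ, ℝ) G x) :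
    Ω.bracketReal F (fun z => χ (G z)) x = deriv χ (G x) * Ω.bracketReal F G x := by
  simp only [bracketReal_eq_neg]
  have h1 := mfderiv_comp x hχ.mdifferentiableAt hG
  have h2 : dirDeriv (fun z => χ (G z)) x (Ω.hamiltonianField F x)
      = fderiv ℝ χ (G x) (dirDeriv G x (Ω.hamiltonianField F x)) := by
    rw [mfderiv_eq_fderiv] at h1
    exact congrArg (fun L => L (Ω.hamiltonianField F x)) h1
  rw [h2, fderiv_eq_smul_deriv, smul_eq_mul]
  ring

theorem bracketReal_congr_right (h : G =ᶠ[nhds x] H) :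
    Ω.bracketReal F G x = Ω.bracketReal F H x := by
  simp only [bracketReal_eq_neg]
  have h1 := h.mfderiv_eq (I := 𝓡 d) (I' := 𝓘(ℝ, ℝ))
  have h2 : dirDeriv G x (Ω.hamiltonianField F x)
      = dirDeriv H x (Ω.hamiltonianField F x) :=
    congrArg (fun L => L (Ω.hamiltonianField F x)) h1
  rw [h2]

theorem bracketReal_const_right (c : ℝ) : Ω.bracketReal F (fun _ => c) x = 0 := by
  rw [bracketReal_eq_neg, dirDeriv, mfderiv_const]
  exact neg_zero

theorem support_bracketReal_right : Function.support (Ω.bracketReal F G) ⊆ tsupport G := by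
  intro z hz
  by_contra hn
  refine hz ?_
  have h1 : G =ᶠ[nhds z] fun _ => 0 := notMem_tsupport_iff_eventuallyEq.1 hn
  rw [bracketReal_congr_right Ω h1, bracketReal_const_right]

theorem hasCompactSupport_bracketReal_right (hG : HasCompactSupport G) :
    HasCompactSupport (Ω.bracketReal F G) :=
  hG.mono' (support_bracketReal_right Ω)

end Derivation

/-! ### The Liouville measure: independence of charts and integration in a chart. -/

section Liouville

variable {d : ℕ} {M : Type*} [TopologicalSpace M] [ChartedSpace (EuclideanSpace ℝ (Fin d)) M]
  [IsManifold (𝓡 d) ∞ M] (Ω : SymplecticForm d M)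
  {e e' : OpenPartialHomeomorph M (EuclideanSpace ℝ (Fin d))} {y : EuclideanSpace ℝ (Fin d)}

/-- The tangent map of the inverse of a chart, with all tangent spaces identified with the model
space. -/
def pushModel (e : OpenPartialHomeomorph M (EuclideanSpace ℝ (Fin d)))
    (y v : EuclideanSpace ℝ (Fin d)) : EuclideanSpace ℝ (Fin d) :=
  pushVec e y v

omit [IsManifold (𝓡 d) ∞ M] in
-- The base point is a free `x` equal to `e.symm y`, so that expressions from two charts can be
-- compared in one tangent space.
theorem chartForm_apply_of_eq {x : M} (hx : e.symm y = x) (v w : EuclideanSpace ℝ (Fin d)) :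
    chartForm Ω.form e y ![v, w] = Ω.form x ![(pushModel e y v : TangentSpace (𝓡 d) x),
      (pushModel e y w : TangentSpace (𝓡 d) x)] := by
  subst hx
  exact chartForm_apply Ω v w

theorem differentiableAt_transition (he : e ∈ atlas (EuclideanSpace ℝ (Fin d)) M)
    (he' : e' ∈ atlas (EuclideanSpace ℝ (Fin d)) M) (hy : y ∈ e.target)
    (hy' : e.symm y ∈ e'.source) : DifferentiableAt ℝ (e' ∘ e.symm) y := by
  rw [← mdifferentiableAt_iff_differentiableAt]
  exact (mdifferentiableAt_atlas (I := 𝓡 d) he' hy').comp y (mdifferentiableAt_atlas_symm he hy)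

/-- Chain rule for `e.symm = e'.symm ∘ (e' ∘ e.symm)`, which holds near `y`. -/
theorem pushModel_transition (he : e ∈ atlas (EuclideanSpace ℝ (Fin d)) M)
    (he' : e' ∈ atlas (EuclideanSpace ℝ (Fin d)) M) (hy : y ∈ e.target)
    (hy' : e.symm y ∈ e'.source) (v : EuclideanSpace ℝ (Fin d)) :
    pushModel e y v = pushModel e' (e' (e.symm y)) (fderiv ℝ (e' ∘ e.symm) y v) := by
  have hd := differentiableAt_transition he he' hy hy'
  have h1 : e.symm =ᶠ[nhds y] e'.symm ∘ (e' ∘ e.symm) := by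
    filter_upwards [e.open_target.mem_nhds hy,
      (e.continuousAt_symm hy).preimage_mem_nhds (e'.open_source.mem_nhds hy')] with z hz hz'
    exact (e'.left_inv hz').symm
  have h2 := h1.mfderiv_eq (I := 𝓡 d) (I' := 𝓡 d)
  have h3 := mfderiv_comp (I := 𝓡 d) (I' := 𝓡 d) (I'' := 𝓡 d) y
    (g := e'.symm) (f := e' ∘ e.symm) (mdifferentiableAt_atlas_symm he' (e'.map_source hy'))
    hd.mdifferentiableAt
  rw [mfderiv_eq_fderiv] at h3
  have h4 := h2.trans h3
  exact congrArg (fun L => L v) h4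

/-- The matrices of the form are related by `W = Aᵀ W' A` with `A` the Jacobian matrix of the
transition map, so the determinant picks up `(det A)²` and its root `|det A|`. -/
theorem chartDensity_transition (he : e ∈ atlas (EuclideanSpace ℝ (Fin d)) M)
    (he' : e' ∈ atlas (EuclideanSpace ℝ (Fin d)) M) (hy : y ∈ e.target)
    (hy' : e.symm y ∈ e'.source) :
    Ω.chartDensity e y
      = |(fderiv ℝ (e' ∘ e.symm) y).det| * Ω.chartDensity e' (e' (e.symm y)) := by
  set J := fderiv ℝ (e' ∘ e.symm) y with hJ
  set y' := e' (e.symm y)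
  let A : Matrix (Fin d) (Fin d) ℝ := Matrix.of fun a i => J (EuclideanSpace.single i 1) a
  have hA : A.det = J.det := by
    rw [ContinuousLinearMap.det,
      ← LinearMap.det_toMatrix (EuclideanSpace.basisFun (Fin d) ℝ).toBasis]
    congr 1
  have hx : e'.symm y' = e.symm y := e'.left_inv hy'
  have hform : ∀ v w, chartForm Ω.form e y ![v, w] = chartForm Ω.form e' y' ![J v, J w] := by
    intro v w
    rw [chartForm_apply_of_eq Ω hx, chartForm_apply_of_eq Ω rfl,
      pushModel_transition he he' hy hy', pushModel_transition he he' hy hy']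
  have hsw : ∀ v w, chartForm Ω.form e' y' ![v, w] = -chartForm Ω.form e' y' ![w, v] := by
    intro v v'
    rw [chartForm_apply, chartForm_apply]; exact form_swap Ω _ _ _
  have hW : chartMatrix Ω e y = A.transpose * chartMatrix Ω e' y' * A := by
    ext i j
    change chartForm Ω.form e y _ = _
    rw [hform, hsw, chartForm_sum_left, Matrix.mul_apply, ← Finset.sum_neg_distrib]
    refine Finset.sum_congr rfl fun b _ => ?_
    rw [Matrix.mul_apply, ← mul_neg, ← hsw, chartForm_sum_left, mul_comm]
    rfl
  rw [chartDensity_eq, chartDensity_eq, hW, Matrix.det_mul, Matrix.det_mul, Matrix.det_transpose,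
    hA, mul_right_comm, Real.sqrt_mul (mul_self_nonneg _), Real.sqrt_mul_self_eq_abs]

variable [MeasurableSpace M] [BorelSpace M]

omit [ChartedSpace (EuclideanSpace ℝ (Fin d)) M] [IsManifold (𝓡 d) ∞ M] in
theorem aemeasurable_chart_symm (e : OpenPartialHomeomorph M (EuclideanSpace ℝ (Fin d))) :
    AEMeasurable e.symm (volume.restrict e.target) :=
  e.continuousOn_symm.aemeasurable e.open_target.measurableSet

omit [IsManifold (𝓡 d) ∞ M] in
theorem chartMeasure_apply {s : Set M} (hs : MeasurableSet s) :
    Ω.chartMeasure e s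
      = ∫⁻ y in e.target ∩ e.symm ⁻¹' s, ENNReal.ofReal (Ω.chartDensity e y) := by
  rw [SymplecticForm.chartMeasure, Measure.map_apply_of_aemeasurable
    ((aemeasurable_chart_symm e).mono_ac (withDensity_absolutelyContinuous _ _)) hs,
    withDensity_apply', Measure.restrict_restrict' e.open_target.measurableSet, Set.inter_comm]

omit [IsManifold (𝓡 d) ∞ M] in
theorem chartMeasure_eq_zero_of_disjoint {s : Set M} (hs : MeasurableSet s)
    (h : Disjoint s e.source) : Ω.chartMeasure e s = 0 := by
  rw [chartMeasure_apply Ω hs]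
  have : e.target ∩ e.symm ⁻¹' s = ∅ := by
    ext z
    simp only [Set.mem_inter_iff, Set.mem_preimage, Set.mem_empty_iff_false, iff_false, not_and]
    exact fun hz hzs => Set.disjoint_left.1 h hzs (e.map_target hz)
  simp [this]

omit [IsManifold (𝓡 d) ∞ M] in
theorem chartMeasure_inter_source {s : Set M} (hs : MeasurableSet s) :
    Ω.chartMeasure e (s ∩ e.source) = Ω.chartMeasure e s := by
  rw [← measure_inter_add_sdiff s e.open_source.measurableSet,
    chartMeasure_eq_zero_of_disjoint Ω (hs.diff e.open_source.measurableSet)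
      Set.disjoint_sdiff_left, add_zero]

omit [ChartedSpace (EuclideanSpace ℝ (Fin d)) M] [IsManifold (𝓡 d) ∞ M] in
theorem measurableSet_target_inter_preimage {s : Set M} (hs : MeasurableSet s) :
    MeasurableSet (e.target ∩ e.symm ⁻¹' s) := by
  classical
  have h := (e.continuousOn_symm.measurable_piecewise
    (continuousOn_const (c := e.symm (0 : EuclideanSpace ℝ (Fin d)))) e.open_target.measurableSet)
  have h2 := (h hs).inter e.open_target.measurableSet
  convert h2 using 1
  ext z
  simp only [Set.mem_inter_iff, Set.mem_preimage]
  constructor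
  · rintro ⟨h1, h2⟩; exact ⟨by rwa [Set.piecewise_eq_of_mem _ _ _ h1], h1⟩
  · rintro ⟨h1, h2⟩; exact ⟨h2, by rwa [Set.piecewise_eq_of_mem _ _ _ h2] at h1⟩

theorem chartMeasure_eq_of_subset (he : e ∈ atlas (EuclideanSpace ℝ (Fin d)) M)
    (he' : e' ∈ atlas (EuclideanSpace ℝ (Fin d)) M) {s : Set M} (hs : MeasurableSet s)
    (h : s ⊆ e.source) (h' : s ⊆ e'.source) : Ω.chartMeasure e s = Ω.chartMeasure e' s := by
  rw [chartMeasure_apply Ω hs, chartMeasure_apply Ω hs]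
  set T := e.target ∩ e.symm ⁻¹' s with hT
  have himg : (e' ∘ e.symm) '' T = e'.target ∩ e'.symm ⁻¹' s := by
    ext z
    constructor
    · rintro ⟨y, ⟨hy, hys⟩, rfl⟩
      refine ⟨e'.map_source (h' hys), ?_⟩
      change e'.symm (e' (e.symm y)) ∈ s
      rwa [e'.left_inv (h' hys)]
    · rintro ⟨hz, hzs⟩
      refine ⟨e (e'.symm z), ⟨e.map_source (h hzs), ?_⟩, ?_⟩
      · change e.symm (e (e'.symm z)) ∈ s
        rwa [e.left_inv (h hzs)]
      · change e' (e.symm (e (e'.symm z))) = z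
        rw [e.left_inv (h hzs), e'.right_inv hz]
  have hinj : Set.InjOn (e' ∘ e.symm) T := by
    rintro y ⟨hy, hys⟩ z ⟨hz, hzs⟩ hyz
    exact e.symm.injOn hy hz (e'.injOn (h' hys) (h' hzs) hyz)
  rw [← himg, lintegral_image_eq_lintegral_abs_det_fderiv_mul volume
    (measurableSet_target_inter_preimage hs)
    (fun y hy => (differentiableAt_transition he he' hy.1 (h' hy.2)).hasFDerivAt.hasFDerivWithinAt)
    hinj]
  refine setLIntegral_congr_fun (measurableSet_target_inter_preimage hs) fun y hy => ?_
  rw [← ENNReal.ofReal_mul (abs_nonneg _), chartDensity_transition Ω he he' hy.1 (h' hy.2)]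
  rfl

variable [SecondCountableTopology M]

omit [IsManifold (𝓡 d) ∞ M] [MeasurableSpace M] [BorelSpace M] in
-- The prescribed chart comes first so that, when the domains are made disjoint, its own domain is
-- kept whole.
theorem exists_seq_chart (he : e ∈ atlas (EuclideanSpace ℝ (Fin d)) M) :
    ∃ c : ℕ → OpenPartialHomeomorph M (EuclideanSpace ℝ (Fin d)), c 0 = e ∧
      (∀ n, c n ∈ atlas (EuclideanSpace ℝ (Fin d)) M) ∧ ⋃ n, (c n).source = Set.univ := by
  obtain ⟨s, hs, hsu⟩ := TopologicalSpace.countable_cover_nhds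
    (f := fun x : M => (chartAt (EuclideanSpace ℝ (Fin d)) x).source)
    fun x => chart_source_mem_nhds _ x
  have hcount : (insert e ((chartAt (EuclideanSpace ℝ (Fin d)) : M → _) '' s)).Countable :=
    (hs.image _).insert e
  obtain ⟨c, hc⟩ := hcount.exists_eq_range (Set.insert_nonempty _ _)
  refine ⟨fun n => Nat.casesOn n e c, rfl, fun n => ?_, ?_⟩
  · cases n with
    | zero => exact he
    | succ n =>
      have : c n ∈ Set.range c := ⟨n, rfl⟩
      rw [← hc] at this
      rcases this with h | ⟨x, _, h⟩
      · change c n ∈ _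
        rw [h]; exact he
      · change c n ∈ _
        rw [← h]; exact chart_mem_atlas _ x
  · rw [Set.eq_univ_iff_forall]
    intro x
    have hx : x ∈ ⋃ z ∈ s, (chartAt (EuclideanSpace ℝ (Fin d)) z).source := hsu ▸ Set.mem_univ x
    obtain ⟨z, hz, hxz⟩ := Set.mem_iUnion₂.1 hx
    have : chartAt (EuclideanSpace ℝ (Fin d)) z ∈ Set.range c := by
      rw [← hc]; exact Or.inr ⟨z, hz, rfl⟩
    obtain ⟨n, hn⟩ := this
    refine Set.mem_iUnion.2 ⟨n + 1, ?_⟩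
    change x ∈ (c n).source
    rwa [hn]

/-- A supremum dominates its members, which gives one inequality. For the other, chart measures
restricted to disjoint pieces of a countable atlas are added up to a measure `ν`. It dominates every
chart measure, because these agree on overlaps, and it coincides with `Ω.chartMeasure e` on the
zeroth piece `e.source`. -/
theorem liouville_apply_of_subset (he : e ∈ atlas (EuclideanSpace ℝ (Fin d)) M) {s : Set M}
    (hs : MeasurableSet s) (h : s ⊆ e.source) : Ω.liouville s = Ω.chartMeasure e s := by
  refine le_antisymm ?_ (Measure.le_iff'.1 (le_iSup₂ (f := fun e _ => Ω.chartMeasure e) e he) s)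
  obtain ⟨c, hc0, hc, hcu⟩ := exists_seq_chart he
  let S : ℕ → Set M := disjointed fun n => (c n).source
  have hSm : ∀ n, MeasurableSet (S n) := fun n =>
    MeasurableSet.disjointed (fun n => (c n).open_source.measurableSet) n
  have hSd : Pairwise (Function.onFun Disjoint S) := disjoint_disjointed _
  have hSu : ⋃ n, S n = Set.univ := (iUnion_disjointed (f := fun n => (c n).source)).trans hcu
  let ν : Measure M := Measure.sum fun n => (Ω.chartMeasure (c n)).restrict (S n)
  have hle : Ω.liouville ≤ ν := by
    refine iSup₂_le fun e' he' => Measure.le_iff.2 fun t ht => ?_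
    have hνt : ν t = ∑' n, Ω.chartMeasure (c n) (t ∩ S n) := by
      rw [Measure.sum_apply _ ht]
      exact tsum_congr fun n => Measure.restrict_apply ht
    have ht2 : Ω.chartMeasure e' t = ∑' n, Ω.chartMeasure e' (t ∩ S n) := by
      rw [← measure_iUnion (fun i j hij => (hSd hij).mono Set.inter_subset_right
        Set.inter_subset_right) (fun n => ht.inter (hSm n)), ← Set.inter_iUnion, hSu,
        Set.inter_univ]
    rw [hνt, ht2]
    refine ENNReal.tsum_le_tsum fun n => ?_
    rw [← chartMeasure_inter_source Ω (ht.inter (hSm n)), chartMeasure_eq_of_subset Ω he' (hc n)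
      ((ht.inter (hSm n)).inter e'.open_source.measurableSet) Set.inter_subset_right
      (Set.inter_subset_left.trans (Set.inter_subset_right.trans (disjointed_subset _ n)))]
    exact measure_mono Set.inter_subset_left
  refine (Measure.le_iff'.1 hle s).trans (le_of_eq ?_)
  rw [Measure.sum_apply _ hs, tsum_eq_single 0]
  · have h0 : S 0 = e.source := by
      rw [← hc0]; exact disjointed_zero _
    rw [Measure.restrict_apply hs, h0, Set.inter_eq_left.2 h, hc0]
  · intro n hn
    have h0 : s ∩ S n = ∅ := by
      refine Set.disjoint_iff_inter_eq_empty.1 ?_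
      have h1 : s ⊆ S 0 := by
        have : S 0 = e.source := by
          rw [← hc0]; exact disjointed_zero _
        rw [this]; exact h
      exact (hSd (Ne.symm hn)).mono_left h1
    rw [Measure.restrict_apply hs, h0, measure_empty]

theorem liouville_restrict_source (he : e ∈ atlas (EuclideanSpace ℝ (Fin d)) M) :
    Ω.liouville.restrict e.source = Ω.chartMeasure e := by
  ext s hs
  rw [Measure.restrict_apply hs, liouville_apply_of_subset Ω he
    (hs.inter e.open_source.measurableSet) Set.inter_subset_right, chartMeasure_inter_source Ω hs]

omit [MeasurableSpace M] [BorelSpace M] [SecondCountableTopology M] in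
theorem aemeasurable_chartDensity (he : e ∈ atlas (EuclideanSpace ℝ (Fin d)) M) :
    AEMeasurable (Ω.chartDensity e) (volume.restrict e.target) := by
  refine ContinuousOn.aemeasurable (fun y hy => ?_) e.open_target.measurableSet
  exact (contDiffAt_chartDensity Ω he hy).continuousAt.continuousWithinAt

/-- The integral of a function supported in a chart domain, computed in the chart. -/
theorem integral_liouville_eq (he : e ∈ atlas (EuclideanSpace ℝ (Fin d)) M) {f : M → ℝ}
    (hf : Continuous f) (h0 : ∀ x ∉ e.source, f x = 0) :
    ∫ x, f x ∂Ω.liouville = ∫ y in e.target, Ω.chartDensity e y * f (e.symm y) := by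
  rw [← setIntegral_eq_integral_of_forall_compl_eq_zero h0, liouville_restrict_source Ω he,
    SymplecticForm.chartMeasure, integral_map
      ((aemeasurable_chart_symm e).mono_ac (withDensity_absolutelyContinuous _ _))
      hf.aestronglyMeasurable, integral_withDensity_eq_integral_toReal_smul₀]
  · refine setIntegral_congr_fun e.open_target.measurableSet fun y hy => ?_
    simp only [smul_eq_mul]
    rw [ENNReal.toReal_ofReal (chartDensity_pos Ω he hy).le]
  · exact (aemeasurable_chartDensity Ω he).ennreal_ofReal
  · exact Filter.Eventually.of_forall fun _ => ENNReal.ofReal_lt_top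

theorem liouville_eq_zero_of_forall_chart {s : Set M} (hs : MeasurableSet s)
    (h : ∀ e ∈ atlas (EuclideanSpace ℝ (Fin d)) M, volume (e.target ∩ e.symm ⁻¹' s) = 0) :
    Ω.liouville s = 0 := by
  rcases isEmpty_or_nonempty M with hM | ⟨⟨x⟩⟩
  · rw [Set.eq_empty_of_isEmpty s, measure_empty]
  obtain ⟨c, -, hc, hcu⟩ := exists_seq_chart (chart_mem_atlas (EuclideanSpace ℝ (Fin d)) x)
  have hsu : s = ⋃ n, s ∩ (c n).source := by rw [← Set.inter_iUnion, hcu, Set.inter_univ]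
  rw [hsu, measure_iUnion_null_iff]
  intro n
  rw [liouville_apply_of_subset Ω (hc n) (hs.inter (c n).open_source.measurableSet)
    Set.inter_subset_right, chartMeasure_inter_source Ω hs, chartMeasure_apply Ω hs]
  exact setLIntegral_measure_zero _ _ (h _ (hc n))

theorem liouville_isOpenPosMeasure : Ω.liouville.IsOpenPosMeasure where
  open_pos U hU hne h0 := by
    obtain ⟨x, hx⟩ := hne
    set e := chartAt (EuclideanSpace ℝ (Fin d)) x
    have he : e ∈ atlas (EuclideanSpace ℝ (Fin d)) M := chart_mem_atlas _ x
    have h1 : Ω.chartMeasure e U = 0 := by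
      rw [← chartMeasure_inter_source Ω hU.measurableSet, ← liouville_apply_of_subset Ω he
        (hU.measurableSet.inter e.open_source.measurableSet) Set.inter_subset_right]
      exact measure_mono_null Set.inter_subset_left h0
    have hTo : IsOpen (e.target ∩ e.symm ⁻¹' U) := e.isOpen_inter_preimage_symm hU
    have hxT : e x ∈ e.target ∩ e.symm ⁻¹' U :=
      ⟨e.map_source (mem_chart_source _ x), by
        rw [Set.mem_preimage, e.left_inv (mem_chart_source _ x)]; exact hx⟩
    rw [chartMeasure_apply Ω hU.measurableSet, lintegral_eq_zero_iff'] at h1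
    · have h2 := ae_imp_of_ae_restrict h1
      have h3 : volume (e.target ∩ e.symm ⁻¹' U) = 0 := by
        refine measure_mono_null (fun z hz => ?_) (ae_iff.1 h2)
        simp only [Set.mem_ofPred_eq, Classical.not_imp]
        refine ⟨hz, ?_⟩
        simpa using chartDensity_pos Ω he hz.1
      exact hTo.measure_ne_zero volume ⟨_, hxT⟩ h3
    · exact ((aemeasurable_chartDensity Ω he).mono_set Set.inter_subset_left).ennreal_ofReal

end Liouville

/-! ### Test functions, cutoffs and localisation. -/

section Cutoff

variable {d : ℕ} {M : Type*} [TopologicalSpace M] [ChartedSpace (EuclideanSpace ℝ (Fin d)) M]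

variable (d M) in
/-- The space of real-valued smooth compactly supported functions. -/
def testFunctions : Submodule ℝ (M → ℝ) where
  carrier := {f | ContMDiff (𝓡 d) 𝓘(ℝ, ℝ) ∞ f ∧ HasCompactSupport f}
  add_mem' hf hg := ⟨hf.1.add hg.1, hf.2.add hg.2⟩
  zero_mem' := ⟨contMDiff_const, HasCompactSupport.zero⟩
  smul_mem' c _ hf := ⟨(contDiff_const_smul (𝕜 := ℝ) (F := ℝ) c).contMDiff.comp hf.1,
    hf.2.smul_left (f := fun _ => c)⟩

theorem mul_mem_testFunctions {f g : M → ℝ} (hf : ContMDiff (𝓡 d) 𝓘(ℝ, ℝ) ∞ f)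
    (hg : g ∈ testFunctions d M) : (fun x => f x * g x) ∈ testFunctions d M :=
  ⟨(contDiff_mul (𝕜 := ℝ) (𝔸 := ℝ)).contMDiff.comp (hf.prodMk_space hg.1), hg.2.mul_left⟩

theorem contMDiff_mul {f g : M → ℝ} (hf : ContMDiff (𝓡 d) 𝓘(ℝ, ℝ) ∞ f)
    (hg : ContMDiff (𝓡 d) 𝓘(ℝ, ℝ) ∞ g) : ContMDiff (𝓡 d) 𝓘(ℝ, ℝ) ∞ fun x => f x * g x :=
  (contDiff_mul (𝕜 := ℝ) (𝔸 := ℝ)).contMDiff.comp (hf.prodMk_space hg)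

variable [IsManifold (𝓡 d) ∞ M] [T2Space M] [SecondCountableTopology M]

/-- Smooth cutoff functions. -/
theorem exists_cutoff {K U : Set M} (hK : IsCompact K) (hU : IsOpen U) (hKU : K ⊆ U) :
    ∃ χ ∈ testFunctions d M, (∀ᶠ x in nhdsSet K, χ x = 1) ∧ tsupport χ ⊆ U ∧
      ∀ x, χ x ∈ Set.Icc (0 : ℝ) 1 := by
  have : LocallyCompactSpace M := ChartedSpace.locallyCompactSpace (EuclideanSpace ℝ (Fin d)) M
  obtain ⟨L, hL, hKL, hLU⟩ := exists_compact_between hK hU hKU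
  obtain ⟨χ, h1, h0, h01⟩ := exists_contMDiffMap_one_nhds_of_subset_interior (𝓡 d) (n := ⊤)
    hK.isClosed hKL
  have hsupp : tsupport χ ⊆ L := closure_minimal
    (fun x hx => by by_contra hn; exact hx (h0 x hn)) hL.isClosed
  exact ⟨χ, ⟨χ.contMDiff, HasCompactSupport.intro hL h0⟩, h1, hsupp.trans hLU, h01⟩

/-- Decomposition of a test function into test functions with small supports. -/
theorem exists_sum_subordinate {f : M → ℝ} (hf : f ∈ testFunctions d M) {U : M → Set M}
    (hU : ∀ x, IsOpen (U x)) (hxU : ∀ x, x ∈ U x) :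
    ∃ (t : Finset M) (g : M → M → ℝ), (∀ i ∈ t, g i ∈ testFunctions d M ∧ tsupport (g i) ⊆ U i) ∧
      f = ∑ i ∈ t, g i := by
  have : LocallyCompactSpace M := ChartedSpace.locallyCompactSpace (EuclideanSpace ℝ (Fin d)) M
  obtain ⟨t, ht⟩ := hf.2.isCompact.elim_finite_subcover U hU
    fun x _ => Set.mem_iUnion.2 ⟨x, hxU x⟩
  obtain ⟨ρ, hρ⟩ := SmoothPartitionOfUnity.exists_isSubordinate (𝓡 d) (isClosed_tsupport f)
    (fun i : t => U i) (fun i => hU i) (by simpa [Set.iUnion_subtype] using ht)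
  classical
  refine ⟨t, fun i x => if hi : i ∈ t then ρ ⟨i, hi⟩ x * f x else 0, fun i hi => ?_, ?_⟩
  · simp only [hi, dif_pos]
    refine ⟨mul_mem_testFunctions (ρ ⟨i, hi⟩).contMDiff hf, ?_⟩
    exact (closure_mono (Function.support_mul_subset_left _ _)).trans (hρ ⟨i, hi⟩)
  · funext x
    rw [Finset.sum_apply, ← Finset.sum_attach]
    simp only [Finset.coe_mem, dif_pos, Subtype.coe_eta]
    rw [← Finset.sum_mul]
    by_cases hx : x ∈ tsupport f
    · have h1 := ρ.sum_eq_one hx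
      rw [finsum_eq_sum_of_fintype] at h1
      have h2 : ∑ i ∈ t.attach, ρ i x = 1 := by rw [← h1]; rfl
      rw [h2, one_mul]
    · rw [image_eq_zero_of_notMem_tsupport hx, mul_zero]

end Cutoff

/-! ### Liouville's theorem: brackets with a test function integrate to zero. -/

section Divergence

theorem contDiff_of_eq_zero_off_compact {E F : Type*} [NormedAddCommGroup E] [NormedSpace ℝ E]
    [NormedAddCommGroup F] [NormedSpace ℝ F] {u : E → F} {K : Set E} (hK : IsCompact K)
    (h : ∀ x ∈ K, ContDiffAt ℝ ∞ u x) (h0 : ∀ x ∉ K, u x = 0) : ContDiff ℝ ∞ u := by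
  rw [contDiff_iff_contDiffAt]
  intro x
  by_cases hx : x ∈ K
  · exact h x hx
  · refine (contDiffAt_const (c := (0 : F))).congr_of_eventuallyEq ?_
    filter_upwards [hK.isClosed.isOpen_compl.mem_nhds hx] with z hz using h0 z hz

variable {d : ℕ} {M : Type*} [TopologicalSpace M] [ChartedSpace (EuclideanSpace ℝ (Fin d)) M]

section Pderiv

variable {y : EuclideanSpace ℝ (Fin d)} {u v : EuclideanSpace ℝ (Fin d) → ℝ}

theorem pderiv_mul (hu : DifferentiableAt ℝ u y) (hv : DifferentiableAt ℝ v y) (k : Fin d) :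
    pderiv k (fun z => u z * v z) y = u y * pderiv k v y + v y * pderiv k u y := by
  rw [pderiv, fderiv_fun_mul hu hv]
  simp [pderiv]

theorem pderiv_sum {ι : Type*} {s : Finset ι} {w : ι → EuclideanSpace ℝ (Fin d) → ℝ}
    (hw : ∀ i ∈ s, DifferentiableAt ℝ (w i) y) (k : Fin d) :
    pderiv k (fun z => ∑ i ∈ s, w i z) y = ∑ i ∈ s, pderiv k (w i) y := by
  rw [pderiv, fderiv_fun_sum hw]
  simp [pderiv]

theorem pderiv_comm (hu : ContDiffAt ℝ ∞ u y) (j k : Fin d) :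
    pderiv j (pderiv k u) y = pderiv k (pderiv j u) y := by
  have hd : DifferentiableAt ℝ (fderiv ℝ u) y :=
    (hu.fderiv_right (m := ∞) (by simp)).differentiableAt (by simp)
  have h : ∀ i l : Fin d, pderiv i (pderiv l u) y
      = fderiv ℝ (fderiv ℝ u) y (EuclideanSpace.single i 1) (EuclideanSpace.single l 1) := by
    intro i l
    change fderiv ℝ (fun z => fderiv ℝ u z (EuclideanSpace.single l 1)) y _ = _
    rw [fderiv_clm_apply hd (by fun_prop)]
    simp
  rw [h, h]
  exact hu.isSymmSndFDerivAt (by simp; exact WithTop.coe_le_coe.2 le_top) _ _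

theorem pderiv_congr (h : u =ᶠ[nhds y] v) (k : Fin d) : pderiv k u y = pderiv k v y := by
  rw [pderiv, h.fderiv_eq, pderiv]

/-- A divergence-free antisymmetric tensor maps pairs of functions to divergences. -/
theorem sum_pderiv_antisymm_flux {Q : EuclideanSpace ℝ (Fin d) → Fin d → Fin d → ℝ}
    (hQ : ∀ j k, DifferentiableAt ℝ (fun z => Q z j k) y) (hskew : ∀ j k, Q y j k = -Q y k j)
    (hdiv : ∀ j, ∑ k, pderiv k (fun z => Q z j k) y = 0)
    (hv : ContDiffAt ℝ ∞ v y) (hu : DifferentiableAt ℝ u y) :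
    ∑ k, pderiv k (fun z => (∑ j, Q z j k * pderiv j v z) * u z) y
      = ∑ j, ∑ k, Q y j k * pderiv j v y * pderiv k u y := by
  have hdv : ∀ j, DifferentiableAt ℝ (pderiv j v) y := fun j =>
    (contDiffAt_pderiv hv j).differentiableAt (by simp)
  have h1 : ∀ k, pderiv k (fun z => (∑ j, Q z j k * pderiv j v z) * u z) y
      = (∑ j, Q y j k * pderiv j v y * pderiv k u y)
        + u y * ∑ j, Q y j k * pderiv k (pderiv j v) y
        + u y * ∑ j, pderiv j v y * pderiv k (fun z => Q z j k) y := by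
    intro k
    have hm : ∀ j ∈ Finset.univ, DifferentiableAt ℝ (fun z => Q z j k * pderiv j v z) y :=
      fun j _ => (hQ j k).fun_mul (hdv j)
    rw [pderiv_mul (DifferentiableAt.fun_sum hm) hu, pderiv_sum hm, Finset.sum_mul, add_assoc,
      ← mul_add, ← Finset.sum_add_distrib]
    congr 2
    exact Finset.sum_congr rfl fun j _ => pderiv_mul (hQ j k) (hdv j) k
  simp only [h1, Finset.sum_add_distrib, ← Finset.mul_sum]
  -- The symmetric Hessian of `v` contracted with the antisymmetric `Q`.
  have h2 : ∑ k, ∑ j, Q y j k * pderiv k (pderiv j v) y = 0 := by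
    have h3 : ∑ k, ∑ j, Q y j k * pderiv k (pderiv j v) y
        = -∑ k, ∑ j, Q y j k * pderiv k (pderiv j v) y := by
      conv_lhs => rw [Finset.sum_comm]
      rw [← Finset.sum_neg_distrib]
      refine Finset.sum_congr rfl fun j _ => ?_
      rw [← Finset.sum_neg_distrib]
      refine Finset.sum_congr rfl fun k _ => ?_
      rw [hskew, pderiv_comm hv]
      ring
    linarith
  have h4 : ∑ k, ∑ j, pderiv j v y * pderiv k (fun z => Q z j k) y = 0 := by
    rw [Finset.sum_comm]
    simp only [← Finset.mul_sum, hdiv, mul_zero, Finset.sum_const_zero]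
  rw [h2, h4, mul_zero, add_zero, add_zero, Finset.sum_comm]

end Pderiv

section ChartTensor

variable [IsManifold (𝓡 d) ∞ M] (Ω : SymplecticForm d M)
  {e : OpenPartialHomeomorph M (EuclideanSpace ℝ (Fin d))} {y : EuclideanSpace ℝ (Fin d)}

/-- The Poisson tensor in a chart, multiplied by the Liouville density. -/
def chartTensor (Ω : SymplecticForm d M)
    (e : OpenPartialHomeomorph M (EuclideanSpace ℝ (Fin d))) (y : EuclideanSpace ℝ (Fin d))
    (j k : Fin d) : ℝ :=
  √(chartMatrix Ω e y).det * (chartMatrix Ω e y)⁻¹ j k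

theorem contDiffAt_chartTensor (he : e ∈ atlas (EuclideanSpace ℝ (Fin d)) M) (hy : y ∈ e.target)
    (j k : Fin d) : ContDiffAt ℝ ∞ (fun z => chartTensor Ω e z j k) y :=
  (contDiffAt_chartDensity Ω he hy).mul (contDiffAt_matrix_inv (contDiffAt_chartMatrix Ω he hy)
    (det_chartMatrix_ne_zero Ω he hy) j k)

theorem chartTensor_skew (he : e ∈ atlas (EuclideanSpace ℝ (Fin d)) M) (hy : y ∈ e.target)
    (j k : Fin d) : chartTensor Ω e y j k = -chartTensor Ω e y k j := by
  have hT : (chartMatrix Ω e y).transpose = -chartMatrix Ω e y := by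
    ext i j; exact chartMatrix_skew Ω y j i
  have : ((chartMatrix Ω e y)⁻¹).transpose = -(chartMatrix Ω e y)⁻¹ := by
    rw [Matrix.transpose_nonsing_inv, hT]
    refine Matrix.inv_eq_left_inv ?_
    rw [neg_mul_neg, Matrix.nonsing_inv_mul _
      (isUnit_iff_ne_zero.2 (det_chartMatrix_ne_zero Ω he hy))]
  have h : (chartMatrix Ω e y)⁻¹ k j = -(chartMatrix Ω e y)⁻¹ j k :=
    congrFun (congrFun this j) k
  rw [chartTensor, chartTensor, h]
  ring

theorem sum_pderiv_chartTensor (he : e ∈ atlas (EuclideanSpace ℝ (Fin d)) M) (hy : y ∈ e.target)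
    (j : Fin d) : ∑ k, pderiv k (fun z => chartTensor Ω e z j k) y = 0 :=
  sum_pderiv_sqrt_det_mul_inv
    (fun i j => (contDiffAt_chartMatrix Ω he hy i j).of_le (by simp))
    (fun z i j => chartMatrix_skew Ω z i j) (det_chartMatrix_ne_zero Ω he hy)
    (chartMatrix_closed Ω he hy) j

/-- In a chart, the Poisson bracket times the Liouville density is a divergence. -/
theorem chartDensity_mul_bracketReal (he : e ∈ atlas (EuclideanSpace ℝ (Fin d)) M)
    (hy : y ∈ e.target) {F G : M → ℝ} (hF : ContMDiffAt (𝓡 d) 𝓘(ℝ, ℝ) ∞ F (e.symm y))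
    (hG : ContMDiffAt (𝓡 d) 𝓘(ℝ, ℝ) ∞ G (e.symm y)) :
    Ω.chartDensity e y * Ω.bracketReal F G (e.symm y)
      = ∑ k, pderiv k (fun z => (∑ j, chartTensor Ω e z j k * pderiv j (G ∘ e.symm) z) *
          F (e.symm z)) y := by
  rw [sum_pderiv_antisymm_flux (u := fun z => F (e.symm z))
    (fun j k => (contDiffAt_chartTensor Ω he hy j k).differentiableAt (by simp))
    (chartTensor_skew Ω he hy) (sum_pderiv_chartTensor Ω he hy) (contDiffAt_comp_symm he hy hG)
    ((contDiffAt_comp_symm he hy hF).differentiableAt (by simp)),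
    bracketReal_symm_apply Ω he hy (hF.mdifferentiableAt (by simp))
      (hG.mdifferentiableAt (by simp)), Finset.mul_sum]
  refine Finset.sum_congr rfl fun j _ => ?_
  rw [Finset.mul_sum]
  refine Finset.sum_congr rfl fun k _ => ?_
  rw [chartTensor, chartDensity_eq]
  change _ = _ * _ * _ * pderiv k (F ∘ e.symm) y
  ring

variable [T2Space M] [SecondCountableTopology M] [MeasurableSpace M] [BorelSpace M]

omit [T2Space M] in
theorem integral_bracketReal_eq_zero_of_chart (he : e ∈ atlas (EuclideanSpace ℝ (Fin d)) M)
    {F G : M → ℝ} (hF : F ∈ testFunctions d M) (hFe : tsupport F ⊆ e.source)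
    (hG : ContMDiff (𝓡 d) 𝓘(ℝ, ℝ) ∞ G) : ∫ x, Ω.bracketReal F G x ∂Ω.liouville = 0 := by
  have hB := contMDiff_bracketReal Ω hF.1 hG
  have hB0 : ∀ x ∉ tsupport F, Ω.bracketReal F G x = 0 := by
    intro x hx
    rw [bracketReal_swap]
    by_contra hn
    exact hx (support_bracketReal_right Ω (by simpa using hn))
  rw [integral_liouville_eq Ω he hB.continuous fun x hx => hB0 x fun h => hx (hFe h)]
  set K := e '' tsupport F with hKdef
  have hK : IsCompact K := hF.2.isCompact.image_of_continuousOn (e.continuousOn.mono hFe)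
  have hKt : K ⊆ e.target := by
    rintro _ ⟨x, hx, rfl⟩; exact e.map_source (hFe hx)
  have hK0 : ∀ y ∈ e.target, y ∉ K → e.symm y ∉ tsupport F := fun y hy hyK h =>
    hyK ⟨_, h, e.right_inv hy⟩
  classical
  -- The flux carries the factor `F`, so within the chart target it already vanishes off `K`;
  -- extending it by zero gives a smooth compactly supported field on all of Euclidean space.
  let w : Fin d → EuclideanSpace ℝ (Fin d) → ℝ := fun k y => if y ∈ K then
    (∑ j, chartTensor Ω e y j k * pderiv j (G ∘ e.symm) y) * F (e.symm y) else 0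
  have hw : ∀ k, ∀ y ∈ e.target, w k =ᶠ[nhds y] fun z =>
      (∑ j, chartTensor Ω e z j k * pderiv j (G ∘ e.symm) z) * F (e.symm z) := by
    intro k y hy
    filter_upwards [e.open_target.mem_nhds hy] with z hz
    by_cases hzK : z ∈ K
    · simp [w, hzK]
    · simp [w, hzK, image_eq_zero_of_notMem_tsupport (hK0 z hz hzK)]
  have hw0 : ∀ k, ∀ y ∉ K, w k y = 0 := fun k y hy => by simp [w, hy]
  have hws : ∀ k, ContDiff ℝ ∞ (w k) := by
    intro k
    refine contDiff_of_eq_zero_off_compact hK (fun y hy => ?_) (hw0 k)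
    refine ContDiffAt.congr_of_eventuallyEq ?_ (hw k y (hKt hy))
    exact (ContDiffAt.sum fun j _ => (contDiffAt_chartTensor Ω he (hKt hy) j k).mul
      (contDiffAt_pderiv (contDiffAt_comp_symm he (hKt hy) hG.contMDiffAt) j)).mul
      (contDiffAt_comp_symm he (hKt hy) hF.1.contMDiffAt)
  have hwc : ∀ k, HasCompactSupport (w k) := fun k => HasCompactSupport.intro hK (hw0 k)
  have hi : ∀ k ∈ Finset.univ, Integrable (pderiv k (w k)) := fun k _ =>
    (((hws k).continuous_fderiv (by simp)).clm_apply
      continuous_const).integrable_of_hasCompactSupport ((hwc k).fderiv_apply (𝕜 := ℝ) _)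
  have h1 : ∫ y in e.target, Ω.chartDensity e y * Ω.bracketReal F G (e.symm y)
      = ∫ y in e.target, ∑ k, pderiv k (w k) y := by
    refine setIntegral_congr_fun e.open_target.measurableSet fun y hy => ?_
    rw [chartDensity_mul_bracketReal Ω he hy hF.1.contMDiffAt hG.contMDiffAt]
    exact Finset.sum_congr rfl fun k _ => (pderiv_congr (hw k y hy) k).symm
  rw [h1, setIntegral_eq_integral_of_forall_compl_eq_zero, integral_finsetSum _ hi]
  · exact Finset.sum_eq_zero fun k _ => integral_pderiv_eq_zero ((hws k).of_le (by simp)) (hwc k) k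
  · intro y hy
    refine Finset.sum_eq_zero fun k _ => ?_
    have : w k =ᶠ[nhds y] fun _ => 0 := by
      filter_upwards [hK.isClosed.isOpen_compl.mem_nhds fun h => hy (hKt h)] with z hz
        using hw0 k z hz
    rw [pderiv_congr this]
    simp [pderiv]

omit [T2Space M] in
theorem liouville_isLocallyFiniteMeasure : IsLocallyFiniteMeasure Ω.liouville where
  finiteAtNhds x := by
    set e := chartAt (EuclideanSpace ℝ (Fin d)) x
    have he : e ∈ atlas (EuclideanSpace ℝ (Fin d)) M := chart_mem_atlas _ x
    have hx : x ∈ e.source := mem_chart_source _ x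
    have hev : ∀ᶠ y in nhds (e x), y ∈ e.target ∧
        Ω.chartDensity e y ≤ Ω.chartDensity e (e x) + 1 :=
      (e.open_target.eventually_mem (e.map_source hx)).and
        ((contDiffAt_chartDensity Ω he (e.map_source hx)).continuousAt.eventually_le_const
          (lt_add_one _))
    obtain ⟨ε, hε, hball⟩ := Metric.eventually_nhds_iff_ball.1 hev
    have hVo : IsOpen (e.source ∩ e ⁻¹' Metric.ball (e x) ε) :=
      e.isOpen_inter_preimage Metric.isOpen_ball
    refine ⟨e.source ∩ e ⁻¹' Metric.ball (e x) ε, hVo.mem_nhds ⟨hx, Metric.mem_ball_self hε⟩, ?_⟩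
    rw [liouville_apply_of_subset Ω he hVo.measurableSet Set.inter_subset_left,
      chartMeasure_apply Ω hVo.measurableSet]
    have hsub : e.target ∩ e.symm ⁻¹' (e.source ∩ e ⁻¹' Metric.ball (e x) ε)
        ⊆ Metric.ball (e x) ε := by
      rintro y ⟨hy, -, hy2⟩
      rwa [Set.mem_preimage, e.right_inv hy] at hy2
    refine (lintegral_mono_set hsub).trans_lt ?_
    refine (setLIntegral_mono' measurableSet_ball
      (g := fun _ => ENNReal.ofReal (Ω.chartDensity e (e x) + 1)) fun y hy =>
        ENNReal.ofReal_le_ofReal (hball y hy).2).trans_lt ?_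
    rw [setLIntegral_const]
    exact ENNReal.mul_lt_top ENNReal.ofReal_lt_top measure_ball_lt_top

omit [IsManifold (𝓡 d) ∞ M] [T2Space M] [SecondCountableTopology M] [MeasurableSpace M]
  [BorelSpace M] in
theorem bracketReal_sum_right {ι : Type*} (t : Finset ι) {F : M → ℝ} {g : ι → M → ℝ}
    (hg : ∀ i ∈ t, ContMDiff (𝓡 d) 𝓘(ℝ, ℝ) ∞ (g i)) (x : M) :
    Ω.bracketReal F (∑ i ∈ t, g i) x = ∑ i ∈ t, Ω.bracketReal F (g i) x := by
  classical
  induction t using Finset.induction_on with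
  | empty => exact bracketReal_const_right Ω 0
  | insert i t hi ih =>
    have hs : ContMDiff (𝓡 d) 𝓘(ℝ, ℝ) ∞ (∑ i ∈ t, g i) :=
      contMDiff_finsetSum' fun j hj => hg j (Finset.mem_insert_of_mem hj)
    rw [Finset.sum_insert hi, Finset.sum_insert hi,
      ← ih fun j hj => hg j (Finset.mem_insert_of_mem hj)]
    exact bracketReal_add_right Ω
      ((hg i (Finset.mem_insert_self i t)).mdifferentiable (by simp) x)
      (hs.mdifferentiable (by simp) x)

/-- The Liouville integral of a Poisson bracket with a test function vanishes. -/
theorem integral_bracketReal_eq_zero {F G : M → ℝ} (hF : ContMDiff (𝓡 d) 𝓘(ℝ, ℝ) ∞ F)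
    (hG : G ∈ testFunctions d M) : ∫ x, Ω.bracketReal F G x ∂Ω.liouville = 0 := by
  have := liouville_isLocallyFiniteMeasure Ω
  obtain ⟨t, g, hg, rfl⟩ := exists_sum_subordinate hG
    (fun x => (chartAt (EuclideanSpace ℝ (Fin d)) x).open_source) fun x => mem_chart_source _ x
  simp only [bracketReal_sum_right Ω t fun i hi => (hg i hi).1.1]
  rw [integral_finsetSum]
  · refine Finset.sum_eq_zero fun i hi => ?_
    -- The localised pieces of `G` are moved into the first slot, where the chart version expects
    -- the compact support.
    simp only [bracketReal_swap Ω F]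
    rw [integral_neg, integral_bracketReal_eq_zero_of_chart Ω (chart_mem_atlas _ i) (hg i hi).1
      (hg i hi).2 hF, neg_zero]
  · intro i hi
    exact (contMDiff_bracketReal Ω hF (hg i hi).1.1).continuous.integrable_of_hasCompactSupport
      (hasCompactSupport_bracketReal_right Ω (hg i hi).1.2)

end ChartTensor

end Divergence

/-! ### Brackets with a function vanishing at infinity, and the real KMS identity. -/

section VanishingAtInfinity

/-- The derivative of a real function vanishes almost everywhere on its zero set. -/
theorem ae_fderiv_eq_zero_of_eq_zero {E : Type*} [NormedAddCommGroup E] [NormedSpace ℝ E]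
    [FiniteDimensional ℝ E] [MeasurableSpace E] [BorelSpace E] (μ : Measure E)
    [μ.IsAddHaarMeasure] {u : E → ℝ} {s : Set E} (hs : MeasurableSet s)
    (hu : ∀ y ∈ s, DifferentiableAt ℝ u y) (h0 : ∀ y ∈ s, u y = 0) :
    ∀ᵐ y ∂μ.restrict s, fderiv ℝ u y = 0 := by
  rcases subsingleton_or_nontrivial E with hE | hE
  · exact Filter.Eventually.of_forall fun y => by
      ext v; rw [Subsingleton.elim v 0, map_zero, map_zero]
  obtain ⟨v, hv⟩ := exists_ne (0 : E)
  -- On `s` the map `u • v` is zero, hence approximated by the zero linear map with constant `0`,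
  -- and the almost everywhere derivative estimate forces its derivative to vanish. The nonzero
  -- vector `v` only serves to turn `u` into a self-map of `E`.
  have happ : ApproximatesLinearOn (fun y => u y • v) (0 : E →L[ℝ] E) s 0 := by
    intro x hx y hy
    simp [h0 x hx, h0 y hy]
  filter_upwards [happ.norm_fderiv_sub_le μ hs (fun y => (fderiv ℝ u y).smulRight v)
    fun y hy => ((hu y hy).hasFDerivAt.smul_const v).hasFDerivWithinAt] with y hy
  simpa [hv] using hy

variable {d : ℕ} {M : Type*} [TopologicalSpace M] [ChartedSpace (EuclideanSpace ℝ (Fin d)) M]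
  [IsManifold (𝓡 d) ∞ M] [T2Space M] [SecondCountableTopology M]
  [MeasurableSpace M] [BorelSpace M] (Ω : SymplecticForm d M)

omit [T2Space M] in
-- Cutoffs of the form `χₙ(F)` tend to the indicator of `F ≠ 0` rather than to `1`; this shows that
-- nothing is lost on the zero set.
theorem ae_bracketReal_eq_zero {F G : M → ℝ} (hF : ContMDiff (𝓡 d) 𝓘(ℝ, ℝ) ∞ F)
    (hG : ContMDiff (𝓡 d) 𝓘(ℝ, ℝ) ∞ G) :
    ∀ᵐ x ∂Ω.liouville, F x = 0 → Ω.bracketReal F G x = 0 := by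
  have hm : MeasurableSet {x | F x = 0 ∧ Ω.bracketReal F G x ≠ 0} :=
    (isClosed_eq hF.continuous continuous_const).measurableSet.inter
      (isOpen_ne_fun (contMDiff_bracketReal Ω hF hG).continuous continuous_const).measurableSet
  rw [ae_iff]
  have hset : {x | ¬(F x = 0 → Ω.bracketReal F G x = 0)}
      = {x | F x = 0 ∧ Ω.bracketReal F G x ≠ 0} := by
    ext x; simp
  rw [hset]
  refine liouville_eq_zero_of_forall_chart Ω hm fun e he => ?_
  set s := e.target ∩ e.symm ⁻¹' {x | F x = 0} with hs
  have hsm : MeasurableSet s := measurableSet_target_inter_preimage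
    (isClosed_eq hF.continuous continuous_const).measurableSet
  have h1 := ae_imp_of_ae_restrict (ae_fderiv_eq_zero_of_eq_zero volume (u := F ∘ e.symm) hsm
    (fun y hy => (contDiffAt_comp_symm he hy.1 hF.contMDiffAt).differentiableAt (by simp))
    fun y hy => hy.2)
  refine measure_mono_null (fun y hy => ?_) (ae_iff.1 h1)
  simp only [Set.mem_ofPred_eq, Classical.not_imp]
  refine ⟨⟨hy.1, hy.2.1⟩, fun h0 => hy.2.2 ?_⟩
  rw [bracketReal_symm_apply Ω he hy.1 (hF.mdifferentiable (by simp) _)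
    (hG.mdifferentiable (by simp) _)]
  have : ∀ k, pderiv k (F ∘ e.symm) y = 0 := fun k => by simp [pderiv, h0]
  simp [this]

/-- If `F` vanishes at infinity, then the integral of `{F, G}` vanishes as soon as it converges. -/
theorem integral_bracketReal_eq_zero_of_tendsto {F G : M → ℝ}
    (hF : ContMDiff (𝓡 d) 𝓘(ℝ, ℝ) ∞ F) (hG : ContMDiff (𝓡 d) 𝓘(ℝ, ℝ) ∞ G)
    (h0 : Filter.Tendsto F (Filter.cocompact M) (nhds 0))
    (hi : Integrable (Ω.bracketReal F G) Ω.liouville) :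
    ∫ x, Ω.bracketReal F G x ∂Ω.liouville = 0 := by
  -- `χ n` is `0` for `|t| ≤ 1 / (n + 1)` and `1` for `|t| ≥ √2 / (n + 1)`. So `χ n ∘ F` has compact
  -- support and tends to `1` wherever `F ≠ 0`.
  let χ : ℕ → ℝ → ℝ := fun n t => Real.smoothTransition (((n + 1) * t) ^ 2 - 1)
  have hχ : ∀ n, ContDiff ℝ ∞ (χ n) := fun n =>
    Real.smoothTransition.contDiff.comp (by fun_prop)
  have hχF : ∀ n, ContMDiff (𝓡 d) 𝓘(ℝ, ℝ) ∞ fun x => χ n (F x) := fun n =>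
    (hχ n).contMDiff.comp hF
  have hχc : ∀ n, HasCompactSupport fun x => χ n (F x) := by
    intro n
    have hpos : (0 : ℝ) < 1 / (n + 1) := by positivity
    obtain ⟨K, hK, hKF⟩ := Filter.mem_cocompact.1 (h0 (Metric.ball_mem_nhds 0 hpos))
    refine HasCompactSupport.intro hK fun x hx => Real.smoothTransition.zero_of_nonpos ?_
    have h1 : |F x| < 1 / (n + 1) := by simpa using hKF hx
    have h2 : |(n + 1) * F x| ≤ 1 := by
      rw [abs_mul, abs_of_pos (by positivity : (0 : ℝ) < n + 1)]
      rw [lt_div_iff₀ (by positivity)] at h1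
      linarith
    have h3 : ((n + 1) * F x) ^ 2 ≤ 1 := (sq_le_one_iff_abs_le_one _).2 h2
    linarith
  -- `{F, G χₙ(F)} = χₙ(F) {F, G}` because `{F, F} = 0`, and `G χₙ(F)` is a test function.
  have hzero : ∀ n, ∫ x, χ n (F x) * Ω.bracketReal F G x ∂Ω.liouville = 0 := by
    intro n
    have h1 : (fun x => G x * χ n (F x)) ∈ testFunctions d M :=
      mul_mem_testFunctions hG ⟨hχF n, hχc n⟩
    rw [← integral_bracketReal_eq_zero Ω hF h1]
    refine integral_congr_ae (Filter.Eventually.of_forall fun x => ?_)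
    beta_reduce
    rw [bracketReal_mul_right Ω (hG.mdifferentiable (by simp) x)
      ((hχF n).mdifferentiable (by simp) x),
      bracketReal_comp_right Ω ((hχ n).differentiable (by simp) _)
      (hF.mdifferentiable (by simp) x), bracketReal_self]
    ring
  have hlim : Filter.Tendsto (fun n => ∫ x, χ n (F x) * Ω.bracketReal F G x ∂Ω.liouville)
      Filter.atTop (nhds (∫ x, Ω.bracketReal F G x ∂Ω.liouville)) := by
    refine tendsto_integral_of_dominated_convergence (fun x => ‖Ω.bracketReal F G x‖)
      (fun n => ((hχF n).continuous.mul
        (contMDiff_bracketReal Ω hF hG).continuous).aestronglyMeasurable) hi.norm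
      (fun n => Filter.Eventually.of_forall fun x => ?_) ?_
    · rw [norm_mul, Real.norm_of_nonneg (Real.smoothTransition.nonneg _)]
      exact mul_le_of_le_one_left (norm_nonneg _) (Real.smoothTransition.le_one _)
    · filter_upwards [ae_bracketReal_eq_zero Ω hF hG] with x hx
      by_cases hFx : F x = 0
      · simp [hx hFx]
      · refine tendsto_const_nhds.congr' ?_
        obtain ⟨N, hN⟩ := exists_nat_gt (2 / |F x|)
        filter_upwards [Filter.eventually_ge_atTop N] with n hn
        have hpos : 0 < |F x| := abs_pos.2 hFx
        have h1 : 2 ≤ |(n + 1) * F x| := by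
          rw [abs_mul, abs_of_pos (by positivity : (0 : ℝ) < n + 1)]
          rw [div_lt_iff₀ hpos] at hN
          have : (N : ℝ) ≤ n := by exact_mod_cast hn
          nlinarith
        have h2 : 1 ≤ ((n + 1) * F x) ^ 2 - 1 := by
          rw [← sq_abs]
          nlinarith
        rw [show χ n (F x) = 1 from Real.smoothTransition.one_of_one_le h2, one_mul]
  simp only [hzero] at hlim
  exact (tendsto_nhds_unique hlim tendsto_const_nhds)

omit [T2Space M] [SecondCountableTopology M] [MeasurableSpace M] [BorelSpace M]
  [IsManifold (𝓡 d) ∞ M] in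
theorem contMDiff_exp_mul {h : M → ℝ} (hh : ContMDiff (𝓡 d) 𝓘(ℝ, ℝ) ∞ h) (b : ℝ) :
    ContMDiff (𝓡 d) 𝓘(ℝ, ℝ) ∞ fun x => Real.exp (b * h x) :=
  (Real.contDiff_exp.comp (contDiff_const.mul contDiff_id)).contMDiff.comp hh

omit [T2Space M] [SecondCountableTopology M] [MeasurableSpace M] [BorelSpace M]
  [IsManifold (𝓡 d) ∞ M] in
-- Used with both signs: `b = -β` turns the KMS identity of the Gibbs density into a vanishing
-- integral, `b = β` turns a KMS functional into one that kills brackets.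
theorem bracketReal_exp_mul {f g h : M → ℝ} (hg : ContMDiff (𝓡 d) 𝓘(ℝ, ℝ) ∞ g)
    (hh : ContMDiff (𝓡 d) 𝓘(ℝ, ℝ) ∞ h) (b : ℝ) (x : M) :
    Ω.bracketReal f (fun z => Real.exp (b * h z) * g z) x
      = Real.exp (b * h x) * (Ω.bracketReal f g x + b * (Ω.bracketReal f h x * g x)) := by
  rw [bracketReal_mul_right Ω ((contMDiff_exp_mul hh b).mdifferentiable (by simp) x)
    (hg.mdifferentiable (by simp) x)]
  have h1 : DifferentiableAt ℝ (fun t => Real.exp (b * t)) (h x) := by fun_prop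
  have h2 : deriv (fun t => Real.exp (b * t)) (h x) = Real.exp (b * h x) * b := by
    have := ((hasDerivAt_id (h x)).const_mul b).exp.deriv
    simpa using this
  rw [bracketReal_comp_right Ω h1 (hh.mdifferentiable (by simp) x), h2]
  ring

/-- The KMS condition of the Gibbs density, for real functions. -/
theorem integral_exp_mul_kms_real {f g h : M → ℝ} (hf : ContMDiff (𝓡 d) 𝓘(ℝ, ℝ) ∞ f)
    (hg : ContMDiff (𝓡 d) 𝓘(ℝ, ℝ) ∞ g) (hh : ContMDiff (𝓡 d) 𝓘(ℝ, ℝ) ∞ h) {β : ℝ}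
    (h0 : Filter.Tendsto f (Filter.cocompact M) (nhds 0))
    (hint : Integrable (fun x => Real.exp (-β * h x)) Ω.liouville) {C C' : ℝ}
    (hC : ∀ x, |Ω.bracketReal f g x| ≤ C) (hC' : ∀ x, |Ω.bracketReal f h x * g x| ≤ C') :
    Integrable (fun x => Real.exp (-β * h x) * Ω.bracketReal f g x) Ω.liouville ∧
    Integrable (fun x => Real.exp (-β * h x) * (Ω.bracketReal f h x * g x)) Ω.liouville ∧
    ∫ x, Real.exp (-β * h x) * Ω.bracketReal f g x ∂Ω.liouville
      = β * ∫ x, Real.exp (-β * h x) * (Ω.bracketReal f h x * g x) ∂Ω.liouville := by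
  have h1 : Integrable (fun x => Real.exp (-β * h x) * Ω.bracketReal f g x) Ω.liouville :=
    hint.mul_bdd (c := C) (contMDiff_bracketReal Ω hf hg).continuous.aestronglyMeasurable
      (Filter.Eventually.of_forall hC)
  have h2 : Integrable (fun x => Real.exp (-β * h x) * (Ω.bracketReal f h x * g x)) Ω.liouville :=
    hint.mul_bdd (c := C')
      ((contMDiff_bracketReal Ω hf hh).continuous.mul hg.continuous).aestronglyMeasurable
      (Filter.Eventually.of_forall hC')
  have h3 : Ω.bracketReal f (fun z => Real.exp (-β * h z) * g z)
      = fun x => Real.exp (-β * h x) * Ω.bracketReal f g x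
        - β * (Real.exp (-β * h x) * (Ω.bracketReal f h x * g x)) := by
    funext x
    rw [bracketReal_exp_mul Ω hg hh]
    ring
  have h4 := integral_bracketReal_eq_zero_of_tendsto Ω hf
    (contMDiff_mul (contMDiff_exp_mul hh (-β)) hg) h0 (by
      rw [h3]; exact h1.sub (h2.const_mul β))
  rw [h3, integral_sub h1 (h2.const_mul β), integral_const_mul] at h4
  exact ⟨h1, h2, by linarith⟩

end VanishingAtInfinity

/-! ### The KMS identity for complex functions in a Poisson algebra. -/

section ComplexValued

variable {d : ℕ} {M : Type*} [TopologicalSpace M] [ChartedSpace (EuclideanSpace ℝ (Fin d)) M]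
  (Ω : SymplecticForm d M)

theorem contMDiff_re {f : M → ℂ} (hf : ContMDiff (𝓡 d) 𝓘(ℝ, ℂ) ∞ f) :
    ContMDiff (𝓡 d) 𝓘(ℝ, ℝ) ∞ fun x => (f x).re :=
  Complex.reCLM.contDiff.contMDiff.comp hf

theorem contMDiff_im {f : M → ℂ} (hf : ContMDiff (𝓡 d) 𝓘(ℝ, ℂ) ∞ f) :
    ContMDiff (𝓡 d) 𝓘(ℝ, ℝ) ∞ fun x => (f x).im :=
  Complex.imCLM.contDiff.contMDiff.comp hf

theorem contMDiff_ofReal {f : M → ℝ} (hf : ContMDiff (𝓡 d) 𝓘(ℝ, ℝ) ∞ f) :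
    ContMDiff (𝓡 d) 𝓘(ℝ, ℂ) ∞ fun x => (f x : ℂ) :=
  Complex.ofRealCLM.contDiff.contMDiff.comp hf

theorem contMDiff_complex_of_re_im {f : M → ℂ} (hr : ContMDiff (𝓡 d) 𝓘(ℝ, ℝ) ∞ fun x => (f x).re)
    (hi : ContMDiff (𝓡 d) 𝓘(ℝ, ℝ) ∞ fun x => (f x).im) : ContMDiff (𝓡 d) 𝓘(ℝ, ℂ) ∞ f := by
  have h := (Complex.equivRealProdCLM.symm.contDiff (n := ∞)).contMDiff.comp (hr.prodMk_space hi)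
  convert h using 1
  funext x
  exact (Complex.equivRealProd.symm_apply_apply (f x)).symm

theorem vectorFieldApply_hamiltonianField {f : M → ℂ} (hf : ContMDiff (𝓡 d) 𝓘(ℝ, ℂ) ∞ f)
    (h : M → ℝ) (x : M) : vectorFieldApply (Ω.hamiltonianField h) f x
      = (Ω.bracketReal (fun z => (f z).re) h x : ℂ)
        + Complex.I * (Ω.bracketReal (fun z => (f z).im) h x : ℂ) := by
  have hfx := hf.mdifferentiable (by simp) x
  have hre : dirDeriv (fun z => (f z).re) x (Ω.hamiltonianField h x)
      = (vectorFieldApply (Ω.hamiltonianField h) f x).re := by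
    have h1 := mfderiv_comp x (Complex.reCLM.differentiableAt.mdifferentiableAt (x := f x)) hfx
    rw [mfderiv_eq_fderiv, Complex.reCLM.fderiv] at h1
    exact congrArg (fun L => L (Ω.hamiltonianField h x)) h1
  have him : dirDeriv (fun z => (f z).im) x (Ω.hamiltonianField h x)
      = (vectorFieldApply (Ω.hamiltonianField h) f x).im := by
    have h1 := mfderiv_comp x (Complex.imCLM.differentiableAt.mdifferentiableAt (x := f x)) hfx
    rw [mfderiv_eq_fderiv, Complex.imCLM.fderiv] at h1
    exact congrArg (fun L => L (Ω.hamiltonianField h x)) h1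
  rw [bracketReal_eq, bracketReal_eq, hre, him, mul_comm Complex.I, Complex.re_add_im]

theorem bracket_re (f g : M → ℂ) (x : M) : (Ω.bracket f g x).re
    = Ω.bracketReal (fun z => (f z).re) (fun z => (g z).re) x
      - Ω.bracketReal (fun z => (f z).im) (fun z => (g z).im) x := by
  simp [SymplecticForm.bracket]

theorem bracket_im (f g : M → ℂ) (x : M) : (Ω.bracket f g x).im
    = Ω.bracketReal (fun z => (f z).re) (fun z => (g z).im) x
      + Ω.bracketReal (fun z => (f z).im) (fun z => (g z).re) x := by
  simp [SymplecticForm.bracket]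

theorem bracketReal_neg_left {F G : M → ℝ} (x : M) :
    Ω.bracketReal (fun z => -F z) G x = -Ω.bracketReal F G x := by
  have h1 : mfderiv (𝓡 d) 𝓘(ℝ, ℝ) (fun z => -F z) x = -mfderiv (𝓡 d) 𝓘(ℝ, ℝ) F x :=
    mfderiv_neg
  rw [bracketReal_eq, bracketReal_eq]
  exact congrArg (fun L => L (Ω.hamiltonianField G x)) h1

variable [IsManifold (𝓡 d) ∞ M]

theorem contMDiff_bracket {f g : M → ℂ} (hf : ContMDiff (𝓡 d) 𝓘(ℝ, ℂ) ∞ f)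
    (hg : ContMDiff (𝓡 d) 𝓘(ℝ, ℂ) ∞ g) : ContMDiff (𝓡 d) 𝓘(ℝ, ℂ) ∞ (Ω.bracket f g) := by
  refine contMDiff_complex_of_re_im ?_ ?_
  · simp only [bracket_re]
    exact (contMDiff_bracketReal Ω (contMDiff_re hf) (contMDiff_re hg)).sub
      (contMDiff_bracketReal Ω (contMDiff_im hf) (contMDiff_im hg))
  · simp only [bracket_im]
    exact (contMDiff_bracketReal Ω (contMDiff_re hf) (contMDiff_im hg)).add
      (contMDiff_bracketReal Ω (contMDiff_im hf) (contMDiff_re hg))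

/-- A continuous function with compact support, as a function vanishing at infinity. -/
def ofCompactSupport (f : M → ℂ) (hf : Continuous f) (hc : HasCompactSupport f) : C₀(M, ℂ) where
  toFun := f
  continuous_toFun := hf
  zero_at_infty' := hc.is_zero_at_infty

theorem isPoissonStarSubalgebra_smoothCompact [T2Space M] :
    IsPoissonStarSubalgebra Ω (smoothCompact d M) where
  smooth _ hf := hf.1
  bracket_mem f hf g hg := by
    have hs := contMDiff_bracket Ω hf.1 hg.1
    have hc : HasCompactSupport (Ω.bracket f g) := by
      refine HasCompactSupport.intro hg.2.isCompact fun x hx => ?_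
      have hr : tsupport (fun z => (g z).re) ⊆ tsupport g :=
        closure_mono fun z (hz : (g z).re ≠ 0) (h : g z = 0) => hz (by simp [h])
      have hi : tsupport (fun z => (g z).im) ⊆ tsupport g :=
        closure_mono fun z (hz : (g z).im ≠ 0) (h : g z = 0) => hz (by simp [h])
      have h1 : ∀ F, Ω.bracketReal F (fun z => (g z).re) x = 0 := fun F => by
        by_contra hn
        exact hx (hr (support_bracketReal_right Ω hn))
      have h2 : ∀ F, Ω.bracketReal F (fun z => (g z).im) x = 0 := fun F => by
        by_contra hn
        exact hx (hi (support_bracketReal_right Ω hn))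
      simp [SymplecticForm.bracket, h1, h2]
    exact ⟨ofCompactSupport _ hs.continuous hc, ⟨hs, hc⟩, fun _ => rfl⟩

variable [T2Space M] [SecondCountableTopology M] [MeasurableSpace M] [BorelSpace M]

/-- The Gibbs density satisfies the KMS condition on every Poisson subalgebra. -/
theorem integral_exp_mul_kms {h : M → ℝ} (hh : ContMDiff (𝓡 d) 𝓘(ℝ, ℝ) ∞ h) {β : ℝ}
    (hint : Integrable (fun x => Real.exp (-β * h x)) Ω.liouville)
    {A : NonUnitalStarSubalgebra ℂ C₀(M, ℂ)} (hA : IsPoissonStarSubalgebra Ω A)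
    {f g k l : C₀(M, ℂ)} (hf : f ∈ A) (hg : g ∈ A) (hk : ∀ x, k x = Ω.bracket f g x)
    (hl : ∀ x, l x = vectorFieldApply (Ω.hamiltonianField h) f x * g x) :
    ∫ x, (Real.exp (-β * h x) : ℂ) * k x ∂Ω.liouville
      = β * ∫ x, (Real.exp (-β * h x) : ℂ) * l x ∂Ω.liouville := by
  have hfs := hA.smooth f hf
  have hgs := hA.smooth g hg
  -- `{f̄, g}` is again in `A`, hence bounded. Sums and differences of the components of `{f, g}`
  -- and `{f̄, g}` isolate the four brackets of real and imaginary parts, so each of them is bounded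
  -- and can be integrated separately.
  obtain ⟨k', -, hk'⟩ := hA.bracket_mem (star f) (star_mem hf) g hg
  set f1 : M → ℝ := fun z => (f z).re with hf1
  set f2 : M → ℝ := fun z => (f z).im with hf2
  set g1 : M → ℝ := fun z => (g z).re with hg1
  set g2 : M → ℝ := fun z => (g z).im with hg2
  have hbound : ∀ u : C₀(M, ℂ), ∀ x, ‖u x‖ ≤ ‖u‖ := fun u x => u.toBCF.norm_coe_le_norm x
  have hkre : ∀ x, (k x).re = Ω.bracketReal f1 g1 x - Ω.bracketReal f2 g2 x := fun x => by
    rw [hk, bracket_re]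
  have hkim : ∀ x, (k x).im = Ω.bracketReal f1 g2 x + Ω.bracketReal f2 g1 x := fun x => by
    rw [hk, bracket_im]
  have hsr : (fun z => ((star f : C₀(M, ℂ)) z).re) = f1 := by funext z; simp [hf1]
  have hsi : (fun z => ((star f : C₀(M, ℂ)) z).im) = fun z => -f2 z := by funext z; simp [hf2]
  have hkre' : ∀ x, (k' x).re = Ω.bracketReal f1 g1 x + Ω.bracketReal f2 g2 x := fun x => by
    rw [hk', bracket_re, hsr, hsi, bracketReal_neg_left, sub_neg_eq_add]
  have hkim' : ∀ x, (k' x).im = Ω.bracketReal f1 g2 x - Ω.bracketReal f2 g1 x := fun x => by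
    rw [hk', bracket_im, hsr, hsi, bracketReal_neg_left, ← sub_eq_add_neg]
  have hb : ∀ x, |(k x).re| ≤ ‖k‖ ∧ |(k x).im| ≤ ‖k‖ ∧ |(k' x).re| ≤ ‖k'‖ ∧ |(k' x).im| ≤ ‖k'‖ :=
    fun x => ⟨(Complex.abs_re_le_norm _).trans (hbound k x),
      (Complex.abs_im_le_norm _).trans (hbound k x),
      (Complex.abs_re_le_norm _).trans (hbound k' x),
      (Complex.abs_im_le_norm _).trans (hbound k' x)⟩
  simp only [hkre, hkim, hkre', hkim', abs_le] at hb
  have hY : ∀ x, vectorFieldApply (Ω.hamiltonianField h) f x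
      = (Ω.bracketReal f1 h x : ℂ) + Complex.I * (Ω.bracketReal f2 h x : ℂ) :=
    vectorFieldApply_hamiltonianField Ω hfs h
  -- `Y(f)` and `g` need not have bounded product componentwise a priori; the modulus of `l = Y(f)
  -- g` controls all four products of their components, since `|Re|` and `|Im|` are at most the
  -- modulus.
  have hlb : ∀ x, ‖vectorFieldApply (Ω.hamiltonianField h) f x‖ * ‖g x‖ ≤ ‖l‖ := fun x => by
    rw [← norm_mul, ← hl]; exact hbound l x
  have hY1 : ∀ x, |Ω.bracketReal f1 h x| ≤ ‖vectorFieldApply (Ω.hamiltonianField h) f x‖ :=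
    fun x => by simpa [hY x] using Complex.abs_re_le_norm (vectorFieldApply (Ω.hamiltonianField h) f x)
  have hY2 : ∀ x, |Ω.bracketReal f2 h x| ≤ ‖vectorFieldApply (Ω.hamiltonianField h) f x‖ :=
    fun x => by simpa [hY x] using Complex.abs_im_le_norm (vectorFieldApply (Ω.hamiltonianField h) f x)
  have ht1 : Filter.Tendsto f1 (Filter.cocompact M) (nhds 0) :=
    (Complex.continuous_re.tendsto' 0 0 rfl).comp f.zero_at_infty'
  have ht2 : Filter.Tendsto f2 (Filter.cocompact M) (nhds 0) :=
    (Complex.continuous_im.tendsto' 0 0 rfl).comp f.zero_at_infty'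
  obtain ⟨i11, j11, e11⟩ := integral_exp_mul_kms_real Ω (contMDiff_re hfs) (contMDiff_re hgs) hh
    ht1 hint (C := ‖k‖ + ‖k'‖) (C' := ‖l‖)
    (fun x => abs_le.2 ⟨by linarith [hb x], by linarith [hb x]⟩)
    (fun x => by
      rw [abs_mul]
      exact (mul_le_mul (hY1 x) (Complex.abs_re_le_norm _) (abs_nonneg _)
        (norm_nonneg _)).trans (hlb x))
  obtain ⟨i12, j12, e12⟩ := integral_exp_mul_kms_real Ω (contMDiff_re hfs) (contMDiff_im hgs) hh
    ht1 hint (C := ‖k‖ + ‖k'‖) (C' := ‖l‖)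
    (fun x => abs_le.2 ⟨by linarith [hb x], by linarith [hb x]⟩)
    (fun x => by
      rw [abs_mul]
      exact (mul_le_mul (hY1 x) (Complex.abs_im_le_norm _) (abs_nonneg _)
        (norm_nonneg _)).trans (hlb x))
  obtain ⟨i21, j21, e21⟩ := integral_exp_mul_kms_real Ω (contMDiff_im hfs) (contMDiff_re hgs) hh
    ht2 hint (C := ‖k‖ + ‖k'‖) (C' := ‖l‖)
    (fun x => abs_le.2 ⟨by linarith [hb x], by linarith [hb x]⟩)
    (fun x => by
      rw [abs_mul]
      exact (mul_le_mul (hY2 x) (Complex.abs_re_le_norm _) (abs_nonneg _)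
        (norm_nonneg _)).trans (hlb x))
  obtain ⟨i22, j22, e22⟩ := integral_exp_mul_kms_real Ω (contMDiff_im hfs) (contMDiff_im hgs) hh
    ht2 hint (C := ‖k‖ + ‖k'‖) (C' := ‖l‖)
    (fun x => abs_le.2 ⟨by linarith [hb x], by linarith [hb x]⟩)
    (fun x => by
      rw [abs_mul]
      exact (mul_le_mul (hY2 x) (Complex.abs_im_le_norm _) (abs_nonneg _)
        (norm_nonneg _)).trans (hlb x))
  have hsplit : ∀ a b : M → ℝ, Integrable a Ω.liouville → Integrable b Ω.liouville →
      ∫ x, ((a x : ℂ) + Complex.I * (b x : ℂ)) ∂Ω.liouville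
        = ((∫ x, a x ∂Ω.liouville : ℝ) : ℂ) + Complex.I * ((∫ x, b x ∂Ω.liouville : ℝ) : ℂ) := by
    intro a b ha hb
    rw [integral_add ha.ofReal (hb.ofReal.const_mul _), integral_const_mul,
      integral_complex_ofReal, integral_complex_ofReal]
  have hkI : ∫ x, (Real.exp (-β * h x) : ℂ) * k x ∂Ω.liouville = _ :=
    (integral_congr_ae (Filter.Eventually.of_forall fun x => by
      rw [← Complex.re_add_im (k x), hkre, hkim]
      push_cast
      simp only [Pi.sub_apply, Pi.add_apply]
      push_cast
      ring)).trans (hsplit _ _ (i11.sub i22) (i12.add i21))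
  have hlI : ∫ x, (Real.exp (-β * h x) : ℂ) * l x ∂Ω.liouville = _ :=
    (integral_congr_ae (Filter.Eventually.of_forall fun x => by
      rw [hl, hY, ← Complex.re_add_im (g x)]
      simp only [Pi.sub_apply, Pi.add_apply]
      push_cast
      ring_nf
      rw [Complex.I_sq]
      ring)).trans (hsplit _ _ (j11.sub j22) (j12.add j21))
  rw [hkI, hlI]
  simp only [Pi.sub_apply, Pi.add_apply]
  rw [integral_sub i11 i22, integral_add i12 i21, integral_sub j11 j22, integral_add j12 j21,
    e11, e12, e21, e22]
  push_cast
  ring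

end ComplexValued

/-! ### Transport of functions from a chart to the manifold. -/

section Pullback

variable {d : ℕ} {M : Type*} [TopologicalSpace M] [ChartedSpace (EuclideanSpace ℝ (Fin d)) M]
  {e : OpenPartialHomeomorph M (EuclideanSpace ℝ (Fin d))}

open Classical in
/-- The pullback of a function under a chart, extended by zero. -/
def chartPull (e : OpenPartialHomeomorph M (EuclideanSpace ℝ (Fin d)))
    (v : EuclideanSpace ℝ (Fin d) → ℝ) (x : M) : ℝ :=
  if x ∈ e.source then v (e x) else 0

omit [ChartedSpace (EuclideanSpace ℝ (Fin d)) M] in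
theorem chartPull_of_mem (v : EuclideanSpace ℝ (Fin d) → ℝ) {x : M} (hx : x ∈ e.source) :
    chartPull e v x = v (e x) := if_pos hx

omit [ChartedSpace (EuclideanSpace ℝ (Fin d)) M] in
theorem chartPull_of_notMem (v : EuclideanSpace ℝ (Fin d) → ℝ) {x : M} (hx : x ∉ e.source) :
    chartPull e v x = 0 := if_neg hx

omit [ChartedSpace (EuclideanSpace ℝ (Fin d)) M] in
theorem chartPull_symm (v : EuclideanSpace ℝ (Fin d) → ℝ) {y : EuclideanSpace ℝ (Fin d)}
    (hy : y ∈ e.target) : chartPull e v (e.symm y) = v y := by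
  rw [chartPull_of_mem v (e.map_target hy), e.right_inv hy]

omit [ChartedSpace (EuclideanSpace ℝ (Fin d)) M] in
theorem isCompact_symm_image {K : Set (EuclideanSpace ℝ (Fin d))} (hK : IsCompact K)
    (hKe : K ⊆ e.target) : IsCompact (e.symm '' K) :=
  hK.image_of_continuousOn (e.continuousOn_symm.mono hKe)

omit [ChartedSpace (EuclideanSpace ℝ (Fin d)) M] in
theorem chartPull_eq_zero {K : Set (EuclideanSpace ℝ (Fin d))}
    {v : EuclideanSpace ℝ (Fin d) → ℝ} (hv0 : ∀ y ∉ K, v y = 0) {x : M} (hx : x ∉ e.symm '' K) :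
    chartPull e v x = 0 := by
  by_cases hxe : x ∈ e.source
  · rw [chartPull_of_mem v hxe]
    exact hv0 _ fun h => hx ⟨_, h, e.left_inv hxe⟩
  · exact chartPull_of_notMem v hxe

variable [IsManifold (𝓡 d) ∞ M] [T2Space M]

/-- The image of `K` is compact, hence closed as `M` is Hausdorff, so the extension by zero is
smooth across the boundary of the chart domain. -/
theorem chartPull_mem_testFunctions (he : e ∈ atlas (EuclideanSpace ℝ (Fin d)) M)
    {K : Set (EuclideanSpace ℝ (Fin d))} (hK : IsCompact K) (hKe : K ⊆ e.target)
    {v : EuclideanSpace ℝ (Fin d) → ℝ} (hv : ∀ y ∈ K, ContDiffAt ℝ ∞ v y)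
    (hv0 : ∀ y ∉ K, v y = 0) : chartPull e v ∈ testFunctions d M := by
  have hK' := isCompact_symm_image hK hKe
  refine ⟨fun x => ?_, HasCompactSupport.intro hK' fun x hx => chartPull_eq_zero hv0 hx⟩
  by_cases hx : x ∈ e.symm '' K
  · obtain ⟨y, hy, rfl⟩ := hx
    have hxe : e.symm y ∈ e.source := e.map_target (hKe hy)
    have h1 : ContDiffAt ℝ ∞ v (e (e.symm y)) := by rw [e.right_inv (hKe hy)]; exact hv y hy
    refine (contMDiffAt_comp_chart he hxe h1).congr_of_eventuallyEq ?_
    filter_upwards [e.open_source.mem_nhds hxe] with z hz using chartPull_of_mem v hz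
  · refine (contMDiffAt_const (c := (0 : ℝ))).congr_of_eventuallyEq ?_
    filter_upwards [hK'.isClosed.isOpen_compl.mem_nhds hx] with z hz using chartPull_eq_zero hv0 hz

end Pullback

/-! ### Functionals that annihilate brackets are multiples of the Liouville integral. -/

section LocalUniqueness

variable {d : ℕ} {M : Type*} [TopologicalSpace M] [ChartedSpace (EuclideanSpace ℝ (Fin d)) M]
  [IsManifold (𝓡 d) ∞ M] [T2Space M] (Ω : SymplecticForm d M)
  {e : OpenPartialHomeomorph M (EuclideanSpace ℝ (Fin d))}
  {p : EuclideanSpace ℝ (Fin d)} {r : ℝ}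

omit [T2Space M] in
theorem bracketReal_mem_testFunctions {F G : M → ℝ} (hF : ContMDiff (𝓡 d) 𝓘(ℝ, ℝ) ∞ F)
    (hG : G ∈ testFunctions d M) : Ω.bracketReal F G ∈ testFunctions d M :=
  ⟨contMDiff_bracketReal Ω hF hG.1, hasCompactSupport_bracketReal_right Ω hG.2⟩

theorem pderiv_mem_cubeFunctions {w : EuclideanSpace ℝ (Fin d) → ℝ} (hw : w ∈ cubeFunctions p r)
    (k : Fin d) : pderiv k w ∈ cubeFunctions p r := by
  refine ⟨contDiff_iff_contDiffAt.2 fun y => contDiffAt_pderiv hw.1.contDiffAt k, fun x i hi => ?_⟩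
  have h1 : w =ᶠ[nhds x] fun _ => 0 := by
    have hc : Continuous fun z : EuclideanSpace ℝ (Fin d) => |z i - p i| := by fun_prop
    filter_upwards [hc.continuousAt.eventually_const_lt hi] with z hz using hw.2 z i hz
  rw [pderiv_congr h1]
  simp [pderiv]

theorem eq_zero_of_notMem_cube {w : EuclideanSpace ℝ (Fin d) → ℝ} (hw : w ∈ cubeFunctions p r)
    {y : EuclideanSpace ℝ (Fin d)} (hy : y ∉ {y | ∀ i, |y i - p i| ≤ r}) : w y = 0 := by
  simp only [Set.mem_ofPred_eq, not_forall, not_le] at hy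
  obtain ⟨i, hi⟩ := hy
  exact hw.2 y i hi

/-- Division by the density makes the Liouville integral of the pullback equal to the Lebesgue
integral of `w`. -/
theorem chartPull_div_mem_testFunctions (he : e ∈ atlas (EuclideanSpace ℝ (Fin d)) M)
    (hcube : {y : EuclideanSpace ℝ (Fin d) | ∀ i, |y i - p i| ≤ r} ⊆ e.target)
    {w : EuclideanSpace ℝ (Fin d) → ℝ} (hw : w ∈ cubeFunctions p r) :
    chartPull e (fun y => w y / Ω.chartDensity e y) ∈ testFunctions d M :=
  chartPull_mem_testFunctions he (isCompact_cube p r) hcube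
    (fun _ hy => hw.1.contDiffAt.fun_div (contDiffAt_chartDensity Ω he (hcube hy))
      (chartDensity_pos Ω he (hcube hy)).ne')
    fun y hy => by rw [eq_zero_of_notMem_cube hw hy, zero_div]

variable [SecondCountableTopology M]

/-- Coordinate derivatives of functions supported in a chart are, up to the Liouville density,
sums of Poisson brackets. -/
theorem exists_sum_bracketReal_eq_pderiv (he : e ∈ atlas (EuclideanSpace ℝ (Fin d)) M)
    (hcube : {y : EuclideanSpace ℝ (Fin d) | ∀ i, |y i - p i| ≤ r} ⊆ e.target)
    {w : EuclideanSpace ℝ (Fin d) → ℝ} (hw : w ∈ cubeFunctions p r) (b : Fin d) :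
    ∃ F G : Fin d → M → ℝ, (∀ a, F a ∈ testFunctions d M) ∧ (∀ a, G a ∈ testFunctions d M) ∧
      chartPull e (fun y => pderiv b w y / Ω.chartDensity e y)
        = ∑ a, Ω.bracketReal (F a) (G a) := by
  set K : Set (EuclideanSpace ℝ (Fin d)) := {y | ∀ i, |y i - p i| ≤ r} with hKdef
  have hK : IsCompact K := isCompact_cube p r
  have hK' : IsCompact (e.symm '' K) := isCompact_symm_image hK hcube
  have hKs : e.symm '' K ⊆ e.source := by
    rintro _ ⟨y, hy, rfl⟩; exact e.map_target (hcube hy)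
  obtain ⟨χ, hχ, hχ1, hχs, -⟩ := exists_cutoff (d := d) hK' e.open_source hKs
  -- `G a` is the `a`-th coordinate, cut off. With `ρ` the density and `F a = w W_{ba} / ρ`, the
  -- density times `{F a, G a}` is `∑ₖ ∂ₖ(w W_{ba} (W⁻¹)_{ak})` on the cube; summation over `a`
  -- contracts `W W⁻¹` to `δ_{bk}` and leaves `∂_b w`.
  let f : Fin d → EuclideanSpace ℝ (Fin d) → ℝ := fun a y =>
    w y * chartMatrix Ω e y b a / Ω.chartDensity e y
  let F : Fin d → M → ℝ := fun a => chartPull e (f a)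
  let G : Fin d → M → ℝ := fun a => chartPull e fun y => χ (e.symm y) * y a
  have hf0 : ∀ a, ∀ y ∉ K, f a y = 0 := fun a y hy => by
    simp [f, eq_zero_of_notMem_cube hw hy]
  have hF : ∀ a, F a ∈ testFunctions d M := fun a => chartPull_mem_testFunctions he hK hcube
    (fun y hy => (hw.1.contDiffAt.mul (contDiffAt_chartMatrix Ω he (hcube hy) b a)).fun_div
      (contDiffAt_chartDensity Ω he (hcube hy)) (chartDensity_pos Ω he (hcube hy)).ne') (hf0 a)
  have hL : IsCompact (e '' tsupport χ) :=
    hχ.2.isCompact.image_of_continuousOn (e.continuousOn.mono hχs)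
  have hLt : e '' tsupport χ ⊆ e.target := by
    rintro _ ⟨x, hx, rfl⟩; exact e.map_source (hχs hx)
  have hG : ∀ a, G a ∈ testFunctions d M := fun a => by
    classical
    have hG' : G a = chartPull e fun y => if y ∈ e '' tsupport χ then χ (e.symm y) * y a
        else 0 := by
      funext x
      by_cases hx : x ∈ e.source
      · simp only [G, chartPull_of_mem _ hx, e.left_inv hx]
        split_ifs with h
        · rfl
        · rw [image_eq_zero_of_notMem_tsupport fun hn => h ⟨x, hn, rfl⟩, zero_mul]
      · simp only [G, chartPull_of_notMem _ hx]
    rw [hG']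
    refine chartPull_mem_testFunctions he hL hLt (fun y hy => ?_) fun y hy => if_neg hy
    have h1 : ContDiffAt ℝ ∞ (fun y => χ (e.symm y) * y a) y :=
      (contDiffAt_comp_symm he (hLt hy) hχ.1.contMDiffAt).mul (by fun_prop)
    refine h1.congr_of_eventuallyEq ?_
    filter_upwards [e.open_target.mem_nhds (hLt hy)] with z hz
    split_ifs with h
    · rfl
    · rw [image_eq_zero_of_notMem_tsupport fun hn => h ⟨_, hn, e.right_inv hz⟩, zero_mul]
  refine ⟨F, G, hF, hG, ?_⟩
  funext x
  rw [Finset.sum_apply]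
  by_cases hx : x ∈ e.symm '' K
  · obtain ⟨y, hy, rfl⟩ := hx
    have hyt := hcube hy
    have hD := (chartDensity_pos Ω he hyt).ne'
    rw [chartPull_symm _ hyt, div_eq_iff hD, mul_comm, Finset.mul_sum]
    simp only [chartDensity_mul_bracketReal Ω he hyt (hF _).1.contMDiffAt (hG _).1.contMDiffAt]
    -- The cutoff is `1` on a neighbourhood of the cube, so `G a` is the coordinate at the level of
    -- germs, also at boundary points.
    have hcoord : ∀ a, ∀ᶠ z in nhds y, G a ∘ e.symm =ᶠ[nhds z] fun z => z a := by
      intro a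
      have h1 : ∀ᶠ z in nhds (e.symm y), χ z = 1 :=
        eventually_nhdsSet_iff_forall.1 hχ1 _ ⟨y, hy, rfl⟩
      have h2 : ∀ᶠ z in nhds y, (G a ∘ e.symm) z = z a := by
        filter_upwards [e.open_target.mem_nhds hyt, (e.continuousAt_symm hyt).eventually h1]
          with z hz hz1
        simp only [Function.comp_apply, G, chartPull_symm _ hz, hz1, one_mul]
      exact h2.eventually_nhds
    have hpd : ∀ a j, ∀ᶠ z in nhds y, pderiv j (G a ∘ e.symm) z = if j = a then 1 else 0 := by
      intro a j
      filter_upwards [hcoord a] with z hz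
      rw [pderiv_congr hz, pderiv]
      have : HasFDerivAt (fun z : EuclideanSpace ℝ (Fin d) => z a)
          (EuclideanSpace.proj a : EuclideanSpace ℝ (Fin d) →L[ℝ] ℝ) z :=
        (EuclideanSpace.proj a : EuclideanSpace ℝ (Fin d) →L[ℝ] ℝ).hasFDerivAt
      rw [this.fderiv]
      simp [eq_comm]
    have hflux : ∀ a k, (fun z => (∑ j, chartTensor Ω e z j k * pderiv j (G a ∘ e.symm) z) *
        F a (e.symm z)) =ᶠ[nhds y] fun z => chartTensor Ω e z a k * f a z := by
      intro a k
      filter_upwards [e.open_target.mem_nhds hyt, Filter.eventually_all.2 (hpd a)] with z hz hz1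
      simp only [hz1, F, chartPull_symm _ hz]
      simp
    simp only [pderiv_congr (hflux _ _)]
    rw [Finset.sum_comm]
    have hdiff : ∀ k, ∀ a ∈ Finset.univ,
        DifferentiableAt ℝ (fun z => chartTensor Ω e z a k * f a z) y := fun k a _ =>
      ((contDiffAt_chartTensor Ω he hyt a k).mul ((hw.1.contDiffAt.mul
        (contDiffAt_chartMatrix Ω he hyt b a)).fun_div (contDiffAt_chartDensity Ω he hyt)
          hD)).differentiableAt (by simp)
    have hsum : ∀ k, ∑ a, pderiv k (fun z => chartTensor Ω e z a k * f a z) y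
        = if b = k then pderiv k w y else 0 := by
      intro k
      rw [← pderiv_sum (hdiff k)]
      have h1 : (fun z => ∑ a, chartTensor Ω e z a k * f a z)
          =ᶠ[nhds y] fun z => (if b = k then 1 else 0) * w z := by
        filter_upwards [e.open_target.mem_nhds hyt] with z hz
        have hDz := (chartDensity_pos Ω he hz).ne'
        have h2 : ∑ a, chartMatrix Ω e z b a * (chartMatrix Ω e z)⁻¹ a k
            = if b = k then 1 else 0 := by
          rw [← Matrix.mul_apply, Matrix.mul_nonsing_inv _
            (isUnit_iff_ne_zero.2 (det_chartMatrix_ne_zero Ω he hz)), Matrix.one_apply]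
        rw [← h2, Finset.sum_mul]
        refine Finset.sum_congr rfl fun a _ => ?_
        simp only [f, chartTensor, ← chartDensity_eq]
        field_simp
      rw [pderiv_congr h1]
      split_ifs with h
      · simp only [one_mul]
      · simp [pderiv]
    simp only [hsum]
    simp
  · rw [chartPull_eq_zero (K := K) (fun y hy => by
      rw [eq_zero_of_notMem_cube (pderiv_mem_cubeFunctions hw b) hy, zero_div]) hx]
    refine (Finset.sum_eq_zero fun a _ => ?_).symm
    rw [bracketReal_swap, neg_eq_zero]
    by_contra hn
    have hsub : tsupport (F a) ⊆ e.symm '' K := closure_minimal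
      (fun z hz => by
        by_contra hz'
        exact hz (chartPull_eq_zero (hf0 a) hz')) hK'.isClosed
    exact hx (hsub (support_bracketReal_right Ω hn))

variable [MeasurableSpace M] [BorelSpace M]

/-- A linear functional that annihilates all Poisson brackets is locally a multiple of the
Liouville integral. -/
theorem exists_eq_mul_integral_of_cube {ψ : testFunctions d M →ₗ[ℝ] ℂ}
    (hψ : ∀ F G : testFunctions d M, ∀ k : testFunctions d M,
      (k : M → ℝ) = Ω.bracketReal F G → ψ k = 0)
    (he : e ∈ atlas (EuclideanSpace ℝ (Fin d)) M) (hr : 0 < r)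
    (hcube : {y : EuclideanSpace ℝ (Fin d) | ∀ i, |y i - p i| ≤ r} ⊆ e.target) :
    ∃ c : ℂ, ∀ f : testFunctions d M,
      tsupport (f : M → ℝ) ⊆ e.symm '' {y : EuclideanSpace ℝ (Fin d) | ∀ i, |y i - p i| ≤ r} →
        ψ f = c * (∫ x, (f : M → ℝ) x ∂Ω.liouville : ℝ) := by
  obtain ⟨b, hb, hbu⟩ := exists_eq_integral_smul_add_sum_pderiv p hr
  let T : cubeFunctions p r →ₗ[ℝ] ℂ :=
    { toFun := fun u => ψ ⟨_, chartPull_div_mem_testFunctions Ω he hcube u.2⟩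
      map_add' := fun u v => by
        rw [← map_add]
        congr 1
        ext x
        by_cases hx : x ∈ e.source
        · simp [chartPull_of_mem _ hx, add_div]
        · simp [chartPull_of_notMem _ hx]
      map_smul' := fun a u => by
        rw [← map_smul]
        congr 1
        ext x
        by_cases hx : x ∈ e.source
        · simp [chartPull_of_mem _ hx, mul_div_assoc]
        · simp [chartPull_of_notMem _ hx] }
  have hT : ∀ (w : EuclideanSpace ℝ (Fin d) → ℝ) (hw : w ∈ cubeFunctions p r) (k : Fin d),
      T ⟨_, pderiv_mem_cubeFunctions hw k⟩ = 0 := by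
    intro w hw k
    obtain ⟨F, G, hF, hG, hsum⟩ := exists_sum_bracketReal_eq_pderiv Ω he hcube hw k
    have h1 : (⟨_, chartPull_div_mem_testFunctions Ω he hcube (pderiv_mem_cubeFunctions hw k)⟩ :
        testFunctions d M) = ∑ a, ⟨_, bracketReal_mem_testFunctions Ω (hF a).1 (hG a)⟩ := by
      apply Subtype.ext
      rw [AddSubmonoidClass.coe_finsetSum]
      exact hsum
    change ψ _ = 0
    rw [h1, map_sum]
    exact Finset.sum_eq_zero fun a _ => hψ ⟨F a, hF a⟩ ⟨G a, hG a⟩ _ rfl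
  -- `T` kills coordinate derivatives, so the Poincaré lemma gives `T u = (∫ u) T b`; the local
  -- constant is the value on the normalised bump.
  refine ⟨T ⟨b, hb⟩, fun f hf => ?_⟩
  set K : Set (EuclideanSpace ℝ (Fin d)) := {y | ∀ i, |y i - p i| ≤ r} with hKdef
  have hK : IsCompact K := isCompact_cube p r
  have hfe : tsupport (f : M → ℝ) ⊆ e.source := hf.trans (by
    rintro _ ⟨y, hy, rfl⟩; exact e.map_target (hcube hy))
  have hf0 : ∀ y ∈ e.target, y ∉ K → (f : M → ℝ) (e.symm y) = 0 := by
    intro y hy hyK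
    refine image_eq_zero_of_notMem_tsupport fun h => hyK ?_
    obtain ⟨z, hz, hzy⟩ := hf h
    rwa [← e.symm.injOn (hcube hz) hy hzy]
  classical
  let u : EuclideanSpace ℝ (Fin d) → ℝ := fun y => if y ∈ K then
    Ω.chartDensity e y * (f : M → ℝ) (e.symm y) else 0
  have hut : ∀ y ∈ e.target, u y = Ω.chartDensity e y * (f : M → ℝ) (e.symm y) := by
    intro y hy
    by_cases hyK : y ∈ K
    · simp [u, hyK]
    · simp [u, hyK, hf0 y hy hyK]
  have hu : u ∈ cubeFunctions p r := by
    refine ⟨contDiff_of_eq_zero_off_compact hK (fun y hy => ?_) fun y hy => if_neg hy,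
      fun y i hi => if_neg fun h => not_lt.2 (h i) hi⟩
    refine ContDiffAt.congr_of_eventuallyEq ((contDiffAt_chartDensity Ω he (hcube hy)).mul
      (contDiffAt_comp_symm he (hcube hy) f.2.1.contMDiffAt)) ?_
    filter_upwards [e.open_target.mem_nhds (hcube hy)] with z hz using hut z hz
  have hfu : ψ f = T ⟨u, hu⟩ := by
    change ψ f = ψ _
    congr 1
    ext x
    change (f : M → ℝ) x = chartPull e (fun y => u y / Ω.chartDensity e y) x
    by_cases hx : x ∈ e.source
    · have h1 := (chartDensity_pos Ω he (e.map_source hx)).ne'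
      rw [chartPull_of_mem _ hx, hut _ (e.map_source hx), e.left_inv hx,
        mul_div_cancel_left₀ _ h1]
    · rw [chartPull_of_notMem _ hx]
      exact image_eq_zero_of_notMem_tsupport fun h => hx (hfe h)
  obtain ⟨w, hw, hwu⟩ := hbu u hu
  have h1 : (⟨u, hu⟩ : cubeFunctions p r) = (∫ z, u z) • ⟨b, hb⟩
      + ∑ k, ⟨_, pderiv_mem_cubeFunctions (hw k) k⟩ := by
    apply Subtype.ext
    rw [Submodule.coe_add, AddSubmonoidClass.coe_finsetSum]
    funext x
    simpa using hwu x
  have h2 : ∫ z, u z = ∫ x, (f : M → ℝ) x ∂Ω.liouville := by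
    rw [integral_liouville_eq Ω he f.2.1.continuous
      fun x hx => image_eq_zero_of_notMem_tsupport fun h => hx (hfe h),
      ← setIntegral_eq_integral_of_forall_compl_eq_zero
        (s := e.target) fun y hy => if_neg fun h => hy (hcube h)]
    exact setIntegral_congr_fun e.open_target.measurableSet hut
  rw [hfu, h1, map_add, map_sum, Finset.sum_eq_zero fun k _ => hT (w k) (hw k) k, add_zero,
    map_smul, h2, Complex.real_smul, mul_comm]

theorem exists_testFunction_integral_pos {U : Set M} (hU : IsOpen U) {z : M} (hz : z ∈ U) :
    ∃ f : testFunctions d M, tsupport (f : M → ℝ) ⊆ U ∧ (∀ x, 0 ≤ (f : M → ℝ) x) ∧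
      (f : M → ℝ) z = 1 ∧ 0 < ∫ x, (f : M → ℝ) x ∂Ω.liouville := by
  have := liouville_isLocallyFiniteMeasure Ω
  have := liouville_isOpenPosMeasure Ω
  obtain ⟨χ, hχ, h1, hs, h01⟩ := exists_cutoff (d := d) (isCompact_singleton (x := z)) hU
    (Set.singleton_subset_iff.2 hz)
  have hz1 : χ z = 1 := h1.self_of_nhdsSet z rfl
  refine ⟨⟨χ, hχ⟩, hs, fun x => (h01 x).1, hz1, ?_⟩
  exact hχ.1.continuous.integral_pos_of_hasCompactSupport_nonneg_nonzero (x := z) hχ.2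
    (fun x => (h01 x).1) (by simp [hz1])

/-- On a connected symplectic manifold, a linear functional on test functions that annihilates all
Poisson brackets is a multiple of the Liouville integral. -/
theorem exists_eq_mul_integral [ConnectedSpace M] {ψ : testFunctions d M →ₗ[ℝ] ℂ}
    (hψ : ∀ F G : testFunctions d M, ∀ k : testFunctions d M,
      (k : M → ℝ) = Ω.bracketReal F G → ψ k = 0) :
    ∃ c : ℂ, ∀ f : testFunctions d M, ψ f = c * (∫ x, (f : M → ℝ) x ∂Ω.liouville : ℝ) := by
  have := liouville_isLocallyFiniteMeasure Ω
  have hloc : ∀ x : M, ∃ U : Set M, IsOpen U ∧ x ∈ U ∧ ∃ c : ℂ, ∀ f : testFunctions d M,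
      tsupport (f : M → ℝ) ⊆ U → ψ f = c * (∫ x, (f : M → ℝ) x ∂Ω.liouville : ℝ) := by
    intro x
    set e := chartAt (EuclideanSpace ℝ (Fin d)) x
    have he : e ∈ atlas (EuclideanSpace ℝ (Fin d)) M := chart_mem_atlas _ x
    have hx : x ∈ e.source := mem_chart_source _ x
    obtain ⟨ε, hε, hball⟩ := Metric.isOpen_iff.1 e.open_target _ (e.map_source hx)
    obtain ⟨r, hr, hrb⟩ : ∃ r > 0, {y : EuclideanSpace ℝ (Fin d) | ∀ i, |y i - e x i| ≤ r}
        ⊆ Metric.ball (e x) ε := by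
      have h1 : Filter.Tendsto (fun v : Fin d → ℝ => WithLp.toLp 2 v) (nhds (WithLp.ofLp (e x)))
          (nhds (e x)) := (PiLp.continuous_toLp 2 _).tendsto' _ _ rfl
      obtain ⟨δ, hδ, hsub⟩ := Metric.mem_nhds_iff.1 (h1 (Metric.ball_mem_nhds _ hε))
      refine ⟨δ / 2, by positivity, fun y hy => ?_⟩
      have : WithLp.ofLp y ∈ Metric.ball (WithLp.ofLp (e x)) δ := by
        rw [Metric.mem_ball, dist_pi_lt_iff hδ]
        intro i
        have := hy i
        rw [Real.dist_eq]
        linarith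
      exact hsub this
    obtain ⟨c, hc⟩ := exists_eq_mul_integral_of_cube Ω hψ he hr (hrb.trans hball)
    have hV : IsOpen {y : EuclideanSpace ℝ (Fin d) | ∀ i, |y i - e x i| < r} := by
      simp only [Set.ofPred_forall]
      exact isOpen_iInter_of_finite fun i => isOpen_lt (by fun_prop) continuous_const
    refine ⟨e.source ∩ e ⁻¹' {y | ∀ i, |y i - e x i| < r}, e.isOpen_inter_preimage hV,
      ⟨hx, fun i => by simpa using hr⟩, c, fun f hf => hc f (hf.trans ?_)⟩
    rintro z ⟨hz, hz2⟩
    exact ⟨e z, fun i => (hz2 i).le, e.left_inv hz⟩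
  choose U hUo hxU c hc using hloc
  -- A test function with nonzero integral supported in `U x ∩ U z` is evaluated by both local
  -- formulas. Thus `c` is locally constant, and constant by connectedness.
  have hcc : ∀ x, ∀ z ∈ U x, c z = c x := by
    intro x z hz
    obtain ⟨f, hfs, -, -, hfp⟩ := exists_testFunction_integral_pos Ω ((hUo x).inter (hUo z))
      ⟨hz, hxU z⟩
    have h1 := (hc x f (hfs.trans Set.inter_subset_left)).symm.trans
      (hc z f (hfs.trans Set.inter_subset_right))
    exact (mul_right_cancel₀ (Complex.ofReal_ne_zero.2 hfp.ne') h1).symm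
  have hlc : IsLocallyConstant c := (IsLocallyConstant.iff_eventually_eq c).2 fun x => by
    filter_upwards [(hUo x).mem_nhds (hxU x)] with z hz using hcc x z hz
  obtain ⟨x₀⟩ := (inferInstance : Nonempty M)
  refine ⟨c x₀, fun f => ?_⟩
  obtain ⟨t, g, hg, hfg⟩ := exists_sum_subordinate f.2 hUo hxU
  have h1 : f = ∑ i ∈ t.attach, ⟨g i, (hg i i.2).1⟩ := by
    apply Subtype.ext
    rw [AddSubmonoidClass.coe_finsetSum, hfg]
    exact (Finset.sum_attach t g).symm
  have hsum : ∀ i : t, ψ ⟨g i, (hg i i.2).1⟩ = c x₀ * (∫ x, g i x ∂Ω.liouville : ℝ) := by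
    intro i
    rw [hc i _ (hg i i.2).2, hlc.apply_eq_of_isPreconnected isPreconnected_univ
      (Set.mem_univ _) (Set.mem_univ x₀)]
  have hint : ∫ x, (f : M → ℝ) x ∂Ω.liouville = ∑ i ∈ t.attach, ∫ x, g i x ∂Ω.liouville := by
    rw [hfg]
    simp only [Finset.sum_apply]
    rw [integral_finsetSum _ fun i hi =>
      (hg i hi).1.1.continuous.integrable_of_hasCompactSupport (hg i hi).1.2]
    exact (Finset.sum_attach t fun i => ∫ x, g i x ∂Ω.liouville).symm
  rw [hint]
  conv_lhs => rw [h1]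
  rw [map_sum, Finset.sum_congr rfl fun i _ => hsum i, ← Finset.mul_sum]
  push_cast
  rfl

end LocalUniqueness

/-! ### The Gibbs functional: continuity and positivity. -/

section Gibbs

theorem norm_apply_le_norm {X : Type*} [TopologicalSpace X] (f : C₀(X, ℂ)) (x : X) : ‖f x‖ ≤ ‖f‖ :=
  f.toBCF.norm_coe_le_norm x

variable {X : Type*} [TopologicalSpace X] [MeasurableSpace X] [BorelSpace X]
  {μ : Measure X} {ρ : X → ℝ}

theorem integrable_density_mul (hρ : Integrable ρ μ) (f : C₀(X, ℂ)) :
    Integrable (fun x => (ρ x : ℂ) * f x) μ :=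
  hρ.ofReal.mul_bdd (c := ‖f‖) (map_continuous f).measurable.aestronglyMeasurable
    (Filter.Eventually.of_forall (norm_apply_le_norm f))

/-- Integration against an integrable density, as a functional on `C₀(X, ℂ)`. -/
def densityFunctional (hρ : Integrable ρ μ) : C₀(X, ℂ) →L[ℂ] ℂ :=
  LinearMap.mkContinuous
    { toFun := fun f => ∫ x, (ρ x : ℂ) * f x ∂μ
      map_add' := fun f g => by
        rw [← integral_add (integrable_density_mul hρ f) (integrable_density_mul hρ g)]
        simp [mul_add]
      map_smul' := fun c f => by
        simp only [ZeroAtInftyContinuousMap.smul_apply, smul_eq_mul, RingHom.id_apply]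
        rw [← integral_const_mul]
        congr 1
        funext x
        ring }
    (∫ x, ‖ρ x‖ ∂μ) fun f => by
      calc ‖∫ x, (ρ x : ℂ) * f x ∂μ‖ ≤ ∫ x, ‖ρ x‖ * ‖f‖ ∂μ := by
            refine norm_integral_le_of_norm_le (hρ.norm.mul_const _)
              (Filter.Eventually.of_forall fun x => ?_)
            rw [norm_mul, Complex.norm_real]
            gcongr
            exact norm_apply_le_norm f x
        _ = _ := integral_mul_const _ _

theorem densityFunctional_apply (hρ : Integrable ρ μ) (f : C₀(X, ℂ)) :
    densityFunctional hρ f = ∫ x, (ρ x : ℂ) * f x ∂μ := rfl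

theorem densityFunctional_star_mul_self_nonneg (hρ : Integrable ρ μ) (h0 : ∀ x, 0 ≤ ρ x)
    (f : C₀(X, ℂ)) : 0 ≤ densityFunctional hρ (star f * f) := by
  rw [densityFunctional_apply]
  have h1 : ∀ x, (ρ x : ℂ) * (star f * f : C₀(X, ℂ)) x = ((ρ x * Complex.normSq (f x) : ℝ) : ℂ) := by
    intro x
    rw [ZeroAtInftyContinuousMap.mul_apply, ZeroAtInftyContinuousMap.star_apply]
    push_cast
    rw [Complex.normSq_eq_conj_mul_self]
    rfl
  simp only [h1]
  rw [integral_complex_ofReal]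
  exact Complex.zero_le_real.2 (integral_nonneg fun x => mul_nonneg (h0 x) (Complex.normSq_nonneg _))

end Gibbs

/-! ### Automatic continuity. -/

section PositiveFunctional

/-- Positive functionals on `C₀(X, ℂ)` are continuous. -/
theorem continuous_of_star_mul_self_nonneg {X : Type*} [TopologicalSpace X]
    (Ψ : C₀(X, ℂ) →ₗ[ℂ] ℂ) (hΨ : ∀ f, 0 ≤ Ψ (star f * f)) : Continuous Ψ := by
  -- In the spectral order of the C*-algebra the nonnegative elements are exactly the `star s * s`,
  -- so the hypothesis makes `Ψ` a positive map, and such maps are bounded.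
  let _ : PartialOrder C₀(X, ℂ) := CStarAlgebra.spectralOrder _
  have _ : StarOrderedRing C₀(X, ℂ) := CStarAlgebra.spectralOrderedRing _
  let P : C₀(X, ℂ) →ₚ[ℂ] ℂ := PositiveLinearMap.mk₀ Ψ fun f hf => by
    obtain ⟨s, rfl⟩ := CStarAlgebra.nonneg_iff_eq_star_mul_self.1 hf
    exact hΨ s
  obtain ⟨C, hC⟩ := PositiveLinearMap.exists_norm_apply_le P
  exact (LinearMap.mkContinuous Ψ C hC).continuous

end PositiveFunctional

/-! ### Uniform density of the smooth compactly supported functions. -/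

section Density

variable {d : ℕ} {M : Type*} [TopologicalSpace M] [ChartedSpace (EuclideanSpace ℝ (Fin d)) M]
  [IsManifold (𝓡 d) ∞ M] [T2Space M] [SecondCountableTopology M]

/-- Takes a smooth `g` with `|f - g| < ε` and a cutoff `χ` equal to `1` where `|f| ≥ ε`. Then `f - χ
g = χ (f - g) + (1 - χ) f`, which off the compact set is a convex combination of two terms smaller
than `ε`. -/
theorem exists_smoothCompact_dist_le (f : C₀(M, ℂ)) {ε : ℝ} (hε : 0 < ε) :
    ∃ g ∈ smoothCompact d M, dist f g ≤ ε := by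
  have : LocallyCompactSpace M := ChartedSpace.locallyCompactSpace (EuclideanSpace ℝ (Fin d)) M
  obtain ⟨g, hg⟩ := exists_contMDiffMap_forall_mem_convex_of_local_const (𝓡 d) (n := ⊤)
    (t := fun x => Metric.ball (f x) ε) (fun x => convex_ball _ _) fun x => ⟨f x, by
      filter_upwards [(map_continuous f).continuousAt.eventually (Metric.ball_mem_nhds (f x) hε)]
        with z hz
      exact Metric.mem_ball_comm.1 hz⟩
  obtain ⟨K, hK, hKf⟩ := Filter.mem_cocompact.1 (f.zero_at_infty' (Metric.ball_mem_nhds 0 hε))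
  obtain ⟨χ, hχ, hχ1, -, h01⟩ := exists_cutoff (d := d) hK isOpen_univ (Set.subset_univ K)
  have hs : ContMDiff (𝓡 d) 𝓘(ℝ, ℂ) ∞ fun x => (χ x : ℂ) * g x :=
    (contDiff_mul (𝕜 := ℝ) (𝔸 := ℂ)).contMDiff.comp ((contMDiff_ofReal hχ.1).prodMk_space g.contMDiff)
  have hc : HasCompactSupport fun x => (χ x : ℂ) * g x :=
    HasCompactSupport.mul_right (f := fun x => (χ x : ℂ)) (hχ.2.comp_left Complex.ofReal_zero)
  refine ⟨ofCompactSupport _ hs.continuous hc, ⟨hs, hc⟩, ?_⟩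
  rw [← ZeroAtInftyContinuousMap.dist_toBCF_eq_dist, BoundedContinuousFunction.dist_le hε.le]
  intro x
  change dist (f x) ((χ x : ℂ) * g x) ≤ ε
  have hgx : ‖f x - g x‖ < ε := by
    have := hg x
    rwa [Metric.mem_ball, dist_comm, dist_eq_norm] at this
  rw [dist_eq_norm]
  by_cases hx : x ∈ K
  · have h1 : χ x = 1 := hχ1.self_of_nhdsSet x hx
    rw [h1, Complex.ofReal_one, one_mul]
    exact hgx.le
  · have hfx : ‖f x‖ < ε := by simpa using hKf hx
    have h2 : f x - (χ x : ℂ) * g x = (χ x : ℂ) * (f x - g x) + ((1 - χ x : ℝ) : ℂ) * f x := by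
      push_cast; ring
    rw [h2]
    refine (norm_add_le _ _).trans ?_
    rw [norm_mul, norm_mul, Complex.norm_real, Complex.norm_real,
      Real.norm_of_nonneg (h01 x).1, Real.norm_of_nonneg (sub_nonneg.2 (h01 x).2)]
    nlinarith [(h01 x).1, (h01 x).2]

theorem dense_preimage_smoothCompact {A : NonUnitalStarSubalgebra ℂ C₀(M, ℂ)}
    (hA : smoothCompact d M ≤ A) : Dense {f : A | (f : C₀(M, ℂ)) ∈ smoothCompact d M} := by
  refine Metric.dense_iff.2 fun f ε hε => ?_
  obtain ⟨g, hg, hfg⟩ := exists_smoothCompact_dist_le (d := d) (f : C₀(M, ℂ)) (half_pos hε)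
  refine ⟨⟨g, hA hg⟩, ?_, hg⟩
  rw [Metric.mem_ball, dist_comm]
  exact hfg.trans_lt (half_lt_self hε)

theorem dense_smoothCompact : Dense (smoothCompact d M : Set C₀(M, ℂ)) := by
  refine Metric.dense_iff.2 fun f ε hε => ?_
  obtain ⟨g, hg, hfg⟩ := exists_smoothCompact_dist_le (d := d) f (half_pos hε)
  refine ⟨g, ?_, hg⟩
  rw [Metric.mem_ball, dist_comm]
  exact hfg.trans_lt (half_lt_self hε)

end Density

/-! ### KMS functionals on the smooth compactly supported functions. -/

section Uniqueness

variable {d : ℕ} {M : Type*} [TopologicalSpace M] [ChartedSpace (EuclideanSpace ℝ (Fin d)) M]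
  (Ω : SymplecticForm d M)

/-- A real test function as an element of the algebra of smooth compactly supported functions. -/
def testEmbed (f : testFunctions d M) : smoothCompact d M :=
  ⟨ofCompactSupport (fun x => ((f : M → ℝ) x : ℂ)) (contMDiff_ofReal f.2.1).continuous
    (f.2.2.comp_left Complex.ofReal_zero),
    contMDiff_ofReal f.2.1, f.2.2.comp_left Complex.ofReal_zero⟩

theorem testEmbed_apply (f : testFunctions d M) (x : M) :
    (testEmbed f : C₀(M, ℂ)) x = ((f : M → ℝ) x : ℂ) := rfl

theorem smoothCompact_ext {f g : smoothCompact d M}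
    (h : ∀ x, (f : C₀(M, ℂ)) x = (g : C₀(M, ℂ)) x) : f = g :=
  Subtype.ext (ZeroAtInftyContinuousMap.ext h)

theorem bracket_ofReal (F G : M → ℝ) (x : M) :
    Ω.bracket (fun z => (F z : ℂ)) (fun z => (G z : ℂ)) x = (Ω.bracketReal F G x : ℂ) := by
  have h1 : Ω.bracketReal (fun _ => 0) (fun _ => 0) x = 0 := bracketReal_const_right Ω 0
  have h2 : Ω.bracketReal F (fun _ => 0) x = 0 := bracketReal_const_right Ω 0
  have h3 : Ω.bracketReal (fun _ => 0) G x = 0 := by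
    rw [bracketReal_swap, bracketReal_const_right, neg_zero]
  simp [SymplecticForm.bracket, h1, h2, h3]

/-- Multiplication of test functions by `exp (b h)`. -/
def mulExp {h : M → ℝ} (hh : ContMDiff (𝓡 d) 𝓘(ℝ, ℝ) ∞ h) (b : ℝ) (f : testFunctions d M) :
    testFunctions d M :=
  ⟨fun x => Real.exp (b * h x) * (f : M → ℝ) x, mul_mem_testFunctions (contMDiff_exp_mul hh b) f.2⟩

theorem mulExp_apply {h : M → ℝ} (hh : ContMDiff (𝓡 d) 𝓘(ℝ, ℝ) ∞ h) (b : ℝ)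
    (f : testFunctions d M) (x : M) :
    (mulExp hh b f : M → ℝ) x = Real.exp (b * h x) * (f : M → ℝ) x := rfl

/-- The functional `f ↦ φ (exp (b h) f)` on real test functions. -/
def twistedFunctional {h : M → ℝ} (hh : ContMDiff (𝓡 d) 𝓘(ℝ, ℝ) ∞ h) (b : ℝ)
    (φ : smoothCompact d M →ₗ[ℂ] ℂ) : testFunctions d M →ₗ[ℝ] ℂ where
  toFun f := φ (testEmbed (mulExp hh b f))
  map_add' f g := by
    rw [← map_add]
    congr 1
    refine smoothCompact_ext fun x => ?_
    change ((Real.exp (b * h x) * ((f : M → ℝ) x + (g : M → ℝ) x) : ℝ) : ℂ)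
      = ((Real.exp (b * h x) * (f : M → ℝ) x : ℝ) : ℂ)
        + ((Real.exp (b * h x) * (g : M → ℝ) x : ℝ) : ℂ)
    push_cast
    ring
  map_smul' c f := by
    rw [RingHom.id_apply, Complex.real_smul, ← smul_eq_mul, ← map_smul]
    congr 1
    refine smoothCompact_ext fun x => ?_
    change ((Real.exp (b * h x) * (c * (f : M → ℝ) x) : ℝ) : ℂ)
      = (c : ℂ) * ((Real.exp (b * h x) * (f : M → ℝ) x : ℝ) : ℂ)
    push_cast
    ring

variable [IsManifold (𝓡 d) ∞ M] [T2Space M] [SecondCountableTopology M]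
  [MeasurableSpace M] [BorelSpace M] {h : M → ℝ} {β : ℝ}

omit [T2Space M] [SecondCountableTopology M] [MeasurableSpace M] [BorelSpace M] in
-- The KMS condition for the pair `F`, `e^{βh} G`: since `{F, e^{βh} G} = e^{βh} {F, G} + β {F, h}
-- e^{βh} G`, it cancels the last term and leaves `φ(e^{βh} {F, G}) = 0`.
theorem twistedFunctional_bracketReal (hh : ContMDiff (𝓡 d) 𝓘(ℝ, ℝ) ∞ h)
    {φ : smoothCompact d M →ₗ[ℂ] ℂ}
    (hφ : IsKMSFunctional Ω (Ω.hamiltonianField h) β (smoothCompact d M) φ)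
    {F G k : testFunctions d M} (hk : (k : M → ℝ) = Ω.bracketReal F G) :
    twistedFunctional hh β φ k = 0 := by
  have hE := bracketReal_mem_testFunctions Ω F.2.1 (mulExp hh β G).2
  have hL := mul_mem_testFunctions (contMDiff_bracketReal Ω F.2.1 hh) (mulExp hh β G).2
  have h1 := hφ.kms (testEmbed F) (testEmbed (mulExp hh β G)) (testEmbed ⟨_, hE⟩)
    (testEmbed ⟨_, hL⟩) (fun x => (bracket_ofReal Ω _ _ x).symm) fun x => by
      rw [vectorFieldApply_hamiltonianField Ω (testEmbed F).2.1]
      have h2 : Ω.bracketReal (fun z => ((testEmbed F : C₀(M, ℂ)) z).im) h x = 0 := by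
        have : (fun z => ((testEmbed F : C₀(M, ℂ)) z).im) = fun _ => 0 := by
          funext z; rw [testEmbed_apply, Complex.ofReal_im]
        rw [this, bracketReal_swap, bracketReal_const_right, neg_zero]
      have h3 : (fun z => ((testEmbed F : C₀(M, ℂ)) z).re) = F := by
        funext z; rw [testEmbed_apply, Complex.ofReal_re]
      rw [h2, h3]
      change ((Ω.bracketReal F h x * (mulExp hh β G : M → ℝ) x : ℝ) : ℂ)
        = (_ + _) * ((mulExp hh β G : M → ℝ) x : ℂ)
      push_cast
      ring
  have h4 : testEmbed ⟨_, hE⟩ = testEmbed (mulExp hh β k) + (β : ℂ) • testEmbed ⟨_, hL⟩ := by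
    refine smoothCompact_ext fun x => ?_
    change ((Ω.bracketReal F (fun z => Real.exp (β * h z) * (G : M → ℝ) z) x : ℝ) : ℂ)
      = ((Real.exp (β * h x) * (k : M → ℝ) x : ℝ) : ℂ)
        + (β : ℂ) * ((Ω.bracketReal F h x * (Real.exp (β * h x) * (G : M → ℝ) x) : ℝ) : ℂ)
    rw [bracketReal_exp_mul Ω G.2.1 hh, hk]
    push_cast
    ring
  rw [h4, map_add, map_smul, smul_eq_mul, add_eq_right] at h1
  exact h1

/-- A KMS functional on the smooth compactly supported functions is a nonnegative multiple of the
Gibbs functional. -/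
theorem exists_eq_mul_densityFunctional [ConnectedSpace M] (hh : ContMDiff (𝓡 d) 𝓘(ℝ, ℝ) ∞ h)
    (hint : Integrable (fun x => Real.exp (-β * h x)) Ω.liouville)
    {φ : smoothCompact d M →ₗ[ℂ] ℂ}
    (hφ : IsKMSFunctional Ω (Ω.hamiltonianField h) β (smoothCompact d M) φ) :
    ∃ c : ℝ, 0 ≤ c ∧ ∀ f : smoothCompact d M, φ f = c * densityFunctional hint f.1 := by
  have hlf := liouville_isLocallyFiniteMeasure Ω
  have hop := liouville_isOpenPosMeasure Ω
  obtain ⟨c, hc⟩ := exists_eq_mul_integral Ω (ψ := twistedFunctional hh β φ)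
    fun F G k hk => twistedFunctional_bracketReal Ω hh hφ hk
  have hreal : ∀ f : testFunctions d M, φ (testEmbed f)
      = c * (∫ x, Real.exp (-β * h x) * (f : M → ℝ) x ∂Ω.liouville : ℝ) := by
    intro f
    have h1 : testEmbed f = testEmbed (mulExp hh β (mulExp hh (-β) f)) := by
      refine smoothCompact_ext fun x => ?_
      rw [testEmbed_apply, testEmbed_apply, mulExp_apply, mulExp_apply, ← mul_assoc,
        ← Real.exp_add]
      simp
    rw [h1]
    exact hc _
  have hall : ∀ f : smoothCompact d M, φ f = c * densityFunctional hint f.1 := by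
    intro f
    let f1 : testFunctions d M := ⟨fun x => ((f : C₀(M, ℂ)) x).re, contMDiff_re f.2.1,
      f.2.2.comp_left (g := Complex.re) Complex.zero_re⟩
    let f2 : testFunctions d M := ⟨fun x => ((f : C₀(M, ℂ)) x).im, contMDiff_im f.2.1,
      f.2.2.comp_left (g := Complex.im) Complex.zero_im⟩
    have hf : f = testEmbed f1 + Complex.I • testEmbed f2 := by
      refine smoothCompact_ext fun x => ?_
      change (f : C₀(M, ℂ)) x = (((f : C₀(M, ℂ)) x).re : ℂ)
        + Complex.I * (((f : C₀(M, ℂ)) x).im : ℂ)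
      rw [mul_comm, Complex.re_add_im]
    have hi : ∀ g : testFunctions d M, densityFunctional hint (testEmbed g).1
        = (∫ x, Real.exp (-β * h x) * (g : M → ℝ) x ∂Ω.liouville : ℝ) := by
      intro g
      rw [densityFunctional_apply, ← integral_complex_ofReal]
      refine integral_congr_ae (Filter.Eventually.of_forall fun x => ?_)
      change (Real.exp (-β * h x) : ℂ) * ((g : M → ℝ) x : ℂ) = _
      push_cast
      rfl
    have hsplit : densityFunctional hint f.1 = densityFunctional hint (testEmbed f1).1
        + Complex.I * densityFunctional hint (testEmbed f2).1 := by
      conv_lhs => rw [hf]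
      change densityFunctional hint ((testEmbed f1).1 + Complex.I • (testEmbed f2).1) = _
      rw [map_add, map_smul, smul_eq_mul]
    rw [hsplit, hi, hi]
    conv_lhs => rw [hf]
    rw [map_add, map_smul, smul_eq_mul, hreal, hreal]
    ring
  obtain ⟨z⟩ := (inferInstance : Nonempty M)
  obtain ⟨f, -, hf0, hfz, -⟩ := exists_testFunction_integral_pos Ω isOpen_univ (Set.mem_univ z)
  have hpos : 0 < ∫ x, Real.exp (-β * h x) * ((f : M → ℝ) x * (f : M → ℝ) x) ∂Ω.liouville := by
    have hm := mul_mem_testFunctions (contMDiff_exp_mul hh (-β)) (mul_mem_testFunctions f.2.1 f.2)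
    exact hm.1.continuous.integral_pos_of_hasCompactSupport_nonneg_nonzero (x := z) hm.2
      (fun x => mul_nonneg (Real.exp_pos _).le (mul_self_nonneg _)) (by
        simp [hfz])
  have hstar : star (testEmbed f) * testEmbed f
      = testEmbed ⟨_, mul_mem_testFunctions f.2.1 f.2⟩ := by
    refine smoothCompact_ext fun x => ?_
    change star ((f : M → ℝ) x : ℂ) * ((f : M → ℝ) x : ℂ)
      = (((f : M → ℝ) x * (f : M → ℝ) x : ℝ) : ℂ)
    push_cast
    congr 1
    exact Complex.conj_ofReal _
  -- Positivity on one square: `c` times a positive number is nonnegative in the complex order,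
  -- which yields both `c.re ≥ 0` and `c.im = 0`.
  have hp := hφ.positive (testEmbed f)
  rw [hstar, hreal, Complex.le_def] at hp
  simp only [Complex.zero_re, Complex.zero_im, Complex.mul_re, Complex.mul_im, Complex.ofReal_re,
    Complex.ofReal_im, mul_zero, sub_zero, zero_add] at hp
  refine ⟨c.re, nonneg_of_mul_nonneg_left hp.1 hpos, fun f => ?_⟩
  have him : c.im = 0 := (mul_eq_zero.1 hp.2.symm).resolve_right hpos.ne'
  have hcr : ((c.re : ℝ) : ℂ) = c := Complex.ext rfl (by simp [him])
  rw [hcr]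
  exact hall f

end Uniqueness

end ClassicalKMS

end

/-! ### The main theorem. -/

theorem proposition2p3 {d : ℕ} {M : Type*} [TopologicalSpace M]
    [ChartedSpace (EuclideanSpace ℝ (Fin d)) M] [IsManifold (𝓡 d) ∞ M]
    [T2Space M] [SecondCountableTopology M] [ConnectedSpace M]
    [MeasurableSpace M] [BorelSpace M]
    (Ω : ClassicalKMS.SymplecticForm d M)
    (h : M → ℝ) (hh : ContMDiff (𝓡 d) 𝓘(ℝ, ℝ) ∞ h)
    (β : ℝ) (hβ : 0 < β)
    (hint : MeasureTheory.Integrable (fun x => Real.exp (-β * h x)) Ω.liouville) :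
    ∃ Φ : C₀(M, ℂ) →L[ℂ] ℂ,
      -- the Gibbs functional, a positive functional on `C₀(M, ℂ)`
      (∀ f : C₀(M, ℂ), Φ f = ∫ x, (Real.exp (-β * h x) : ℂ) * f x ∂Ω.liouville) ∧
      (∀ f : C₀(M, ℂ), 0 ≤ Φ (star f * f)) ∧
      -- on `C_c^∞`, the KMS functionals are exactly its nonnegative multiples
      (∀ φ : ClassicalKMS.smoothCompact d M →ₗ[ℂ] ℂ,
        ClassicalKMS.IsKMSFunctional Ω (Ω.hamiltonianField h) β
            (ClassicalKMS.smoothCompact d M) φ ↔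
          ∃ c : ℝ, 0 ≤ c ∧ ∀ f : ClassicalKMS.smoothCompact d M, φ f = c * Φ f.1) ∧
      ∀ A : NonUnitalStarSubalgebra ℂ C₀(M, ℂ), ClassicalKMS.IsPoissonStarSubalgebra Ω A →
        ∀ hA : ClassicalKMS.smoothCompact d M ≤ A,
          -- on `A`, it is a KMS functional
          ClassicalKMS.IsKMSFunctional Ω (Ω.hamiltonianField h) β A
            (ClassicalKMS.restrictTo A Φ.toLinearMap) ∧
          -- every KMS functional on `A` that is continuous in the uniform norm is a nonnegative
          -- multiple, even if positivity and the KMS condition are only required on `C_c^∞`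
          (∀ φ : A →ₗ[ℂ] ℂ, Continuous φ →
            ClassicalKMS.IsKMSFunctional Ω (Ω.hamiltonianField h) β
              (ClassicalKMS.smoothCompact d M) (ClassicalKMS.restrictFunctional hA φ) →
            ∃ c : ℝ, 0 ≤ c ∧ ∀ f : A, φ f = c * Φ f.1) ∧
          -- its restriction to `A` has only one extension to `C₀(M, ℂ)` that is continuous or
          -- positive
          (∀ Ψ : C₀(M, ℂ) →ₗ[ℂ] ℂ,
            (Continuous Ψ ∨ ∀ f : C₀(M, ℂ), 0 ≤ Ψ (star f * f)) →
            (∀ f ∈ A, Ψ f = Φ f) → ∀ f, Ψ f = Φ f) := by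
  have hkms : ∀ A : NonUnitalStarSubalgebra ℂ C₀(M, ℂ), ClassicalKMS.IsPoissonStarSubalgebra Ω A →
      ClassicalKMS.IsKMSFunctional Ω (Ω.hamiltonianField h) β A
        (ClassicalKMS.restrictTo A (ClassicalKMS.densityFunctional hint).toLinearMap) :=
    fun A hA =>
      { positive := fun f => ClassicalKMS.densityFunctional_star_mul_self_nonneg hint
          (fun x => (Real.exp_pos _).le) f.1
        kms := fun f g k l hk hl => ClassicalKMS.integral_exp_mul_kms Ω hh hint hA f.2 g.2 hk hl }
  refine ⟨ClassicalKMS.densityFunctional hint, fun f => rfl,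
    ClassicalKMS.densityFunctional_star_mul_self_nonneg hint fun x => (Real.exp_pos _).le,
    fun φ => ⟨ClassicalKMS.exists_eq_mul_densityFunctional Ω hh hint, ?_⟩,
    fun A hAP hA => ⟨hkms A hAP, ?_, ?_⟩⟩
  · rintro ⟨c, hc, hφ⟩
    have hK := hkms _ (ClassicalKMS.isPoissonStarSubalgebra_smoothCompact Ω)
    refine ⟨fun f => ?_, fun f g k l hk hl => ?_⟩
    · rw [hφ]
      exact mul_nonneg (Complex.zero_le_real.2 hc) (hK.positive f)
    · have h1 : ClassicalKMS.densityFunctional hint k.1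
          = β * ClassicalKMS.densityFunctional hint l.1 := hK.kms f g k l hk hl
      rw [hφ, hφ, h1]
      ring
  · intro φ hφc hφ
    obtain ⟨c, hc, hcφ⟩ := ClassicalKMS.exists_eq_mul_densityFunctional Ω hh hint hφ
    refine ⟨c, hc, fun f => ?_⟩
    have h1 : Continuous fun f : A => (c : ℂ) * ClassicalKMS.densityFunctional hint f.1 :=
      continuous_const.mul ((ClassicalKMS.densityFunctional hint).continuous.comp
        continuous_subtype_val)
    exact congrFun (Continuous.ext_on (ClassicalKMS.dense_preimage_smoothCompact hA) hφc h1
      fun f hf => hcφ ⟨f.1, hf⟩) f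
  · intro Ψ hΨ hΨA f
    have hc : Continuous Ψ := hΨ.elim id (ClassicalKMS.continuous_of_star_mul_self_nonneg Ψ)
    exact congrFun (Continuous.ext_on (ClassicalKMS.dense_smoothCompact (d := d)) hc
      (ClassicalKMS.densityFunctional hint).continuous fun f hf => hΨA f (hA hf)) f
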